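/- **Setting.** All spaces and algebras are complex, algebras are unital. *Quantum group and coordinate forms.* Let $\mathcal A$ be a Hopf $*$-algebra (coproduct $\phi$, counit $\epsilon$, antipode $\kappa$) with a positive faithful bi-invariant Haar functional $h$, $h(1)=1$. Let $\mathbb V$ be the left-invariant part of a $*$-covariant bicovariant bimodule over $\mathcal A$, with basis $\theta_1,\dots,\theta_d$, right coaction $\varkappa(\theta_i)=\sum_j\theta_j\otimes\varkappa_{ji}$ with $[\varkappa_{ij}]$ unitary, and right $\mathcal A$-module structure $\theta_i\circ a=\sum_j\nu_{ij}(a)\theta_j$, compatible in the sense that $\sum_k \nu_{ik}(a^{(2)})\,a^{(1)}\varkappa_{jk}=\sum_k\nu_{kj}(a^{(1)})\,\varkappa_{ki}a^{(2)}$ for all $a,i,j$. Let $\theta_i^*=\sum_j[C^{-1/2}]_{ji}\theta_j$, where $C^{1/2}$ is a positive definite matrix with $\overline{C^{1/2}}=C^{-1/2}$, $C^{1/2}\varkappa C^{-1/2}=\overline\varkappa$ and $\nu(\kappa(a)^*)=C^{-1/2}\overline{\nu(a)}C^{1/2}$. Put $\tau(\theta_i\otimes\theta_j)=\sum_k\theta_k\otimes(\theta_i\circ\varkappa_{kj})$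 and $\mathbb V^\wedge=\mathbb V^\otimes/(\mathrm{im}(I+\tau))$, with the induced $\circ$, $\varkappa$ and $*$. *Metric.* Let $\sigma$ be an invertible solution of the braid equation on $\mathbb V\otimes\mathbb V$ with $*\sigma=\sigma*$ (where $(x\otimes y)^*=y^*\otimes x^*$), $\Sigma$ a $*$-algebra, and $g\colon\mathbb V\otimes\mathbb V\to\Sigma$ linear, $g_{ij}=g(\theta_i,\theta_j)$, with $g\sigma=g$, $g(x,y)^*=g(y^*,x^*)$, $g\otimes g=(g\otimes g)(\mathrm{id}\otimes\sigma\otimes\mathrm{id})(\sigma^{-1}\otimes\sigma)(\mathrm{id}\otimes\sigma^{-1}\otimes\mathrm{id})$, $[g_{ij}]$ invertible over $\Sigma$, and $\Sigma$ generated by the entries of $[g_{ij}]$ and its inverse. Let $\nu_\Sigma\colon\Sigma\to M_d(\Sigma)$ be a unital homomorphism with $\nu_\Sigma(\mathrm{id}\otimes g)=(g\otimes\mathrm{id})(\mathrm{id}\otimes\sigma)(\sigma^{-1}\otimes\mathrm{id})$, giving the bimodule $\mathbb V_\Sigma=\Sigma\otimes\mathbb V$ by $\theta_iq=\sum_j\nu_\Sigma(q)_{ij}\theta_j$;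 assume that $\tau$ extends $\Sigma$-bilinearly to $\mathbb V_\Sigma\otimes_\Sigma\mathbb V_\Sigma$, that $\mathbb V^\wedge=\mathbb V^\otimes/\ker A_\sigma$ with $A_\sigma=\sum_\pi\mathrm{sgn}(\pi)\sigma_\pi$ the total braided antisymmetrizer (so that $A_\sigma$ induces an embedding $\mathbb V^\wedge\leftrightarrow\mathrm{im}(A_\sigma)\subseteq\mathbb V^\otimes$), and that $\Sigma$ is a right $\mathcal A$-module algebra with $g(x,y)\circ a=g(x\circ a^{(1)},y\circ a^{(2)})$. Let $\mathbb V_\Sigma^\wedge=\Sigma\otimes\mathbb V^\wedge$ be the resulting twisted tensor product algebra, with the involution $(q\otimes\eta)^*=\eta^*q^*$ where $(\vartheta\eta)^*=\eta^*\vartheta^*$. For $x\in\mathbb V$ let $\iota[x]\psi=(g\otimes\mathrm{id})(x\otimes\psi)$, with $\psi\in\mathbb V_\Sigma^\wedge$ realized in the tensor algebra by the above embedding. Let $g_\wedge(\psi,\xi)=g(\psi,A_\sigma\xi)$, where $g$ is extended $\Sigma$-bilinearly by $g(\psi\otimes x,y\otimes\xi)=g(\psi,g(x,y)\xi)$, different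 degrees being orthogonal. *Bundle.* Let $\mathcal B$ be a $*$-algebra, $F\colon\mathcal B\to\mathcal B\otimes\mathcal A$ a coassociative, counital $*$-homomorphism such that the elements $(q\otimes1)F(b)$ span $\mathcal B\otimes\mathcal A$; put $\mathcal V=\{b: F(b)=b\otimes1\}$. Let $\mathfrak{hor}_P=\mathcal B\otimes\mathbb V^\wedge$, with $(q\otimes\vartheta)(b\otimes\eta)=\sum_kqb_k\otimes(\vartheta\circ c_k)\eta$, where $F(b)=\sum_kb_k\otimes c_k$, with $(b\otimes\vartheta)^*=\sum_kb_k^*\otimes(\vartheta^*\circ c_k^*)$ where here $*$ on $\mathbb V^\wedge$ is graded-antimultiplicative, and with the combined action $F^\wedge$ of $F$ and $\varkappa$. Let $\mathfrak{hor}_{P,\Sigma}=\mathcal B\otimes\mathbb V_\Sigma^\wedge$, with the product given by the same formula, and with the operation $(b\otimes\vartheta)^*=\sum_kb_k^*\otimes(\vartheta^*\circ c_k^*)$ built from the ungraded involution of $\mathbb V_\Sigma^\wedge$. *Frame structure.* Let $\nabla$ be a first-order, hermitian, $F^\wedge$-covariant antiderivation of $\mathfrak{hor}_P$ with $\nabla(\nabla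 f)=0$ for $f\in\mathcal V$ and $\nabla(\theta_i)=0$, and let $b_{\alpha i}\in\mathcal B$, $f_\alpha\in\mathcal V$ (finitely many $\alpha$) satisfy $1\otimes\theta_i=\sum_\alpha b_{\alpha i}\nabla(f_\alpha)$ and $F(b_{\alpha i})=\sum_jb_{\alpha j}\otimes\varkappa_{ji}$. Define $\partial_i\colon\mathcal B\to\mathcal B$ by $\nabla(b)=\sum_i\partial_i(b)\otimes\theta_i$, and extend $\nabla$ to $\mathfrak{hor}_{P,\Sigma}$ by $\nabla(b\otimes\vartheta)=\nabla(b)\vartheta$. Let $\varrho_\nabla\colon\mathcal A\to\mathfrak{hor}_P^2$ be the curvature: $\nabla^2(b)=-\sum_kb_k\varrho_\nabla(c_k)$; its components are defined by $\varrho_\nabla(a)=\frac12\sum_{ij}\varrho_\nabla^{ij}(a)\otimes\{\theta_i\otimes\theta_j\}$ through $\mathbb V^{\wedge2}\leftrightarrow\mathrm{im}(A_\sigma)$. *Measure.* Let $\mathcal V$ be a dense $*$-subalgebra of a unital $C^*$-algebra $\widehat{\mathcal V}$ with a faithful state $\omega_M$. Let $\int_\uparrow=(\mathrm{id}\otimes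 h)F\colon\mathcal B\to\mathcal V$ satisfy $\int_\uparrow b^*b\ge0$, with equality only for $b=0$. With $C=(C^{1/2})^2$, suppose $\omega_M\bigl(\sum_{ij}C_{ji}\,\partial_i(b_{\alpha j}f)\bigr)=0$ for all $\alpha$ and all $f\in\mathcal V$. Put $\omega_P=\omega_M\int_\uparrow$, and equip $\mathfrak{hor}_{P,\Sigma}$ with the $\Sigma$-valued scalar product $$\langle b\otimes\vartheta,q\otimes\eta\rangle=\omega_P(b^*q)\,g_\wedge(\vartheta^*,\eta).$$ **Proposition.** (a) Suppose $\mathbb V^{\wedge m}=\mathbb C w$ with $w\ne0$ and $\mathbb V^{\wedge k}=0$ for $k>m$. Let $j(x,y)w$ be the top component of $xy$ ($x,y\in\mathbb V_\Sigma^\wedge$), let $\star$ be a linear operator on $\mathbb V_\Sigma^\wedge$ with $g_\wedge(x,y)=j(x,\star y)$, let $\star_P=\mathrm{id}\otimes\star$, and let $\int_P(b\otimes qw)=\omega_P(b)q$, with $\int_P$ vanishing on forms of degree less than $m$. Then $\langle\varphi,\psi\rangle=\int_P\varphi^*\star_P\psi$ for all $\varphi,\psi\in\mathfrak{hor}_{P,\Sigma}$.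 (b) There is a unique linear map $\nabla^\dagger\colon\mathfrak{hor}_{P,\Sigma}\to\mathfrak{hor}_{P,\Sigma}$ with $\langle\varphi,\nabla\psi\rangle=\langle\nabla^\dagger\varphi,\psi\rangle$ for all $\varphi,\psi\in\mathfrak{hor}_{P,\Sigma}$. The quantum Laplacian $\Delta_P=\nabla\nabla^\dagger+\nabla^\dagger\nabla$ is given, for all $b\in\mathcal B$ and $\vartheta\in\mathbb V_\Sigma^\wedge$, by $$\Delta_P(b\otimes\vartheta)=-\sum_{ij}\partial_i\partial_j(b)\otimes g_{ij}\vartheta+\frac12\sum_{ij\alpha}b_\alpha\,\varrho_\nabla^{ij}(c_\alpha)\otimes\theta_i\,\iota[\theta_j](\vartheta),\qquad F(b)=\sum_\alpha b_\alpha\otimes c_\alpha .$$ -/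

import Mathlib

open scoped TensorProduct ComplexConjugate ComplexOrder Matrix

noncomputable section

set_option linter.unusedSectionVars false

namespace QRiem

/-! ### Tensor algebra over a space with a fixed basis `θ₁, …, θ_d` -/

section Tensor

/-- The tensor algebra `𝕍^⊗` of the space `𝕍` with basis `θ₁, …, θ_d`. -/
abbrev Tens (d : ℕ) : Type := FreeAlgebra ℂ (Fin d)

/-- The tensor `θ_{i₁} ⊗ ⋯ ⊗ θ_{iₙ}`. -/
def word {d : ℕ} (w : List (Fin d)) : Tens d := (w.map (FreeAlgebra.ι ℂ)).prod

/-- The linear map on `𝕍^⊗` with prescribed values on the basis tensors `word w`. -/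
def onWords {d : ℕ} {M : Type*} [AddCommGroup M] [Module ℂ M] (f : List (Fin d) → M) :
    Tens d →ₗ[ℂ] M :=
  (FreeAlgebra.basisFreeMonoid ℂ (Fin d)).constr ℂ fun w => f w.toList

/-- The coefficient of `θ_{i₁} ⊗ ⋯ ⊗ θ_{iₙ}` in a tensor. -/
def wordCoeff {d : ℕ} (w : List (Fin d)) : Tens d →ₗ[ℂ] ℂ :=
  onWords fun u => if u = w then 1 else 0

/-- `θ_k ⊗ t ↦ t`, and `θ_i ⊗ t ↦ 0` for `i ≠ k`; scalars go to `0`. -/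
def stripLeft {d : ℕ} (k : Fin d) : Tens d →ₗ[ℂ] Tens d :=
  onWords fun w => match w with
    | [] => 0
    | i :: u => if i = k then word u else 0

/-- `id ⊗ X`, acting on tensors of positive degree. -/
def idTensor {d : ℕ} (X : Tens d →ₗ[ℂ] Tens d) : Tens d →ₗ[ℂ] Tens d :=
  onWords fun w => match w with
    | [] => 1
    | i :: u => FreeAlgebra.ι ℂ i * X (word u)

/-- The antilinear multiplicative extension of a map of generators. -/
def conjLift {d : ℕ} {S : Type*} [Ring S] [Algebra ℂ S] (f : Fin d → S) : Tens d →+* S :=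
  (MonoidAlgebra.liftNCRingHom ((algebraMap ℂ S).comp (starRingEnd ℂ)) (FreeMonoid.lift f)
    (fun x _ => Algebra.commutes (conj x) _)).comp
    (FreeAlgebra.equivMonoidAlgebraFreeMonoid (R := ℂ) (X := Fin d)).toRingEquiv.toRingHom

lemma conjLift_apply {d : ℕ} {S : Type*} [Ring S] [Algebra ℂ S] (f : Fin d → S) (t : Tens d) :
    conjLift f t = MonoidAlgebra.liftNCRingHom ((algebraMap ℂ S).comp (starRingEnd ℂ))
      (FreeMonoid.lift f) (fun x _ => Algebra.commutes (conj x) _)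
      (FreeAlgebra.equivMonoidAlgebraFreeMonoid (R := ℂ) (X := Fin d) t) := rfl

lemma conjLift_gen {d : ℕ} {S : Type*} [Ring S] [Algebra ℂ S] (f : Fin d → S) (i : Fin d) :
    conjLift f (FreeAlgebra.ι ℂ i) = f i := by
  have h : (FreeAlgebra.equivMonoidAlgebraFreeMonoid (R := ℂ) (X := Fin d)) (FreeAlgebra.ι ℂ i) =
      MonoidAlgebra.single (FreeMonoid.of i) 1 := by
    simp [FreeAlgebra.equivMonoidAlgebraFreeMonoid]
  rw [conjLift_apply, h]
  refine (MonoidAlgebra.liftNCRingHom_single _ _ _ _ _).trans ?_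
  simp

lemma conjLift_algebraMap {d : ℕ} {S : Type*} [Ring S] [Algebra ℂ S] (f : Fin d → S) (c : ℂ) :
    conjLift f (algebraMap ℂ (Tens d) c) = algebraMap ℂ S (conj c) := by
  have h : (FreeAlgebra.equivMonoidAlgebraFreeMonoid (R := ℂ) (X := Fin d)) (algebraMap ℂ _ c) =
      MonoidAlgebra.single 1 c := by simp
  rw [conjLift_apply, h]
  refine (MonoidAlgebra.liftNCRingHom_single _ _ _ _ _).trans ?_
  simp

lemma conjLift_smul {d : ℕ} {S : Type*} [Ring S] [Algebra ℂ S] (f : Fin d → S) (c : ℂ)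
    (t : Tens d) : conjLift f (c • t) = conj c • conjLift f t := by
  rw [Algebra.smul_def, map_mul, conjLift_algebraMap, Algebra.smul_def]

end Tensor

/-! ### The structure quantum group and the coordinate one-forms -/

section Group

variable (A : Type*) [Ring A] [StarRing A] [HopfAlgebra ℂ A] [StarModule ℂ A]

/-- A Hopf `*`-algebra `𝒜` with its Haar measure: the algebra of polynomial functions on a compact
quantum group. -/
structure CompactQG where
  comul_star : ∀ a : A, Coalgebra.comul (R := ℂ) (star a) = star (Coalgebra.comul (R := ℂ) a)
  haar : A →ₗ[ℂ] ℂ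
  haar_one : haar 1 = 1
  haar_right : ∀ a : A, TensorProduct.lid ℂ A (haar.rTensor A (Coalgebra.comul a)) = haar a • 1
  haar_left : ∀ a : A, TensorProduct.rid ℂ A (haar.lTensor A (Coalgebra.comul a)) = haar a • 1
  haar_pos : ∀ a : A, 0 ≤ haar (star a * a)
  haar_faithful : ∀ a : A, haar (star a * a) = 0 → a = 0

/-- The left-invariant part `𝕍` of a `*`-covariant bicovariant bimodule over the quantum group,
in an orthonormal basis `θ₁, …, θ_d` of `J`-real vectors. -/
structure CoordForms (d : ℕ) where
  /-- the matrix `ϰ`, where `ϰ(θ_i) = ∑_j θ_j ⊗ ϰ_{ji}` -/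
  rep : Matrix (Fin d) (Fin d) A
  /-- the homomorphism `ν`, where `θ_i ∘ a = ∑_j ν_{ij}(a) θ_j` -/
  act : A →ₐ[ℂ] Matrix (Fin d) (Fin d) ℂ
  /-- the matrix of `C^{1/2}` -/
  cHalf : Matrix (Fin d) (Fin d) ℂ
  comul_rep : ∀ i j, Coalgebra.comul (R := ℂ) (rep i j) = ∑ k, rep i k ⊗ₜ[ℂ] rep k j
  counit_rep : ∀ i j, Coalgebra.counit (R := ℂ) (rep i j) = if i = j then 1 else 0
  rep_unitary : rep ∈ unitary (Matrix (Fin d) (Fin d) A)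
  /-- the compatibility `∑ a⁽¹⁾ ϰ(θ_i ∘ a⁽²⁾) = ∑ ϰ(θ_i) ∘ a` of `ϰ` and `∘`, equivalently
  `ϰ(θ ∘ a) = ∑ (θ_k ∘ a⁽²⁾) ⊗ κ(a⁽¹⁾) c_k a⁽³⁾` with `ϰ(θ) = ∑ θ_k ⊗ c_k` -/
  rep_act : ∀ (a : A) (i j : Fin d),
    ∑ k, TensorProduct.rid ℂ A ((Matrix.entryLinearMap ℂ ℂ i k ∘ₗ act.toLinearMap).lTensor A
        (Coalgebra.comul a)) * rep j k =
      ∑ k, rep k i * TensorProduct.lid ℂ A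
        ((Matrix.entryLinearMap ℂ ℂ k j ∘ₗ act.toLinearMap).rTensor A (Coalgebra.comul a))
  cHalf_pos : cHalf.PosDef
  /-- `J C^{1/2} J = C^{-1/2}` -/
  cHalf_conj : cHalf.map conj * cHalf = 1
  /-- `ϰ * = (* ⊗ *) ϰ`, i.e. `C^{1/2} ϰ = ϰ̄ C^{1/2}` -/
  rep_star : cHalf.map (algebraMap ℂ A) * rep = rep.map star * cHalf.map (algebraMap ℂ A)
  /-- `(θ ∘ a)^* = θ^* ∘ κ(a)^*`, i.e. `C^{1/2} ν(κ(a)^*) = ν̄(a) C^{1/2}` -/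
  act_star : ∀ a : A,
    cHalf * act (star (HopfAlgebra.antipode ℂ a)) = (act a).map conj * cHalf

namespace CoordForms

variable {A} {d : ℕ} (Q : CoordForms A d)

/-- `ν_{ij} : 𝒜 → ℂ`. -/
def nu (i j : Fin d) : A →ₗ[ℂ] ℂ := Matrix.entryLinearMap ℂ ℂ i j ∘ₗ Q.act.toLinearMap

/-- The convolution `∑ ν_{ik}(a⁽¹⁾) ν_{jl}(a⁽²⁾)`. -/
def nu2 (i j k l : Fin d) : A →ₗ[ℂ] ℂ :=
  LinearMap.mul' ℂ ℂ ∘ₗ TensorProduct.map (Q.nu i k) (Q.nu j l) ∘ₗ Coalgebra.comul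

/-- The canonical braid operator `τ(θ_i ⊗ θ_j) = ∑_k θ_k ⊗ (θ_i ∘ ϰ_{kj}) =
∑_{kl} τ_{ij}^{kl} θ_k ⊗ θ_l`; here `tau i j k l` is `τ_{ij}^{kl}`. -/
def tau (i j k l : Fin d) : ℂ := Q.nu i l (Q.rep k j)

/-- The quadratic relations `(I + τ)(θ_i ⊗ θ_j) = 0`. -/
def extRel : Tens d → Tens d → Prop := fun x y =>
  y = 0 ∧ ∃ i j, x = FreeAlgebra.ι ℂ i * FreeAlgebra.ι ℂ j +
    ∑ k, ∑ l, Q.tau i j k l • (FreeAlgebra.ι ℂ k * FreeAlgebra.ι ℂ l)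

/-- The `τ`-exterior algebra `𝕍^∧ = 𝕍^⊗ / (im(I + τ))`. -/
abbrev Ext : Type := RingQuot Q.extRel

/-- The projection `𝕍^⊗ → 𝕍^∧`. -/
def proj : Tens d →ₐ[ℂ] Q.Ext := RingQuot.mkAlgHom ℂ Q.extRel

/-- The coordinate one-form `θ_i` in `𝕍^∧`. -/
def theta (i : Fin d) : Q.Ext := Q.proj (FreeAlgebra.ι ℂ i)

/-- The homogeneous component `𝕍^{∧n}`. -/
def extDeg (n : ℕ) : Submodule ℂ Q.Ext := (Submodule.span ℂ (Set.range Q.theta)) ^ n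

lemma proj_surjective : Function.Surjective Q.proj := RingQuot.mkAlgHom_surjective ℂ Q.extRel

lemma theta_rel (i j : Fin d) :
    Q.theta i * Q.theta j + ∑ k, ∑ l, Q.tau i j k l • (Q.theta k * Q.theta l) = 0 := by
  have h := RingQuot.mkAlgHom_rel ℂ (s := Q.extRel) ⟨rfl, i, j, rfl⟩
  simpa [theta, proj] using h

/-- The algebra homomorphism on `𝕍^∧` with given values on the `θ_i`. -/
def extLift {S : Type*} [Ring S] [Algebra ℂ S] (f : Fin d → S)
    (hf : ∀ i j, f i * f j + ∑ k, ∑ l, Q.tau i j k l • (f k * f l) = 0) : Q.Ext →ₐ[ℂ] S :=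
  RingQuot.liftAlgHom ℂ ⟨FreeAlgebra.lift ℂ f, by
    rintro x y ⟨rfl, i, j, rfl⟩
    simpa using hf i j⟩

lemma extLift_theta {S : Type*} [Ring S] [Algebra ℂ S] (f : Fin d → S) (hf) (i : Fin d) :
    Q.extLift f hf (Q.theta i) = f i := by
  simp [extLift, theta, proj]

lemma sum4_comm {M : Type*} [AddCommMonoid M] (f : Fin d → Fin d → Fin d → Fin d → M) :
    ∑ k, ∑ l, ∑ m, ∑ n, f k l m n = ∑ m, ∑ n, ∑ k, ∑ l, f k l m n := by
  have h := Finset.sum_comm (s := (Finset.univ : Finset (Fin d × Fin d)))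
    (t := (Finset.univ : Finset (Fin d × Fin d))) (f := fun p q => f p.1 p.2 q.1 q.2)
  simpa only [Fintype.sum_prod_type] using h

lemma sum4_swap {M : Type*} [AddCommGroup M] [Module ℂ M] (f : Fin d → Fin d → ℂ)
    (g : Fin d → Fin d → Fin d → Fin d → ℂ) (x : Fin d → Fin d → M) :
    ∑ k, ∑ l, f k l • ∑ m, ∑ n, g k l m n • x m n =
      ∑ m, ∑ n, (∑ k, ∑ l, f k l * g k l m n) • x m n := by
  simp only [Finset.smul_sum, smul_smul, Finset.sum_smul]
  exact sum4_comm _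

/-- The coordinates of `ϰ` and `∘` satisfy `τ(ψ ∘ a) = τ(ψ) ∘ a`. -/
lemma tau_nu2 (a : A) (i j m n : Fin d) :
    ∑ k, ∑ l, Q.tau i j k l * Q.nu2 k l m n a = ∑ k, ∑ l, Q.nu2 i j k l a * Q.tau k l m n := by
  have h := congrArg (Q.nu i n) (Q.rep_act a j m)
  obtain ⟨s, hs⟩ := TensorProduct.exists_finset (R := ℂ) (Coalgebra.comul (R := ℂ) a)
  have hmul : ∀ x y : A, Q.nu i n (x * y) = ∑ p, Q.nu i p x * Q.nu p n y := fun x y => by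
    simp [nu, Matrix.mul_apply]
  rw [map_sum, map_sum] at h
  simp only [hmul, tau, nu2, hs, map_sum, LinearMap.lTensor_tmul, LinearMap.rTensor_tmul,
    TensorProduct.rid_tmul, TensorProduct.lid_tmul, LinearMap.comp_apply, TensorProduct.map_tmul,
    LinearMap.mul'_apply, map_smul, smul_eq_mul] at h ⊢
  refine h.symm.trans ?_
  rw [Finset.sum_comm]
  simp only [nu, LinearMap.comp_apply, mul_comm]

/-- The coordinates of `ϰ` satisfy `ϰ τ = (τ ⊗ id) ϰ`. -/
lemma tau_rep (i j m n : Fin d) :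
    ∑ k, ∑ l, Q.tau i j k l • (Q.rep m k * Q.rep n l) =
      ∑ k, ∑ l, Q.tau k l m n • (Q.rep k i * Q.rep l j) := by
  have h := Q.rep_act (Q.rep m j) i n
  simp only [Q.comul_rep, map_sum, LinearMap.lTensor_tmul, LinearMap.rTensor_tmul,
    TensorProduct.rid_tmul, TensorProduct.lid_tmul, Finset.sum_mul, Finset.mul_sum,
    smul_mul_assoc, mul_smul_comm] at h
  rw [Finset.sum_comm]
  exact h

/-- The right `𝒜`-module structure `∘` on `𝕍^∧`, as an algebra homomorphism into the convolution
algebra; multiplicativity is `(ϑη) ∘ a = ∑ (ϑ ∘ a⁽¹⁾)(η ∘ a⁽²⁾)` and unitality is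
`1 ∘ a = ε(a) 1`. -/
def circHom : Q.Ext →ₐ[ℂ] WithConv (A →ₗ[ℂ] Q.Ext) :=
  Q.extLift (fun i => WithConv.toConv (∑ j, (Q.nu i j).smulRight (Q.theta j))) (by
    intro i j
    have key : ∀ (k l : Fin d) (a : A),
        (WithConv.toConv (∑ m, (Q.nu k m).smulRight (Q.theta m)) *
          WithConv.toConv (∑ n, (Q.nu l n).smulRight (Q.theta n))) a =
        ∑ m, ∑ n, Q.nu2 k l m n a • (Q.theta m * Q.theta n) := by
      intro k l a
      rw [LinearMap.convMul_apply]
      simp only [nu2, LinearMap.comp_apply]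
      induction (Coalgebra.comul (R := ℂ) a) with
      | zero => simp
      | add x y hx hy =>
        simp only [map_add, hx, hy, add_smul, Finset.sum_add_distrib]
      | tmul x y =>
        simp [Finset.sum_mul_sum, smul_smul, mul_comm]
    have e : ∀ a : A, ∑ k, ∑ l, Q.tau i j k l • ∑ m, ∑ n, Q.nu2 k l m n a • (Q.theta m * Q.theta n) =
        ∑ k, ∑ l, Q.nu2 i j k l a • ∑ m, ∑ n, Q.tau k l m n • (Q.theta m * Q.theta n) := by
      intro a
      refine (sum4_swap (fun k l => Q.tau i j k l) (fun k l m n => Q.nu2 k l m n a)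
        (fun m n => Q.theta m * Q.theta n)).trans (Eq.trans ?_
        (sum4_swap (fun k l => Q.nu2 i j k l a) (fun k l m n => Q.tau k l m n)
        (fun m n => Q.theta m * Q.theta n)).symm)
      refine Finset.sum_congr rfl fun m _ => Finset.sum_congr rfl fun n _ => ?_
      rw [Q.tau_nu2 a i j m n]
    refine WithConv.ofConv_injective (LinearMap.ext fun a => ?_)
    simp only [WithConv.ofConv_add, WithConv.ofConv_sum, WithConv.ofConv_smul, LinearMap.add_apply,
      LinearMap.sum_apply, LinearMap.smul_apply, WithConv.ofConv_zero, LinearMap.zero_apply]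
    simp only [key]
    rw [e, ← Finset.sum_add_distrib]
    refine Finset.sum_eq_zero fun k _ => ?_
    rw [← Finset.sum_add_distrib]
    refine Finset.sum_eq_zero fun l _ => ?_
    rw [← smul_add, Q.theta_rel, smul_zero])

/-- `circ ϑ a = ϑ ∘ a` on `𝕍^∧`. -/
def circ : Q.Ext →ₗ[ℂ] A →ₗ[ℂ] Q.Ext where
  toFun x := (Q.circHom x).ofConv
  map_add' x y := by simp
  map_smul' c x := by simp

/-- The coaction `ϰ : 𝕍^∧ → 𝕍^∧ ⊗ 𝒜`, an algebra homomorphism. -/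
def kap : Q.Ext →ₐ[ℂ] Q.Ext ⊗[ℂ] A :=
  Q.extLift (fun i => ∑ j, Q.theta j ⊗ₜ[ℂ] Q.rep j i) (by
    intro i j
    have key : ∀ k l : Fin d, (∑ m, Q.theta m ⊗ₜ[ℂ] Q.rep m k) * (∑ n, Q.theta n ⊗ₜ[ℂ] Q.rep n l) =
        ∑ m, ∑ n, (Q.theta m * Q.theta n) ⊗ₜ[ℂ] (Q.rep m k * Q.rep n l) := fun k l => by
      simp [Finset.sum_mul_sum]
    have e : ∑ k, ∑ l, Q.tau i j k l • ∑ m, ∑ n,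
          (Q.theta m * Q.theta n) ⊗ₜ[ℂ] (Q.rep m k * Q.rep n l) =
        ∑ k, ∑ l, (∑ m, ∑ n, Q.tau k l m n • (Q.theta m * Q.theta n)) ⊗ₜ[ℂ]
          (Q.rep k i * Q.rep l j) := by
      simp only [TensorProduct.sum_tmul, Finset.smul_sum]
      rw [sum4_comm]
      refine Eq.trans ?_ (sum4_comm _).symm
      refine Finset.sum_congr rfl fun m _ => Finset.sum_congr rfl fun n _ => ?_
      simp only [TensorProduct.smul_tmul, ← TensorProduct.tmul_smul, ← TensorProduct.tmul_sum]
      rw [Q.tau_rep]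
    simp only [key, e]
    rw [← Finset.sum_add_distrib]
    refine Finset.sum_eq_zero fun k _ => ?_
    rw [← Finset.sum_add_distrib]
    refine Finset.sum_eq_zero fun l _ => ?_
    rw [← TensorProduct.add_tmul, Q.theta_rel, TensorProduct.zero_tmul])

lemma cHalf_transpose_mul : Q.cHalfᵀ * Q.cHalf = 1 := by
  have h := Q.cHalf_conj
  have h2 : Q.cHalf.map conj = Q.cHalfᵀ := by
    have h3 := Q.cHalf_pos.isHermitian
    ext i j
    exact congrFun (congrFun h3 j) i
  rwa [h2] at h

lemma cHalf_mul_transpose : Q.cHalf * Q.cHalfᵀ = 1 :=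
  mul_eq_one_comm.mp Q.cHalf_transpose_mul

lemma cHalf_inv (i j : Fin d) : Q.cHalf⁻¹ i j = Q.cHalf j i := by
  rw [Matrix.inv_eq_left_inv Q.cHalf_transpose_mul, Matrix.transpose_apply]

lemma rep_antipode (m j : Fin d) :
    ∑ k, Q.rep m k * HopfAlgebra.antipode ℂ (Q.rep k j) = if m = j then 1 else 0 := by
  have h := HopfAlgebra.mul_antipode_lTensor_comul_apply (R := ℂ) (Q.rep m j)
  rw [Q.comul_rep, Q.counit_rep] at h
  simp only [map_sum, LinearMap.lTensor_tmul, LinearMap.mul'_apply] at h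
  rw [h]
  split_ifs <;> simp

lemma rep_cHalf (p k : Fin d) :
    ∑ b, Q.cHalf k b • Q.rep p b = ∑ m, Q.cHalf m p • star (Q.rep m k) := by
  have h1 : (Q.cHalfᵀ.map (algebraMap ℂ A)) * (Q.cHalf.map (algebraMap ℂ A)) = 1 := by
    rw [← Matrix.map_mul, Q.cHalf_transpose_mul]; simp
  have h2 : (Q.cHalf.map (algebraMap ℂ A)) * (Q.cHalfᵀ.map (algebraMap ℂ A)) = 1 := by
    rw [← Matrix.map_mul, Q.cHalf_mul_transpose]; simp
  have h : Q.rep * Q.cHalfᵀ.map (algebraMap ℂ A) =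
      Q.cHalfᵀ.map (algebraMap ℂ A) * Q.rep.map star := by
    calc Q.rep * Q.cHalfᵀ.map (algebraMap ℂ A)
        = (Q.cHalfᵀ.map (algebraMap ℂ A)) * ((Q.cHalf.map (algebraMap ℂ A)) * Q.rep) *
            Q.cHalfᵀ.map (algebraMap ℂ A) := by rw [← mul_assoc, h1, one_mul]
      _ = _ := by rw [Q.rep_star]; simp only [mul_assoc]; rw [h2, mul_one]
  have h3 := congrFun (congrFun h p) k
  simp only [Matrix.mul_apply, Matrix.map_apply, Matrix.transpose_apply] at h3
  simp only [Algebra.smul_def]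
  rw [← h3]
  exact Finset.sum_congr rfl fun b _ => Algebra.commutes _ _

lemma tau_star (i j p q : Fin d) :
    ∑ k, ∑ l, conj (Q.tau i j k l) * ∑ a, ∑ b, Q.cHalf l a * Q.cHalf k b * Q.tau a b p q =
      Q.cHalf j p * Q.cHalf i q := by
  have h1 : ∀ k a, ∑ l, conj (Q.tau i j k l) * Q.cHalf l a =
      (Q.cHalf * Q.act (star (HopfAlgebra.antipode ℂ (Q.rep k j)))) i a := by
    intro k a
    rw [Q.act_star, Matrix.mul_apply]
    rfl
  have h2 : ∀ k, ∑ l, conj (Q.tau i j k l) * ∑ a, ∑ b, Q.cHalf l a * Q.cHalf k b * Q.tau a b p q =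
      (Q.cHalf * Q.act (star (HopfAlgebra.antipode ℂ (Q.rep k j)) *
        ∑ b, Q.cHalf k b • Q.rep p b)) i q := by
    intro k
    have e1 : ∑ l, conj (Q.tau i j k l) *
        ∑ a, ∑ b, Q.cHalf l a * Q.cHalf k b * Q.tau a b p q =
        ∑ a, (∑ l, conj (Q.tau i j k l) * Q.cHalf l a) * ∑ b, Q.cHalf k b * Q.tau a b p q := by
      simp only [Finset.mul_sum, Finset.sum_mul]
      rw [Finset.sum_comm]
      refine Finset.sum_congr rfl fun a _ => ?_
      rw [Finset.sum_comm]
      refine Finset.sum_congr rfl fun b _ => Finset.sum_congr rfl fun l _ => ?_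
      ring
    rw [e1, map_mul, ← mul_assoc, Matrix.mul_apply]
    refine Finset.sum_congr rfl fun a _ => ?_
    rw [h1, map_sum, Matrix.sum_apply]
    simp [tau, nu]
  simp only [h2]
  rw [← Matrix.sum_apply, ← Matrix.mul_sum, ← map_sum]
  have h3 : ∑ k, star (HopfAlgebra.antipode ℂ (Q.rep k j)) * ∑ b, Q.cHalf k b • Q.rep p b =
      Q.cHalf j p • 1 := by
    simp only [Q.rep_cHalf, Finset.mul_sum, mul_smul_comm]
    rw [Finset.sum_comm]
    simp only [← Finset.smul_sum, ← star_mul, ← star_sum, Q.rep_antipode]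
    rw [Finset.sum_eq_single j]
    · simp
    · intro b _ hb
      simp [hb]
    · simp
  rw [h3, map_smul, map_one]
  simp

/-- `θ_i^* = C^{-1/2} θ_i`, as an element of `𝕍^∧`. -/
def thetaStar (i : Fin d) : Q.Ext := ∑ j, Q.cHalf⁻¹ j i • Q.theta j

lemma thetaStar_rel (i j : Fin d) : Q.thetaStar j * Q.thetaStar i +
    ∑ k, ∑ l, conj (Q.tau i j k l) • (Q.thetaStar l * Q.thetaStar k) = 0 := by
  have key : ∀ k l, Q.thetaStar l * Q.thetaStar k =
      ∑ a, ∑ b, (Q.cHalf l a * Q.cHalf k b) • (Q.theta a * Q.theta b) := by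
    intro k l
    simp [thetaStar, cHalf_inv, Finset.sum_mul_sum, smul_smul, mul_comm]
  have e : Q.thetaStar j * Q.thetaStar i = ∑ k, ∑ l, conj (Q.tau i j k l) •
      ∑ a, ∑ b, (Q.cHalf l a * Q.cHalf k b) •
        ∑ p, ∑ q, Q.tau a b p q • (Q.theta p * Q.theta q) := by
    rw [key]
    have e1 : ∀ k l, ∑ a, ∑ b, (Q.cHalf l a * Q.cHalf k b) •
        ∑ p, ∑ q, Q.tau a b p q • (Q.theta p * Q.theta q) =
        ∑ p, ∑ q, (∑ a, ∑ b, Q.cHalf l a * Q.cHalf k b * Q.tau a b p q) •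
          (Q.theta p * Q.theta q) := fun k l =>
      sum4_swap (fun a b => Q.cHalf l a * Q.cHalf k b) (fun a b p q => Q.tau a b p q)
        (fun p q => Q.theta p * Q.theta q)
    simp only [e1]
    refine Eq.trans ?_ (sum4_swap (fun k l => conj (Q.tau i j k l))
      (fun k l p q => ∑ a, ∑ b, Q.cHalf l a * Q.cHalf k b * Q.tau a b p q)
      (fun p q => Q.theta p * Q.theta q)).symm
    simp only [Q.tau_star]
  rw [e]
  simp only [key]
  rw [← Finset.sum_add_distrib]
  refine Finset.sum_eq_zero fun k _ => ?_
  rw [← Finset.sum_add_distrib]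
  refine Finset.sum_eq_zero fun l _ => ?_
  rw [← smul_add, ← Finset.sum_add_distrib]
  refine (congrArg _ (Finset.sum_eq_zero fun a _ => ?_)).trans (smul_zero _)
  rw [← Finset.sum_add_distrib]
  refine Finset.sum_eq_zero fun b _ => ?_
  rw [← smul_add, add_comm, Q.theta_rel, smul_zero]

/-- The antimultiplicative antilinear extension of `*` from `𝕍` to `𝕍^∧`, as a homomorphism into
the opposite algebra. -/
def starHom : Q.Ext →+* Q.Extᵐᵒᵖ :=
  RingQuot.lift ⟨conjLift fun i => MulOpposite.op (Q.thetaStar i), by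
    rintro x y ⟨rfl, i, j, rfl⟩
    apply MulOpposite.unop_injective
    simp only [map_add, map_mul, map_sum, conjLift_smul, conjLift_gen, map_zero,
      MulOpposite.unop_add, Finset.unop_sum, MulOpposite.unop_smul, MulOpposite.unop_mul,
      MulOpposite.unop_op, MulOpposite.unop_zero]
    exact Q.thetaStar_rel i j⟩

/-- The (ungraded) antimultiplicative involution `(ϑη)^* = η^* ϑ^*` on `𝕍^∧`. -/
def starExt : Q.Ext →ₗ⋆[ℂ] Q.Ext where
  toFun x := (Q.starHom x).unop
  map_add' x y := by simp
  map_smul' c x := by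
    have h : Q.starHom (algebraMap ℂ Q.Ext c) = algebraMap ℂ _ (conj c) := by
      have h1 : (RingQuot.mkRingHom Q.extRel) (algebraMap ℂ (Tens d) c) = algebraMap ℂ Q.Ext c := by
        rw [← RingQuot.mkAlgHom_coe ℂ]
        exact (RingQuot.mkAlgHom ℂ Q.extRel).commutes c
      rw [← h1, starHom, RingQuot.lift_mkRingHom_apply, conjLift_algebraMap]
    rw [Algebra.smul_def, map_mul, h]
    simp [Algebra.smul_def, Algebra.commutes]

end CoordForms

end Group

end QRiem

namespace QRiem

/-! ### Braided metrics -/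

section Antisym

variable {d : ℕ} (s : Matrix (Fin d × Fin d) (Fin d × Fin d) ℂ)

/-- The operator `σ ⊗ id` on `𝕍^⊗`, where `σ(θ_i ⊗ θ_j) = ∑_{kl} σ_{ij}^{kl} θ_k ⊗ θ_l` and
`σ_{ij}^{kl}` is the matrix entry `s (k, l) (i, j)`. -/
def braidFst : Tens d →ₗ[ℂ] Tens d :=
  onWords fun w => match w with
    | i :: j :: u => ∑ k, ∑ l, s (k, l) (i, j) • word (k :: l :: u)
    | u => word u

/-- `(1 - σ₁ + σ₁σ₂ - ⋯ ± σ₁σ₂⋯σ_{n-1})(θ_{i₁} ⊗ ⋯ ⊗ θ_{iₙ})`, where `σ_k` acts on the legs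
`k`, `k + 1`. -/
def cosetSum : List (Fin d) → Tens d
  | [] => 1
  | [i] => word [i]
  | i :: j :: u => word (i :: j :: u) - braidFst s (FreeAlgebra.ι ℂ i * cosetSum (j :: u))

/-- The braided antisymmetrizer `A_σ^n = ∑_π sgn(π) σ_π` on `n`-tensors. It is built from the
factorization of the sum over the permutations `π` through the permutations which fix the first
place and the coset representatives `1, s₁, s₁s₂, …`. -/
def antisymDeg : ℕ → Tens d →ₗ[ℂ] Tens d
  | 0 => LinearMap.id
  | n + 1 => idTensor (antisymDeg n) ∘ₗ onWords (cosetSum s)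

/-- The total braided antisymmetrizer `A_σ` on `𝕍^⊗`. -/
def antisym : Tens d →ₗ[ℂ] Tens d := onWords fun w => antisymDeg s w.length (word w)

end Antisym

section Metric

variable {A : Type*} [Ring A] [StarRing A] [HopfAlgebra ℂ A] [StarModule ℂ A] {d : ℕ}

/-- A quantum metric on `𝕍`: a braid operator `σ`, a `*`-algebra `Σ` and a quadratic form
`g : 𝕍 ⊗ 𝕍 → Σ`, coupled to the bicovariant structure of `𝕍`. -/
structure BraidedMetric (Q : CoordForms A d) (Sg : Type*) [Ring Sg] [StarRing Sg] [Algebra ℂ Sg]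
    [StarModule ℂ Sg] where
  /-- the matrix of `σ`, with `σ(θ_i ⊗ θ_j) = ∑_{kl} sigma (k, l) (i, j) θ_k ⊗ θ_l` -/
  sigma : Matrix (Fin d × Fin d) (Fin d × Fin d) ℂ
  sigma_isUnit : IsUnit sigma
  sigma_braid : ∀ i j k : Fin d,
    braidFst sigma (idTensor (braidFst sigma) (braidFst sigma (word [i, j, k]))) =
      idTensor (braidFst sigma) (braidFst sigma (idTensor (braidFst sigma) (word [i, j, k])))
  /-- `* σ = σ *`, where `(x ⊗ y)^* = y^* ⊗ x^*` -/
  sigma_star : ∀ i j k l : Fin d,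
    ∑ a, ∑ b, Q.cHalf⁻¹ a j * Q.cHalf⁻¹ b i * sigma (k, l) (a, b) =
      ∑ p, ∑ q, conj (sigma (p, q) (i, j)) * (Q.cHalf⁻¹ k q * Q.cHalf⁻¹ l p)
  /-- the matrix `g_{ij} = g(θ_i, θ_j)` -/
  g : Matrix (Fin d) (Fin d) Sg
  /-- `g σ = g` -/
  g_symm : ∀ i j : Fin d, ∑ k, ∑ l, sigma (k, l) (i, j) • g k l = g i j
  /-- `g(x, y)^* = g(y^*, x^*)` -/
  g_star : ∀ i j : Fin d,
    star (g i j) = ∑ a, ∑ b, (Q.cHalf⁻¹ a j * Q.cHalf⁻¹ b i) • g a b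
  /-- `g ⊗ g = (g ⊗ g)(id ⊗ σ ⊗ id)(σ⁻¹ ⊗ σ)(id ⊗ σ⁻¹ ⊗ id)` -/
  g_funny : ∀ i j k l : Fin d, g i j * g k l =
    ∑ p, ∑ q, ∑ a, ∑ r, ∑ t, ∑ e, ∑ b, ∑ c,
      (sigma⁻¹ (p, q) (j, k) * sigma⁻¹ (a, r) (i, p) * sigma (t, e) (q, l) *
        sigma (b, c) (r, t)) • (g a b * g c e)
  /-- the inverse matrix of `g` -/
  gInv : Matrix (Fin d) (Fin d) Sg
  g_mul_gInv : g * gInv = 1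
  gInv_mul_g : gInv * g = 1
  /-- `Σ` is generated by the matrix elements of `g` and `g⁻¹` -/
  minimal : Algebra.adjoin ℂ {q | ∃ i j, q = g i j ∨ q = gInv i j} = ⊤
  /-- the homomorphism `ν_Σ : Σ → M_d(Σ)`, where `θ_i q = ∑_j ν_Σ(q)_{ij} θ_j` -/
  nuS : Sg →ₐ[ℂ] Matrix (Fin d) (Fin d) Sg
  /-- `ν_Σ (id ⊗ g) = (g ⊗ id)(id ⊗ σ)(σ⁻¹ ⊗ id)` -/
  nuS_g : ∀ i j k l : Fin d, nuS (g k l) i j =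
    ∑ a, ∑ b, ∑ c, (sigma⁻¹ (a, b) (i, k) * sigma (c, j) (b, l)) • g a c
  /-- `τ` extends `Σ`-bilinearly to `𝕍_Σ ⊗_Σ 𝕍_Σ` -/
  tau_nuS : ∀ (q : Sg) (i j k l : Fin d),
    ∑ a, ∑ b, Q.tau i j a b • nuS (nuS q b l) a k =
      ∑ a, ∑ b, Q.tau a b k l • nuS (nuS q j b) i a
  /-- `𝕍^∧ = 𝕍^⊗ / ker A_σ` -/
  coupling : ∀ t : Tens d, antisym sigma t = 0 ↔ Q.proj t = 0
  /-- the right `𝒜`-module structure `∘` on `Σ` -/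
  circS : Sg →ₗ[ℂ] A →ₗ[ℂ] Sg
  circS_one : ∀ q, circS q 1 = q
  circS_mul : ∀ q a b, circS q (a * b) = circS (circS q a) b
  circS_mul_left : ∀ (p q : Sg) (a : A), circS (p * q) a =
    LinearMap.mul' ℂ Sg (TensorProduct.map (circS p) (circS q) (Coalgebra.comul a))
  circS_one_left : ∀ a : A, circS 1 a = Coalgebra.counit (R := ℂ) a • 1
  /-- `g(x, y) ∘ a = ∑ g(x ∘ a⁽¹⁾, y ∘ a⁽²⁾)` -/
  circS_g : ∀ (i j : Fin d) (a : A), circS (g i j) a = ∑ k, ∑ l, Q.nu2 i j k l a • g k l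

namespace BraidedMetric

variable {Q : CoordForms A d} {Sg : Type*} [Ring Sg] [StarRing Sg] [Algebra ℂ Sg]
  [StarModule ℂ Sg] (M : BraidedMetric Q Sg)

lemma exists_section : ∃ f : Q.Ext →ₗ[ℂ] Tens d, Q.proj.toLinearMap ∘ₗ f = LinearMap.id :=
  LinearMap.exists_rightInverse_of_surjective _ (LinearMap.range_eq_top.2 Q.proj_surjective)

/-- A linear choice of representatives in `𝕍^⊗` of the elements of `𝕍^∧`. -/
def sec (Q : CoordForms A d) : Q.Ext →ₗ[ℂ] Tens d := Classical.choose (exists_section (Q := Q))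

lemma proj_sec (x : Q.Ext) : Q.proj (sec Q x) = x :=
  LinearMap.congr_fun (Classical.choose_spec (exists_section (Q := Q))) x

/-- The canonical embedding `𝕍^∧ = 𝕍^⊗ / ker A_σ ↔ im A_σ ⊆ 𝕍^⊗`, induced by `A_σ`. -/
def real : Q.Ext →ₗ[ℂ] Tens d := antisym M.sigma ∘ₗ sec Q

lemma real_proj (t : Tens d) : M.real (Q.proj t) = antisym M.sigma t := by
  have h := (M.coupling (sec Q (Q.proj t) - t)).2 (by rw [map_sub, proj_sec, sub_self])
  rw [map_sub, sub_eq_zero] at h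
  exact h

lemma exists_retraction : ∃ f : Tens d →ₗ[ℂ] Q.Ext, f ∘ₗ M.real = LinearMap.id := by
  refine LinearMap.exists_leftInverse_of_injective _ (LinearMap.ker_eq_bot'.2 fun x hx => ?_)
  have h := (M.coupling (sec Q x)).1 hx
  rwa [proj_sec] at h

/-- A linear left inverse of the embedding of `𝕍^∧` into `𝕍^⊗`. -/
def retr : Tens d →ₗ[ℂ] Q.Ext := Classical.choose M.exists_retraction

lemma retr_real (x : Q.Ext) : M.retr (M.real x) = x :=
  LinearMap.congr_fun (Classical.choose_spec M.exists_retraction) x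

/-- The extended exterior algebra `𝕍_Σ^∧ ↔ Σ ⊗ 𝕍^∧`, as a left `Σ`-module. -/
abbrev VS (_M : BraidedMetric Q Sg) : Type _ := Sg ⊗[ℂ] Q.Ext

/-- The left multiplication of `𝕍_Σ^∧` by elements of `Σ`. -/
def lmulS : Sg →ₗ[ℂ] Module.End ℂ M.VS := LinearMap.rTensorHom Q.Ext ∘ₗ LinearMap.mul ℂ Sg

/-- The left multiplication of `𝕍_Σ^∧` by elements of `𝕍^∧`, determined by
`θ_i (q ⊗ η) = ∑_j ν_Σ(q)_{ij} ⊗ θ_j η`. -/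
def lmulE : Q.Ext →ₐ[ℂ] Module.End ℂ M.VS :=
  Q.extLift (fun i => ∑ j, TensorProduct.map
    (Matrix.entryLinearMap ℂ Sg i j ∘ₗ M.nuS.toLinearMap) (LinearMap.mulLeft ℂ (Q.theta j))) (by
    intro i j
    refine TensorProduct.ext' fun q η => ?_
    have key : ∀ k l : Fin d, ((∑ m, TensorProduct.map
        (Matrix.entryLinearMap ℂ Sg k m ∘ₗ M.nuS.toLinearMap)
        (LinearMap.mulLeft ℂ (Q.theta m)) : Module.End ℂ M.VS) *
        ∑ m, TensorProduct.map (Matrix.entryLinearMap ℂ Sg l m ∘ₗ M.nuS.toLinearMap)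
        (LinearMap.mulLeft ℂ (Q.theta m))) (q ⊗ₜ[ℂ] η) =
        ∑ m, ∑ n, M.nuS (M.nuS q l n) k m ⊗ₜ[ℂ] (Q.theta m * Q.theta n * η) := by
      intro k l
      simp only [Module.End.mul_apply, LinearMap.sum_apply, TensorProduct.map_tmul, map_sum,
        LinearMap.comp_apply, LinearMap.mulLeft_apply, AlgHom.toLinearMap_apply,
        Matrix.entryLinearMap_apply, mul_assoc]
      exact Finset.sum_comm
    simp only [LinearMap.add_apply, LinearMap.sum_apply, LinearMap.smul_apply, key,
      LinearMap.zero_apply]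
    have e : ∑ k, ∑ l, Q.tau i j k l • ∑ m, ∑ n,
          M.nuS (M.nuS q l n) k m ⊗ₜ[ℂ] (Q.theta m * Q.theta n * η) =
        ∑ k, ∑ l, M.nuS (M.nuS q j l) i k ⊗ₜ[ℂ]
          ((∑ m, ∑ n, Q.tau k l m n • (Q.theta m * Q.theta n)) * η) := by
      simp only [Finset.sum_mul, TensorProduct.tmul_sum, Finset.smul_sum]
      rw [CoordForms.sum4_comm]
      refine Eq.trans ?_ (CoordForms.sum4_comm _).symm
      refine Finset.sum_congr rfl fun m _ => Finset.sum_congr rfl fun n _ => ?_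
      simp only [smul_mul_assoc, TensorProduct.tmul_smul, TensorProduct.smul_tmul',
        ← TensorProduct.sum_tmul]
      rw [M.tau_nuS]
    rw [e, ← Finset.sum_add_distrib]
    refine Finset.sum_eq_zero fun k _ => ?_
    rw [← Finset.sum_add_distrib]
    refine Finset.sum_eq_zero fun l _ => ?_
    rw [← TensorProduct.tmul_add, ← add_mul, Q.theta_rel, zero_mul, TensorProduct.tmul_zero])

/-- The product of `𝕍_Σ^∧`: `(q ⊗ η) y = q (η y)`. -/
def mulV : M.VS →ₗ[ℂ] M.VS →ₗ[ℂ] M.VS :=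
  TensorProduct.lift
    ((LinearMap.mul ℂ (Module.End ℂ M.VS)).compl₁₂ M.lmulS M.lmulE.toLinearMap)

/-- The involution of `𝕍_Σ^∧`: `(q ⊗ η)^* = η^* q^*`. -/
def starV : M.VS →ₗ⋆[ℂ] M.VS :=
  TensorProduct.lift (LinearMap.mk₂'ₛₗ (starRingEnd ℂ) (starRingEnd ℂ)
    (fun q η => M.lmulE (Q.starExt η) (star q ⊗ₜ[ℂ] 1))
    (fun q q' η => by simp [TensorProduct.add_tmul])
    (fun c q η => by rw [star_smul, ← TensorProduct.smul_tmul', map_smul]; rfl)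
    (fun q η η' => by simp)
    (fun c q η => by simp))

/-- The right `𝒜`-module structure on `𝕍_Σ^∧`: `(q ⊗ η) ∘ a = ∑ (q ∘ a⁽¹⁾) ⊗ (η ∘ a⁽²⁾)`. -/
def circV : M.VS →ₗ[ℂ] A →ₗ[ℂ] M.VS :=
  (TensorProduct.map₂ M.circS Q.circ).compl₂ Coalgebra.comul

/-- The contraction `ξ ↦ (g ⊗ id)(θ_i ⊗ ξ)` on `𝕍_Σ^⊗ ↔ Σ ⊗ 𝕍^⊗`:
`q ⊗ θ_k ⊗ t ↦ ∑_j ν_Σ(q)_{ij} g_{jk} ⊗ t`. -/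
def contrT (i : Fin d) : Module.End ℂ (Sg ⊗[ℂ] Tens d) :=
  ∑ j, ∑ k, TensorProduct.map
    (LinearMap.mulRight ℂ (M.g j k) ∘ₗ Matrix.entryLinearMap ℂ Sg i j ∘ₗ M.nuS.toLinearMap)
    (stripLeft k)

/-- The contraction operator `ι[θ_i]` on `𝕍_Σ^∧`, realized in the tensor algebra. -/
def iota (i : Fin d) : Module.End ℂ M.VS :=
  M.retr.lTensor Sg ∘ₗ M.contrT i ∘ₗ M.real.lTensor Sg

/-- The projection `Σ ⊗ 𝕍^⊗ → Σ` onto the component of degree zero. -/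
def degZero : Sg ⊗[ℂ] Tens d →ₗ[ℂ] Sg :=
  (TensorProduct.rid ℂ Sg).toLinearMap ∘ₗ
    ((FreeAlgebra.algebraMapInv : Tens d →ₐ[ℂ] ℂ).toLinearMap).lTensor Sg

/-- The pairing of `𝕍_Σ^⊗` with itself, with `g(ψ ⊗ x, y ⊗ ξ) = g(ψ, g(x, y) ξ)` and tensors of
different degrees orthogonal. -/
def gTens : Sg ⊗[ℂ] Tens d →ₗ[ℂ] Sg ⊗[ℂ] Tens d →ₗ[ℂ] Sg :=
  TensorProduct.lift ((LinearMap.llcomp ℂ (Sg ⊗[ℂ] Tens d) Sg Sg).compl₁₂ (LinearMap.mul ℂ Sg)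
    (LinearMap.llcomp ℂ (Sg ⊗[ℂ] Tens d) (Sg ⊗[ℂ] Tens d) Sg degZero ∘ₗ
      (FreeAlgebra.lift ℂ M.contrT).toLinearMap))

/-- `g_∧(ψ, ξ) = g(ψ, A_σ ξ)` on `𝕍_Σ^∧`. -/
def gWedge : M.VS →ₗ[ℂ] M.VS →ₗ[ℂ] Sg :=
  M.gTens.compl₁₂ ((sec Q).lTensor Sg) (M.real.lTensor Sg)

end BraidedMetric

end Metric

end QRiem

namespace QRiem

/-! ### Quantum principal bundles and frame structures -/

section Bundle

variable {A : Type*} [Ring A] [StarRing A] [HopfAlgebra ℂ A] [StarModule ℂ A] {d : ℕ}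

/-- The right action `F : ℬ → ℬ ⊗ 𝒜` of a quantum principal bundle; the algebra `𝒱` of the base
is the fixed-point subalgebra. -/
structure QPB (A B : Type*) [Ring A] [StarRing A] [HopfAlgebra ℂ A] [StarModule ℂ A]
    [Ring B] [StarRing B] [Algebra ℂ B] [StarModule ℂ B] where
  F : B →⋆ₐ[ℂ] B ⊗[ℂ] A
  coassoc : ∀ b : B, TensorProduct.assoc ℂ B A A (F.toAlgHom.toLinearMap.rTensor A (F b)) =
    (Coalgebra.comul (R := ℂ) (A := A)).lTensor B (F b)
  counit : ∀ b : B,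
    TensorProduct.rid ℂ B ((Coalgebra.counit (R := ℂ) (A := A)).lTensor B (F b)) = b
  free : Submodule.span ℂ {x | ∃ q b : B, x = (q ⊗ₜ[ℂ] (1 : A)) * F b} = ⊤

namespace QPB

variable {B : Type*} [Ring B] [StarRing B] [Algebra ℂ B] [StarModule ℂ B] (P : QPB A B)

/-- `F` as a linear map. -/
abbrev Flin : B →ₗ[ℂ] B ⊗[ℂ] A := P.F.toAlgHom.toLinearMap

/-- The algebra `𝒱 = {b | F(b) = b ⊗ 1}` of functions on the base space. -/
def base : StarSubalgebra ℂ B where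
  carrier := {b | P.F b = b ⊗ₜ[ℂ] 1}
  mul_mem' {a b} ha hb := by
    simp only [Set.mem_ofPred_eq] at *
    rw [map_mul, ha, hb, Algebra.TensorProduct.tmul_mul_tmul, one_mul]
  add_mem' {a b} ha hb := by
    simp only [Set.mem_ofPred_eq] at *
    rw [map_add, ha, hb, TensorProduct.add_tmul]
  algebraMap_mem' c := by
    simp only [Set.mem_ofPred_eq]
    rw [AlgHomClass.commutes, Algebra.TensorProduct.algebraMap_apply]
  star_mem' {a} ha := by
    simp only [Set.mem_ofPred_eq] at *
    rw [map_star, ha, TensorProduct.star_tmul, star_one]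

lemma mem_base (b : B) : b ∈ P.base ↔ P.F b = b ⊗ₜ[ℂ] 1 := Iff.rfl

/-- `(id ⊗ h) F`, where `h` is the Haar measure. -/
def vert (H : CompactQG A) : B →ₗ[ℂ] B :=
  (TensorProduct.rid ℂ B).toLinearMap ∘ₗ H.haar.lTensor B ∘ₗ P.Flin

lemma vert_mem (H : CompactQG A) (b : B) : P.vert H b ∈ P.base := by
  have h1 : ∀ x : B ⊗[ℂ] A, P.F (TensorProduct.rid ℂ B (H.haar.lTensor B x)) =
      TensorProduct.rid ℂ (B ⊗[ℂ] A) (H.haar.lTensor (B ⊗[ℂ] A) (P.Flin.rTensor A x)) := by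
    intro x
    induction x with
    | zero => simp
    | add x y hx hy => simp only [map_add, hx, hy]
    | tmul x y => simp
  have h2 : ∀ (x : B) (y : A ⊗[ℂ] A), TensorProduct.rid ℂ (B ⊗[ℂ] A) (H.haar.lTensor (B ⊗[ℂ] A)
      ((TensorProduct.assoc ℂ B A A).symm (x ⊗ₜ[ℂ] y))) =
      x ⊗ₜ[ℂ] TensorProduct.rid ℂ A (H.haar.lTensor A y) := by
    intro x y
    induction y with
    | zero => simp
    | add y z hy hz => simp only [map_add, TensorProduct.tmul_add, hy, hz]
    | tmul y z => simp
  have h3 : ∀ x : B ⊗[ℂ] A, TensorProduct.rid ℂ (B ⊗[ℂ] A) (H.haar.lTensor (B ⊗[ℂ] A)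
      ((TensorProduct.assoc ℂ B A A).symm
        ((Coalgebra.comul (R := ℂ) (A := A)).lTensor B x))) =
      TensorProduct.rid ℂ B (H.haar.lTensor B x) ⊗ₜ[ℂ] 1 := by
    intro x
    induction x with
    | zero => simp
    | add x y hx hy => simp only [map_add, TensorProduct.add_tmul, hx, hy]
    | tmul x y =>
      rw [LinearMap.lTensor_tmul, h2, H.haar_left]
      simp [TensorProduct.smul_tmul']
  rw [mem_base]
  have h4 := h3 (P.F b)
  rw [← P.coassoc b, LinearEquiv.symm_apply_apply] at h4
  exact (h1 _).trans h4

/-- The vertical integration `∫_↑ : ℬ → 𝒱`. -/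
def intUp (H : CompactQG A) : B →ₗ[ℂ] P.base where
  toFun b := ⟨P.vert H b, P.vert_mem H b⟩
  map_add' x y := Subtype.ext (map_add _ x y)
  map_smul' c x := Subtype.ext (map_smul _ c x)

section Crossed

variable {W : Type*} [AddCommGroup W] [Module ℂ W]

/-- The product `(q ⊗ ϑ)(b ⊗ η) = ∑_k q b_k ⊗ (ϑ ∘ c_k) η` on `ℬ ⊗ W`, where
`F(b) = ∑_k b_k ⊗ c_k`, for a space `W` with a product and a right `𝒜`-module structure `∘`. -/
def crossMul (mulW : W →ₗ[ℂ] W →ₗ[ℂ] W) (circW : W →ₗ[ℂ] A →ₗ[ℂ] W) :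
    B ⊗[ℂ] W →ₗ[ℂ] B ⊗[ℂ] W →ₗ[ℂ] B ⊗[ℂ] W :=
  (TensorProduct.map₂ (LinearMap.mul ℂ B)
      ((TensorProduct.lift.equiv (RingHom.id ℂ) A W W).toLinearMap ∘ₗ
        LinearMap.llcomp ℂ A W (W →ₗ[ℂ] W) mulW ∘ₗ circW)).compl₂
    ((TensorProduct.assoc ℂ B A W).toLinearMap ∘ₗ P.Flin.rTensor W)

/-- The operation `(b ⊗ ϑ)^* = ∑_k b_k^* ⊗ (ϑ^* ∘ c_k^*)` on `ℬ ⊗ W`, for an involution on `W`. -/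
def crossStar (starW : W →ₗ⋆[ℂ] W) (circW : W →ₗ[ℂ] A →ₗ[ℂ] W) : B ⊗[ℂ] W →ₗ⋆[ℂ] B ⊗[ℂ] W :=
  TensorProduct.lift (LinearMap.mk₂'ₛₗ (starRingEnd ℂ) (starRingEnd ℂ)
    (fun b ϑ => (circW (starW ϑ)).lTensor B (star (P.F b)))
    (fun b b' ϑ => by simp)
    (fun c b ϑ => by simp)
    (fun b ϑ ϑ' => by simp [LinearMap.lTensor_add])
    (fun c b ϑ => by simp [LinearMap.lTensor_smul]))

end Crossed

variable (Q : CoordForms A d)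

/-- The space `𝔥𝔬𝔯_P = ℬ ⊗ 𝕍^∧` of horizontal forms. -/
abbrev Hor (_P : QPB A B) (Q : CoordForms A d) : Type _ := B ⊗[ℂ] Q.Ext

/-- The product of horizontal forms. -/
def horMul : P.Hor Q →ₗ[ℂ] P.Hor Q →ₗ[ℂ] P.Hor Q :=
  P.crossMul (LinearMap.mul ℂ Q.Ext) Q.circ

/-- The horizontal forms of degree `n`. -/
def horDeg (n : ℕ) : Submodule ℂ (P.Hor Q) :=
  Submodule.span ℂ {φ | ∃ b : B, ∃ η ∈ Q.extDeg n, φ = b ⊗ₜ[ℂ] η}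

/-- The `*`-structure on horizontal forms of degree `n`, where `*` on `𝕍^∧` is graded
antimultiplicative: `(ϑη)^* = (-1)^{∂ϑ∂η} η^* ϑ^*`. On `𝕍^{∧n}` this differs from the
antimultiplicative involution by the sign `(-1)^{n(n-1)/2}`. -/
def horStar (n : ℕ) (φ : P.Hor Q) : P.Hor Q :=
  (-1 : ℂ) ^ (n * (n - 1) / 2) • P.crossStar Q.starExt Q.circ φ

/-- The action `F^∧ : 𝔥𝔬𝔯_P → 𝔥𝔬𝔯_P ⊗ 𝒜`, which combines `F` and `ϰ`. -/
def horF : P.Hor Q →ₗ[ℂ] P.Hor Q ⊗[ℂ] A :=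
  (LinearMap.mul' ℂ A).lTensor (P.Hor Q) ∘ₗ
    (TensorProduct.tensorTensorTensorComm ℂ B A Q.Ext A).toLinearMap ∘ₗ
      TensorProduct.map P.Flin Q.kap.toLinearMap

end QPB

/-- A frame structure on a quantum principal bundle: a first-order hermitian antiderivation `∇`
of the algebra of horizontal forms which intertwines the action `F^∧`, vanishes on `∇(𝒱)` and on
`𝕍`, and satisfies the completeness condition `1 ⊗ θ = ∑_α b_α(θ) ∇(f_α)`. -/
structure FrameStructure {B : Type*} [Ring B] [StarRing B] [Algebra ℂ B] [StarModule ℂ B]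
    (P : QPB A B) (Q : CoordForms A d) where
  nabla : P.Hor Q →ₗ[ℂ] P.Hor Q
  nabla_deg : ∀ (n : ℕ), ∀ φ ∈ P.horDeg Q n, nabla φ ∈ P.horDeg Q (n + 1)
  leibniz : ∀ (n : ℕ), ∀ φ ∈ P.horDeg Q n, ∀ ψ : P.Hor Q, nabla (P.horMul Q φ ψ) =
    P.horMul Q (nabla φ) ψ + (-1 : ℂ) ^ n • P.horMul Q φ (nabla ψ)
  hermitian : ∀ (n : ℕ), ∀ φ ∈ P.horDeg Q n,
    nabla (P.horStar Q n φ) = P.horStar Q (n + 1) (nabla φ)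
  covariant : ∀ φ : P.Hor Q, P.horF Q (nabla φ) = nabla.rTensor A (P.horF Q φ)
  nabla_nabla : ∀ f ∈ P.base, nabla (nabla (f ⊗ₜ[ℂ] 1)) = 0
  nabla_theta : ∀ i : Fin d, nabla (1 ⊗ₜ[ℂ] Q.theta i) = 0
  r : ℕ
  /-- the elements `b_{αi} = b_α(θ_i)` -/
  bCoef : Fin r → Fin d → B
  fCoef : Fin r → P.base
  complete : ∀ i : Fin d, (1 : B) ⊗ₜ[ℂ] Q.theta i =
    ∑ α, P.horMul Q (bCoef α i ⊗ₜ[ℂ] 1) (nabla ((fCoef α : B) ⊗ₜ[ℂ] 1))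
  bCoef_cov : ∀ α i, P.F (bCoef α i) = ∑ j, bCoef α j ⊗ₜ[ℂ] Q.rep j i

namespace FrameStructure

variable {B : Type*} [Ring B] [StarRing B] [Algebra ℂ B] [StarModule ℂ B] {P : QPB A B}
  {Q : CoordForms A d} (N : FrameStructure P Q) {Sg : Type*} [Ring Sg] [StarRing Sg]
  [Algebra ℂ Sg] [StarModule ℂ Sg] (M : BraidedMetric Q Sg)

/-- The coordinate vector field `∂_i : ℬ → ℬ`, where `∇(b) = ∑_i ∂_i(b) ⊗ θ_i`. -/
def partialD (i : Fin d) : B →ₗ[ℂ] B :=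
  (TensorProduct.rid ℂ B).toLinearMap ∘ₗ (wordCoeff [i] ∘ₗ M.real).lTensor B ∘ₗ N.nabla ∘ₗ
    (TensorProduct.mk ℂ B Q.Ext).flip 1

/-- The extended horizontal forms `𝔥𝔬𝔯_{P,Σ} = ℬ ⊗ 𝕍_Σ^∧`. -/
abbrev HorS (_N : FrameStructure P Q) (M : BraidedMetric Q Sg) : Type _ := B ⊗[ℂ] M.VS

/-- The extension of `∇` to `𝔥𝔬𝔯_{P,Σ}` by `∇(b ⊗ ϑ) = ∇(b) ϑ`. -/
def nablaS : Module.End ℂ (N.HorS M) :=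
  TensorProduct.lift (LinearMap.flip
    ((LinearMap.lTensorHom B ∘ₗ M.lmulE.toLinearMap.flip).compl₂
      (N.nabla ∘ₗ (TensorProduct.mk ℂ B Q.Ext).flip 1)))

/-- The curvature `ϱ_∇ : 𝒜 → 𝔥𝔬𝔯_P²`, which is determined by
`∇²(b) = -∑_k b_k ϱ_∇(c_k)`, where `F(b) = ∑_k b_k ⊗ c_k`. -/
def IsCurvature (ϱ : A →ₗ[ℂ] P.Hor Q) : Prop :=
  (∀ a, ϱ a ∈ P.horDeg Q 2) ∧
  ∀ b : B, N.nabla (N.nabla (b ⊗ₜ[ℂ] 1)) = -TensorProduct.lift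
    ((P.horMul Q).compl₁₂ ((TensorProduct.mk ℂ B Q.Ext).flip 1) ϱ) (P.F b)

/-- The components of a horizontal two-form: `ψ = ½ ∑_{ij} ψ^{ij} ⊗ {θ_i ⊗ θ_j}`, with `𝕍^∧`
embedded into the tensor algebra. -/
def comp2 (i j : Fin d) : P.Hor Q →ₗ[ℂ] B :=
  (2 : ℂ) • ((TensorProduct.rid ℂ B).toLinearMap ∘ₗ (wordCoeff [i, j] ∘ₗ M.real).lTensor B)

/-- `∑_α b_α ϱ^{ij}(c_α)`, where `F(b) = ∑_α b_α ⊗ c_α`. -/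
def curvTerm (ϱ : A →ₗ[ℂ] P.Hor Q) (i j : Fin d) (b : B) : B :=
  LinearMap.mul' ℂ B ((comp2 M i j ∘ₗ ϱ).lTensor B (P.F b))

end FrameStructure

/-- A measure on a quantum manifold with a frame structure: a faithful state `ω_M` on a
`C^*`-algebra completion of `𝒱`, subject to the strict positivity of the vertical integration and to
the horizontal homogeneity. -/
structure FrameMeasure (H : CompactQG A) {B : Type*} [Ring B] [StarRing B] [Algebra ℂ B]
    [StarModule ℂ B] {P : QPB A B} {Q : CoordForms A d} (N : FrameStructure P Q) {Sg : Type*}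
    [Ring Sg] [StarRing Sg] [Algebra ℂ Sg] [StarModule ℂ Sg] (M : BraidedMetric Q Sg)
    (VC : Type*) [CStarAlgebra VC] [PartialOrder VC] [StarOrderedRing VC] where
  /-- the inclusion of `𝒱` as a dense `*`-subalgebra of a unital `C^*`-algebra -/
  emb : P.base →⋆ₐ[ℂ] VC
  emb_injective : Function.Injective emb
  emb_dense : DenseRange emb
  state : VC →ₗ[ℂ] ℂ
  state_one : state 1 = 1
  state_pos : ∀ x, 0 ≤ x → 0 ≤ state x
  state_faithful : ∀ x, 0 ≤ x → state x = 0 → x = 0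
  vert_pos : ∀ b : B, 0 ≤ emb (P.intUp H (star b * b))
  vert_faithful : ∀ b : B, P.intUp H (star b * b) = 0 → b = 0
  /-- `ω_M(T_α(f)) = 0`, where `T_α(f) = ∑_{ij} C_{ji} ∂_i(b_{αj} f)` -/
  homogeneous : ∀ (α : Fin N.r) (f v : P.base),
    (v : B) = ∑ i, ∑ j, (Q.cHalf * Q.cHalf) j i • N.partialD M i (N.bCoef α j * f) →
      state (emb v) = 0

namespace FrameMeasure

variable {H : CompactQG A} {B : Type*} [Ring B] [StarRing B] [Algebra ℂ B]
  [StarModule ℂ B] {P : QPB A B} {Q : CoordForms A d} {N : FrameStructure P Q} {Sg : Type*}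
  [Ring Sg] [StarRing Sg] [Algebra ℂ Sg] [StarModule ℂ Sg] {M : BraidedMetric Q Sg}
  {VC : Type*} [CStarAlgebra VC] [PartialOrder VC] [StarOrderedRing VC]
  (μ : FrameMeasure H N M VC)

/-- The measure `ω_P = ω_M ∘ ∫_↑` on the bundle. -/
def omegaP : B →ₗ[ℂ] ℂ :=
  μ.state ∘ₗ μ.emb.toAlgHom.toLinearMap ∘ₗ P.intUp H

/-- The antilinear map `b ⊗ ϑ ↦ b^* ⊗ ϑ^*`. -/
def starFactor (_μ : FrameMeasure H N M VC) : N.HorS M →ₗ⋆[ℂ] N.HorS M :=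
  TensorProduct.lift (LinearMap.mk₂'ₛₗ (starRingEnd ℂ) (starRingEnd ℂ)
    (fun (b : B) ϑ => star b ⊗ₜ[ℂ] M.starV ϑ)
    (fun b b' ϑ => by simp [TensorProduct.add_tmul])
    (fun c b ϑ => by simp [TensorProduct.smul_tmul'])
    (fun b ϑ ϑ' => by simp [TensorProduct.tmul_add])
    (fun c b ϑ => by simp))

/-- The `Σ`-valued scalar product `⟨b ⊗ ϑ, q ⊗ η⟩ = ω_P(b^* q) g_∧(ϑ^*, η)` on
`𝔥𝔬𝔯_{P,Σ}`, the direct product of the scalar products of `ℬ` and `𝕍_Σ^∧`. -/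
def sp (φ ψ : N.HorS M) : Sg :=
  TensorProduct.lid ℂ Sg (TensorProduct.map₂ ((LinearMap.mul ℂ B).compr₂ μ.omegaP) M.gWedge
    (μ.starFactor φ) ψ)

/-- `D` is the formal adjoint of `T`, that is `⟨φ, T ψ⟩ = ⟨D φ, ψ⟩`. -/
def IsFormalAdjoint (T D : Module.End ℂ (N.HorS M)) : Prop :=
  ∀ φ ψ, μ.sp φ (T ψ) = μ.sp (D φ) ψ

/-- The integral `∫_P (b ⊗ ϑ) = ω_P(b) ϑ_w` of extended horizontal forms, where `ϑ_w ∈ Σ` is the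
coefficient of `ϑ` at a volume element `w`, extracted by the functional `vol` on `𝕍^∧`. -/
def intP (vol : Q.Ext →ₗ[ℂ] ℂ) : N.HorS M →ₗ[ℂ] Sg :=
  (TensorProduct.lid ℂ Sg).toLinearMap ∘ₗ
    TensorProduct.map μ.omegaP ((TensorProduct.rid ℂ Sg).toLinearMap ∘ₗ vol.lTensor Sg)

end FrameMeasure

/-- `vol` is the coefficient functional at a volume element `w`, a single generator of the top
component `𝕍^{∧m}` of `𝕍^∧`. -/
def IsVolume (Q : CoordForms A d) (vol : Q.Ext →ₗ[ℂ] ℂ) : Prop :=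
  ∃ (m : ℕ) (w : Q.Ext), w ≠ 0 ∧ Q.extDeg m = Submodule.span ℂ {w} ∧
    (∀ k, m < k → Q.extDeg k = ⊥) ∧ vol w = 1 ∧ ∀ k, k < m → ∀ x ∈ Q.extDeg k, vol x = 0

/-- `⋆` is the Hodge operator of `𝕍_Σ^∧`, determined by `g_∧(x, y) = j(x, ⋆y)`, where
`j(x, y) w` is the top component of `x ∧ y`. -/
def IsHodge {Q : CoordForms A d} {Sg : Type*} [Ring Sg] [StarRing Sg] [Algebra ℂ Sg]
    [StarModule ℂ Sg] (M : BraidedMetric Q Sg) (vol : Q.Ext →ₗ[ℂ] ℂ)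
    (hodge : M.VS →ₗ[ℂ] M.VS) : Prop :=
  ∀ x y, M.gWedge x y = TensorProduct.rid ℂ Sg (vol.lTensor Sg (M.mulV x (hodge y)))

end Bundle

end QRiem

end

/-! The formal adjoint is explicit: it is `-∑ i, ∂_i ⊗ ι[θ_i]`, while `∇ = ∑ i, ∂_i ⊗ θ_i` with
`θ_i` acting by left multiplication. That it is the adjoint splits into a statement on the bundle
and a statement on the fibre.

On the bundle, `ω_P(∂_p b) = 0` for every `b` (`omegaP_partialD`). The homogeneity hypothesis gives
this only in divergence form and only for the families `b_{αj} f`. By completeness of the frame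
every family `β` that transforms as the `θ_j` is a sum of such families, so its divergence `∑ C_{ji}
∂_i(β_j)` integrates to zero. Haar averages of an arbitrary `b` against conjugate matrix elements of
`ϰ` are such families, their divergences are `∑ C_{ap} ∫_↑ ∂_p b`, and `C` is invertible. With the
twisted Leibniz rule and hermiticity this becomes integration by parts, `ω_P(b^* ∂_j q) = -∑
C^{-1/2}_{jn} ω_P(∂_n(b)^* q)`.

On the fibre, `ι[θ_n]` is adjoint, for `g_∧`, to left multiplication by `θ_n^* = ∑ C^{-1/2}_{jn}
θ_j` (`gWedge_starV_iota`), so the same matrix `C^{-1/2}` appears on both sides. The proof works in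
`Σ ⊗ 𝕍^⊗`, where `σ`, `g` and `*` must be compatible with coefficients from `Σ`. Each compatibility
is verified on the entries `g_{ij}`, from the braid equation and the axioms for `ν_Σ` and `g ⊗ g`,
and extended to `Σ` by `gen_induction`. The involution and the iterated contraction both reverse the
order of tensor legs. The antisymmetrizer survives this because it factors through coset
representatives from either end, a fact about any ring with braid generators (`antisymUp_flip`,
`antisymUp_flip_rev`).

Uniqueness of the adjoint is nondegeneracy: `ω_P` is faithful, and `g` has dual bases because
`[g_{ij}]` is invertible.

For the Laplacian, the recursion of `A_σ` gives the Clifford relation `ι[θ_i] θ_j = g_{ij} - ∑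
σ_{ij}^{kl} θ_k ι[θ_l]` (`iota_lmulE`). In `-∑ ∂_i ∂_j ⊗ (θ_i ι[θ_j] + ι[θ_i] θ_j)` the metric term
is the second-order part. What remains is the image of `∂_i ∂_j` under `1 - σ`, which is `A_σ` in
degree two, hence the components of `∇²`, that is, of the curvature.

For the Hodge formula, `(b ⊗ ϑ)^* (q ⊗ η)` depends on `b` and `q` only through `F(b^* q)`, and
invariance of `ω_P` replaces the coefficients in `𝒜` by the unit. -/

noncomputable section

set_option linter.unusedSectionVars false

namespace QRiem

/-! ### Antisymmetrizers in a ring with generators satisfying the braid relations -/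

section BraidRing

variable {R : Type*} [Ring R] (s : ℕ → R)

/-- `1 - s_k + s_k s_{k+1} - ⋯ ± s_k ⋯ s_{k+n-1}`. -/
def cosetUp : ℕ → ℕ → R
  | _, 0 => 1
  | k, n + 1 => 1 - s k * cosetUp (k + 1) n

/-- `1 - s_{k+n-1} + s_{k+n-2} s_{k+n-1} - ⋯ ± s_k ⋯ s_{k+n-1}`. -/
def cosetTop (k : ℕ) : ℕ → R
  | 0 => 1
  | n + 1 => 1 - cosetTop k n * s (k + n)

/-- `1 - s_{k+n-1} + s_{k+n-1} s_{k+n-2} - ⋯ ± s_{k+n-1} ⋯ s_k`. -/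
def cosetDown (k : ℕ) : ℕ → R
  | 0 => 1
  | n + 1 => 1 - s (k + n) * cosetDown k n

/-- The antisymmetrizer built from the generators `s_k, …, s_{k+n-1}`. -/
def antisymUp : ℕ → ℕ → R
  | _, 0 => 1
  | k, n + 1 => antisymUp (k + 1) n * cosetUp s k (n + 1)

/-- The product `s_k ⋯ s_{k+n-1}`. -/
def ascProd (k : ℕ) : ℕ → R
  | 0 => 1
  | n + 1 => ascProd k n * s (k + n)

lemma ascProd_succ_left (k n : ℕ) : ascProd s k (n + 1) = s k * ascProd s (k + 1) n := by
  induction n with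
  | zero => simp [ascProd]
  | succ n ih =>
    rw [ascProd, ih, ascProd, mul_assoc]
    congr 3
    omega

lemma cosetUp_succ (k n : ℕ) :
    cosetUp s k (n + 1) = cosetUp s k n + (-1) ^ (n + 1) * ascProd s k (n + 1) := by
  induction n generalizing k with
  | zero => simp [cosetUp, ascProd, sub_eq_add_neg]
  | succ n ih =>
    have h : cosetUp s k (n + 1 + 1) = 1 - s k * cosetUp s (k + 1) (n + 1) := rfl
    rw [h, ih, mul_add, ascProd_succ_left s k (n + 1),
      ← mul_assoc (s k) ((-1) ^ (n + 1)), ((Commute.neg_one_right (s k)).pow_right (n + 1)).eq,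
      pow_succ (-1 : R) (n + 1), cosetUp]
    noncomm_ring

/-- The longest product `s_k ⋯ s_{k+n}` enters here with the same sign as in `cosetUp_succ`. This
common term is what allows the factorizations from the two ends to be compared. -/
lemma cosetTop_succ (k n : ℕ) :
    cosetTop s k (n + 1) = cosetTop s (k + 1) n + (-1) ^ (n + 1) * ascProd s k (n + 1) := by
  induction n with
  | zero => simp [cosetTop, ascProd, sub_eq_add_neg]
  | succ n ih =>
    have h : cosetTop s k (n + 1 + 1) = 1 - cosetTop s k (n + 1) * s (k + (n + 1)) := rfl
    have h2 : ascProd s k (n + 1 + 1) = ascProd s k (n + 1) * s (k + (n + 1)) := rfl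
    have h3 : k + 1 + n = k + (n + 1) := by omega
    rw [h, ih, h2, pow_succ (-1 : R) (n + 1), cosetTop, h3]
    noncomm_ring

section FarCommute

variable {s} (hfar : ∀ i j, i + 2 ≤ j → s i * s j = s j * s i)
include hfar

lemma commute_cosetUp (j k n : ℕ) (h : k + n + 1 ≤ j) : s j * cosetUp s k n = cosetUp s k n * s j := by
  induction n generalizing k with
  | zero => simp [cosetUp]
  | succ n ih =>
    rw [cosetUp, mul_sub, sub_mul, ← mul_assoc, ← hfar k j (by omega), mul_assoc,
      ih (k + 1) (by omega)]
    noncomm_ring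

lemma commute_antisymUp (j k n : ℕ) (h : k + n + 1 ≤ j) :
    s j * antisymUp s k n = antisymUp s k n * s j := by
  induction n generalizing k with
  | zero => simp [antisymUp]
  | succ n ih =>
    rw [antisymUp, ← mul_assoc, ih (k + 1) (by omega), mul_assoc,
      commute_cosetUp hfar j k (n + 1) h, mul_assoc]

lemma commute_ascProd (j k n : ℕ) (h : k + n + 1 ≤ j) :
    s j * ascProd s k n = ascProd s k n * s j := by
  induction n with
  | zero => simp [ascProd]
  | succ n ih =>
    rw [ascProd, ← mul_assoc, ih (by omega), mul_assoc, ← hfar (k + n) j (by omega), mul_assoc]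

variable (hbraid : ∀ i, s i * s (i + 1) * s i = s (i + 1) * s i * s (i + 1))
include hbraid

/-- The factor `s_{j+1}` passes `s_k, …, s_{j-1}`, the braid relation turns `s_{j+1} s_j s_{j+1}`
into `s_j s_{j+1} s_j`, and the last `s_j` passes the remaining factors. No invertibility is needed.
-/
lemma shift_ascProd (j k n : ℕ) (hk : k ≤ j) (hj : j + 2 ≤ k + n) :
    s (j + 1) * ascProd s k n = ascProd s k n * s j := by
  induction n with
  | zero => omega
  | succ n ih =>
    rcases Nat.lt_or_ge (j + 2) (k + n + 1) with h | h
    · rw [ascProd, ← mul_assoc, ih (by omega), mul_assoc, hfar j (k + n) (by omega), mul_assoc]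
    · obtain ⟨m, rfl⟩ : ∃ m, n = m + 1 := ⟨n - 1, by omega⟩
      have h1 : k + m = j := by omega
      have h2 : k + (m + 1) = j + 1 := by omega
      rw [ascProd, ascProd, h1, h2, mul_assoc, ← mul_assoc (s (j + 1)),
        commute_ascProd hfar (j + 1) k m (by omega), mul_assoc, mul_assoc, mul_assoc]
      congr 1
      have := hbraid j
      simpa only [mul_assoc] using this.symm

lemma cosetUp_shift (k n k₀ N : ℕ) (hk : k₀ ≤ k) (hn : k + n + 1 ≤ k₀ + N) :
    cosetUp s (k + 1) n * ascProd s k₀ N = ascProd s k₀ N * cosetUp s k n := by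
  induction n generalizing k with
  | zero => simp [cosetUp]
  | succ n ih =>
    rw [cosetUp, cosetUp, sub_mul, mul_assoc, ih (k + 1) (by omega) (by omega), ← mul_assoc,
      shift_ascProd hfar hbraid k k₀ N hk (by omega)]
    noncomm_ring

lemma antisymUp_shift (k n k₀ N : ℕ) (hk : k₀ ≤ k) (hn : k + n + 1 ≤ k₀ + N) :
    antisymUp s (k + 1) n * ascProd s k₀ N = ascProd s k₀ N * antisymUp s k n := by
  induction n generalizing k with
  | zero => simp [antisymUp]
  | succ n ih =>
    rw [antisymUp, antisymUp, mul_assoc, cosetUp_shift hfar hbraid k (n + 1) k₀ N hk hn,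
      ← mul_assoc, ih (k + 1) (by omega) (by omega), mul_assoc]

/-- The definition splits off the first leg on the right; here the last leg is split off on the
left. All coset terms except the longest are covered by induction, and the longest product carries
the antisymmetrizer of the shifted generators to the unshifted one. -/
lemma antisymUp_succ_top (k n : ℕ) :
    antisymUp s k (n + 1) = cosetTop s k (n + 1) * antisymUp s k n := by
  induction n generalizing k with
  | zero => simp [antisymUp, cosetUp, cosetTop]
  | succ n ih =>
    have h : antisymUp s k (n + 1 + 1) = antisymUp s (k + 1) (n + 1) * cosetUp s k (n + 1 + 1) := rfl
    have h1 : antisymUp s (k + 1) (n + 1) * ((-1) ^ (n + 1 + 1) * ascProd s k (n + 1 + 1)) =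
        (-1) ^ (n + 1 + 1) * ascProd s k (n + 1 + 1) * antisymUp s k (n + 1) := by
      rw [← mul_assoc, ((Commute.neg_one_right _).pow_right (n + 1 + 1)).eq, mul_assoc,
        antisymUp_shift hfar hbraid k (n + 1) k (n + 1 + 1) le_rfl (by omega), mul_assoc]
    rw [h, cosetUp_succ, mul_add, h1, cosetTop_succ s k (n + 1), add_mul]
    congr 1
    rw [ih (k + 1), mul_assoc]
    rfl

/-- The mirror image of the definition, with the last leg split off on the right. It follows from
`antisymUp_succ_top`, because the new generator commutes with the antisymmetrizer of the generators
at distance at least two. -/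
lemma antisymUp_succ_down (k n : ℕ) :
    antisymUp s k (n + 1) = antisymUp s k n * cosetDown s k (n + 1) := by
  induction n with
  | zero => simp [antisymUp, cosetUp, cosetDown]
  | succ n ih =>
    have h1 : cosetTop s k (n + 1) * s (k + (n + 1)) * (antisymUp s k n * cosetDown s k (n + 1)) =
        antisymUp s k (n + 1) * (s (k + (n + 1)) * cosetDown s k (n + 1)) := by
      rw [antisymUp_succ_top hfar hbraid k n, mul_assoc, ← mul_assoc (s (k + (n + 1))),
        commute_antisymUp hfar (k + (n + 1)) k n (by omega)]
      simp only [mul_assoc]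
    calc antisymUp s k (n + 1 + 1)
        = antisymUp s k (n + 1) - cosetTop s k (n + 1) * s (k + (n + 1)) * antisymUp s k (n + 1) := by
          rw [antisymUp_succ_top hfar hbraid k (n + 1)]
          have h : cosetTop s k (n + 1 + 1) = 1 - cosetTop s k (n + 1) * s (k + (n + 1)) := rfl
          rw [h, sub_mul, one_mul]
      _ = antisymUp s k (n + 1) - antisymUp s k (n + 1) * (s (k + (n + 1)) * cosetDown s k (n + 1)) := by
          rw [← h1, ← ih]
      _ = _ := by
          have h : cosetDown s k (n + 1 + 1) = 1 - s (k + (n + 1)) * cosetDown s k (n + 1) := rfl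
          rw [h, mul_sub, mul_one]

end FarCommute

/-- A relation between two rings which is compatible with products relates the antisymmetrizers, if
it relates the generators in the reversed order. -/
lemma antisymUp_flip {R' : Type*} [Ring R'] {s : ℕ → R} {t : ℕ → R'}
    (hfar : ∀ i j, i + 2 ≤ j → t i * t j = t j * t i)
    (hbraid : ∀ i, t i * t (i + 1) * t i = t (i + 1) * t i * t (i + 1))
    (r : R → R' → Prop) (hone : r 1 1) (hsub : ∀ a b a' b', r a b → r a' b' → r (a - a') (b - b'))
    (hmul : ∀ a b a' b', r a b → r a' b' → r (a * a') (b * b')) (n : ℕ)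
    (hgen : ∀ k, k < n → r (s (n - 1 - k)) (t k)) : r (antisymUp s 0 n) (antisymUp t 0 n) := by
  -- Reversal matches the block `s_{n-k}, …, s_{n-1}` with `t_0, …, t_{k-1}`, so splitting off the
  -- first generator on one side is splitting off the last on the other.
  have h1 : ∀ k, k ≤ n → r (cosetUp s (n - k) k) (cosetDown t 0 k) := by
    intro k
    induction k with
    | zero => exact fun _ => hone
    | succ k ih =>
      intro hk
      have h := hgen k (by omega)
      rw [cosetUp, cosetDown, zero_add, show n - (k + 1) + 1 = n - k by omega,
        show n - (k + 1) = n - 1 - k by omega]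
      exact hsub _ _ _ _ hone (hmul _ _ _ _ h (ih (by omega)))
  have h2 : ∀ k, k ≤ n → r (antisymUp s (n - k) k) (antisymUp t 0 k) := by
    intro k
    induction k with
    | zero => exact fun _ => hone
    | succ k ih =>
      intro hk
      rw [antisymUp_succ_down hfar hbraid, antisymUp, show n - (k + 1) + 1 = n - k by omega]
      exact hmul _ _ _ _ (ih (by omega)) (h1 (k + 1) hk)
  simpa using h2 n le_rfl

/-- The version of `antisymUp_flip` for relations which reverse products. -/
lemma antisymUp_flip_rev {R' : Type*} [Ring R'] {s : ℕ → R} {t : ℕ → R'}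
    (hfar : ∀ i j, i + 2 ≤ j → t i * t j = t j * t i)
    (hbraid : ∀ i, t i * t (i + 1) * t i = t (i + 1) * t i * t (i + 1))
    (r : R → R' → Prop) (hone : r 1 1) (hsub : ∀ a b a' b', r a b → r a' b' → r (a - a') (b - b'))
    (hmul : ∀ a b a' b', r a b → r a' b' → r (a * a') (b' * b)) (n : ℕ)
    (hgen : ∀ k, k < n → r (s (n - 1 - k)) (t k)) : r (antisymUp s 0 n) (antisymUp t 0 n) := by
  have h1 : ∀ k, k ≤ n → r (cosetUp s (n - k) k) (cosetTop t 0 k) := by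
    intro k
    induction k with
    | zero => exact fun _ => hone
    | succ k ih =>
      intro hk
      have h := hgen k (by omega)
      rw [cosetUp, cosetTop, zero_add, show n - (k + 1) + 1 = n - k by omega,
        show n - (k + 1) = n - 1 - k by omega]
      exact hsub _ _ _ _ hone (hmul _ _ _ _ h (ih (by omega)))
  have h2 : ∀ k, k ≤ n → r (antisymUp s (n - k) k) (antisymUp t 0 k) := by
    intro k
    induction k with
    | zero => exact fun _ => hone
    | succ k ih =>
      intro hk
      rw [antisymUp_succ_top hfar hbraid, antisymUp, show n - (k + 1) + 1 = n - k by omega]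
      exact hmul _ _ _ _ (ih (by omega)) (h1 (k + 1) hk)
  simpa using h2 n le_rfl

end BraidRing

end QRiem

namespace QRiem

/-! ### Operators on the tensor algebra -/

section TensOps

variable {d : ℕ}

@[simp] lemma word_nil : word ([] : List (Fin d)) = 1 := rfl

lemma word_cons (i : Fin d) (w : List (Fin d)) : word (i :: w) = FreeAlgebra.ι ℂ i * word w := by
  simp [word]

lemma word_append (u w : List (Fin d)) : word (u ++ w) = word u * word w := by
  simp [word]

lemma word_eq_basis (w : List (Fin d)) :
    word w = FreeAlgebra.basisFreeMonoid ℂ (Fin d) (FreeMonoid.ofList w) := by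
  have h : (FreeAlgebra.equivMonoidAlgebraFreeMonoid (R := ℂ) (X := Fin d)).symm
      (MonoidAlgebra.single (FreeMonoid.ofList w) 1) = word w := by
    simp [FreeAlgebra.equivMonoidAlgebraFreeMonoid, word, FreeMonoid.lift_apply]
  rw [← h]
  simp only [FreeAlgebra.basisFreeMonoid, Module.Basis.map_apply, Finsupp.coe_basisSingleOne]
  rfl

@[simp] lemma onWords_word {M : Type*} [AddCommGroup M] [Module ℂ M] (f : List (Fin d) → M)
    (w : List (Fin d)) : onWords f (word w) = f w := by
  rw [word_eq_basis, onWords, Module.Basis.constr_basis]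
  rfl

lemma span_word : Submodule.span ℂ (Set.range (word (d := d))) = ⊤ := by
  have h : Set.range (word (d := d)) = Set.range (FreeAlgebra.basisFreeMonoid ℂ (Fin d)) := by
    ext x
    constructor
    · rintro ⟨w, rfl⟩
      exact ⟨FreeMonoid.ofList w, (word_eq_basis w).symm⟩
    · rintro ⟨w, rfl⟩
      exact ⟨w.toList, word_eq_basis _⟩
  rw [h]
  exact Module.Basis.span_eq _

/-- The maps are semilinear so that the antilinear involution of `𝕍^⊗` is covered as well. -/
lemma tens_ext {M : Type*} [AddCommGroup M] [Module ℂ M] {τ : ℂ →+* ℂ} {f g : Tens d →ₛₗ[τ] M}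
    (h : ∀ w, f (word w) = g (word w)) : f = g :=
  LinearMap.ext_on span_word (by rintro _ ⟨w, rfl⟩; exact h w)

/-- Left multiplication by `θ_i`. -/
def gen (i : Fin d) : Module.End ℂ (Tens d) := LinearMap.mulLeft ℂ (FreeAlgebra.ι ℂ i)

@[simp] lemma gen_apply (i : Fin d) (x : Tens d) : gen i x = FreeAlgebra.ι ℂ i * x := rfl

@[simp] lemma stripLeft_one (k : Fin d) : stripLeft k (1 : Tens d) = 0 := by
  rw [← word_nil, stripLeft, onWords_word]

lemma stripLeft_cons (k i : Fin d) (x : Tens d) :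
    stripLeft k (FreeAlgebra.ι ℂ i * x) = if i = k then x else 0 := by
  have h : stripLeft k ∘ₗ gen i = if i = k then LinearMap.id else 0 := by
    refine tens_ext fun w => ?_
    rw [LinearMap.comp_apply, gen_apply, ← word_cons, stripLeft, onWords_word]
    change (if i = k then word w else 0) = _
    split_ifs <;> rfl
  have := LinearMap.congr_fun h x
  rw [LinearMap.comp_apply, gen_apply] at this
  rw [this]
  split_ifs <;> simp

lemma stripLeft_ι (k i : Fin d) :
    stripLeft k (FreeAlgebra.ι ℂ i) = if i = k then 1 else 0 := by
  simpa using stripLeft_cons k i 1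

lemma stripLeft_stripLeft_ι (k l i : Fin d) : stripLeft l (stripLeft k (FreeAlgebra.ι ℂ i)) = 0 := by
  rw [stripLeft_ι]
  split_ifs <;> simp

lemma stripLeft_mul_gen (k i : Fin d) :
    (stripLeft k : Module.End ℂ (Tens d)) * gen i = if i = k then 1 else 0 := by
  refine LinearMap.ext fun x => ?_
  rw [Module.End.mul_apply, gen_apply, stripLeft_cons]
  split_ifs <;> simp

/-- `θ_i ⊗ t ↦ θ_i ⊗ X t`, and scalars go to `0`. -/
def shiftOp : Module.End ℂ (Tens d) →ₗ[ℂ] Module.End ℂ (Tens d) where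
  toFun X := ∑ i, gen i * X * stripLeft i
  map_add' X Y := by simp [mul_add, add_mul, Finset.sum_add_distrib]
  map_smul' c X := by simp [Finset.smul_sum]

lemma shiftOp_apply (X : Module.End ℂ (Tens d)) :
    shiftOp X = ∑ i, gen i * X * stripLeft i := rfl

lemma shiftOp_mul_gen (X : Module.End ℂ (Tens d)) (i : Fin d) : shiftOp X * gen i = gen i * X := by
  simp [shiftOp_apply, Finset.sum_mul, mul_assoc, stripLeft_mul_gen]

lemma stripLeft_mul_shiftOp (X : Module.End ℂ (Tens d)) (i : Fin d) :
    stripLeft i * shiftOp X = X * stripLeft i := by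
  simp [shiftOp_apply, Finset.mul_sum, ← mul_assoc, stripLeft_mul_gen]

lemma shiftOp_mul (X Y : Module.End ℂ (Tens d)) : shiftOp (X * Y) = shiftOp X * shiftOp Y := by
  rw [shiftOp_apply Y, Finset.mul_sum]
  simp only [← mul_assoc, shiftOp_mul_gen]
  rfl

lemma shiftOp_cons (X : Module.End ℂ (Tens d)) (i : Fin d) (x : Tens d) :
    shiftOp X (FreeAlgebra.ι ℂ i * x) = FreeAlgebra.ι ℂ i * X x :=
  LinearMap.congr_fun (shiftOp_mul_gen X i) x

@[simp] lemma shiftOp_one (X : Module.End ℂ (Tens d)) : shiftOp X (1 : Tens d) = 0 := by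
  simp [shiftOp_apply]

/-- The operator with the matrix `m` on the legs `n`, `n + 1` of tensors (counted from `0`); it
vanishes on tensors without these legs. -/
def legOp (m : Matrix (Fin d × Fin d) (Fin d × Fin d) ℂ) : ℕ → Module.End ℂ (Tens d)
  | 0 => ∑ p : Fin d × Fin d, ∑ q : Fin d × Fin d,
      m p q • (gen p.1 * gen p.2 * (stripLeft q.2 * stripLeft q.1))
  | n + 1 => shiftOp (legOp m n)

variable (m : Matrix (Fin d × Fin d) (Fin d × Fin d) ℂ)

lemma stripLeft_mul_gen_pair (q : Fin d × Fin d) (a b : Fin d) :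
    (stripLeft q.2 * stripLeft q.1 : Module.End ℂ (Tens d)) * (gen a * gen b) =
      if q = (a, b) then 1 else 0 := by
  rw [mul_assoc, ← mul_assoc (stripLeft q.1), stripLeft_mul_gen]
  obtain ⟨x, y⟩ := q
  by_cases h : a = x
  · subst h
    simp only [if_true, one_mul, stripLeft_mul_gen, Prod.mk.injEq, true_and]
    by_cases h2 : b = y
    · simp [h2]
    · rw [if_neg h2, if_neg (Ne.symm h2)]
  · have : (x, y) ≠ (a, b) := fun h2 => h (Prod.mk.inj h2).1.symm
    rw [if_neg h, if_neg this, zero_mul, mul_zero]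

lemma legOp_zero_mul_gen (a b : Fin d) :
    legOp m 0 * (gen a * gen b) = ∑ p : Fin d × Fin d, m p (a, b) • (gen p.1 * gen p.2) := by
  simp only [legOp, Finset.sum_mul, smul_mul_assoc, mul_assoc (gen _ * gen _),
    stripLeft_mul_gen_pair]
  simp

lemma legOp_zero_cons (a b : Fin d) (x : Tens d) :
    legOp m 0 (FreeAlgebra.ι ℂ a * (FreeAlgebra.ι ℂ b * x)) =
      ∑ p : Fin d × Fin d, m p (a, b) • (FreeAlgebra.ι ℂ p.1 * (FreeAlgebra.ι ℂ p.2 * x)) := by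
  have h := LinearMap.congr_fun (legOp_zero_mul_gen m a b) x
  simpa [LinearMap.sum_apply] using h

lemma legOp_zero_mul_gen' (a b : Fin d) (X : Module.End ℂ (Tens d)) :
    legOp m 0 * (gen a * gen b * X) =
      ∑ p : Fin d × Fin d, m p (a, b) • (gen p.1 * gen p.2 * X) := by
  rw [← mul_assoc, legOp_zero_mul_gen, Finset.sum_mul]
  simp only [smul_mul_assoc]

lemma legOp_mul_legOp (m' : Matrix (Fin d × Fin d) (Fin d × Fin d) ℂ) (n : ℕ) :
    legOp m n * legOp m' n = legOp (m * m') n := by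
  induction n with
  | zero =>
    have h : legOp m' 0 = ∑ p : Fin d × Fin d, ∑ q : Fin d × Fin d,
      m' p q • (gen p.1 * gen p.2 * (stripLeft q.2 * stripLeft q.1)) := rfl
    rw [h]
    simp only [Finset.mul_sum, mul_smul_comm, legOp_zero_mul_gen']
    rw [legOp]
    simp only [Finset.smul_sum, smul_smul, Matrix.mul_apply, Finset.sum_smul]
    calc _ = ∑ x : Fin d × Fin d, ∑ i : Fin d × Fin d, ∑ q : Fin d × Fin d,
        (m' x q * m i (x.1, x.2)) • (gen i.1 * gen i.2 * (stripLeft q.2 * stripLeft q.1)) :=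
          Finset.sum_congr rfl fun x _ => Finset.sum_comm
      _ = _ := by
          rw [Finset.sum_comm]
          refine Finset.sum_congr rfl fun i _ => ?_
          rw [Finset.sum_comm]
          refine Finset.sum_congr rfl fun q _ => Finset.sum_congr rfl fun x _ => ?_
          rw [mul_comm]
  | succ n ih => rw [legOp, legOp, ← shiftOp_mul, ih]; rfl

lemma legOp_far (m' : Matrix (Fin d × Fin d) (Fin d × Fin d) ℂ) (i j : ℕ) (h : i + 2 ≤ j) :
    legOp m i * legOp m' j = legOp m' j * legOp m i := by
  induction i generalizing j with
  | zero =>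
    obtain ⟨k, rfl⟩ : ∃ k, j = k + 2 := ⟨j - 2, by omega⟩
    have h1 : ∀ a b X, legOp m' (k + 2) * (gen a * gen b * X) = gen a * gen b * (legOp m' k * X) := by
      intro a b X
      rw [legOp, mul_assoc, ← mul_assoc, shiftOp_mul_gen, mul_assoc, legOp, ← mul_assoc (shiftOp _),
        shiftOp_mul_gen]
      simp only [mul_assoc]
    have h2 : ∀ a b X, X * (stripLeft a * stripLeft b) * legOp m' (k + 2) =
        X * (legOp m' k * (stripLeft a * stripLeft b)) := by
      intro a b X
      rw [mul_assoc, legOp, mul_assoc, stripLeft_mul_shiftOp, ← mul_assoc (stripLeft a), legOp,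
        stripLeft_mul_shiftOp, mul_assoc]
    have h3 : legOp m 0 = ∑ p : Fin d × Fin d, ∑ q : Fin d × Fin d,
      m p q • (gen p.1 * gen p.2 * (stripLeft q.2 * stripLeft q.1)) := rfl
    rw [h3]
    simp only [Finset.mul_sum, Finset.sum_mul, smul_mul_assoc, mul_smul_comm, h1, h2]
  | succ i ih =>
    obtain ⟨k, rfl⟩ : ∃ k, j = k + 1 := ⟨j - 1, by omega⟩
    rw [legOp, legOp, ← shiftOp_mul, ih k (by omega), shiftOp_mul]

/-- The tensors of degree `n`. -/
def homTens (d n : ℕ) : Submodule ℂ (Tens d) :=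
  Submodule.span ℂ (word '' {w | w.length = n})

lemma word_mem_homTens (w : List (Fin d)) : word w ∈ homTens d w.length :=
  Submodule.subset_span ⟨w, rfl, rfl⟩

lemma word_mem_homTens' {w : List (Fin d)} {n : ℕ} (h : w.length = n) : word w ∈ homTens d n :=
  h ▸ word_mem_homTens w

lemma homTens_le {n : ℕ} {S : Submodule ℂ (Tens d)}
    (h : ∀ w : List (Fin d), w.length = n → word w ∈ S) : homTens d n ≤ S :=
  Submodule.span_le.2 (by rintro _ ⟨w, hw, rfl⟩; exact h w hw)

lemma homTens_ext {n : ℕ} {M : Type*} [AddCommGroup M] [Module ℂ M] {τ : ℂ →+* ℂ}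
    {f g : Tens d →ₛₗ[τ] M}
    (h : ∀ w : List (Fin d), w.length = n → f (word w) = g (word w)) {x : Tens d}
    (hx : x ∈ homTens d n) : f x = g x := by
  have : homTens d n ≤ LinearMap.eqLocus f g := homTens_le fun w hw => h w hw
  exact this hx

lemma mul_mem_homTens {k n : ℕ} {x y : Tens d} (hx : x ∈ homTens d k) (hy : y ∈ homTens d n) :
    x * y ∈ homTens d (k + n) := by
  have h1 : ∀ u : List (Fin d), u.length = k → homTens d n ≤
      (homTens d (k + n)).comap (LinearMap.mulLeft ℂ (word u)) := fun u hu =>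
    homTens_le fun w hw => by
      rw [Submodule.mem_comap, LinearMap.mulLeft_apply, ← word_append]
      exact word_mem_homTens' (by simp [hu, hw])
  have h2 : homTens d k ≤ (homTens d (k + n)).comap (LinearMap.mulRight ℂ y) :=
    homTens_le fun u hu => h1 u hu hy
  exact h2 hx

lemma ι_mem_homTens (i : Fin d) : FreeAlgebra.ι ℂ i ∈ homTens d 1 := by
  simpa [word_cons] using word_mem_homTens [i]

lemma cons_mem_homTens {n : ℕ} {x : Tens d} (i : Fin d) (hx : x ∈ homTens d n) :
    FreeAlgebra.ι ℂ i * x ∈ homTens d (n + 1) := by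
  rw [add_comm]
  exact mul_mem_homTens (ι_mem_homTens i) hx

lemma shiftOp_mem_homTens {X : Module.End ℂ (Tens d)} {n : ℕ}
    (hX : ∀ x ∈ homTens d n, X x ∈ homTens d n) :
    ∀ x ∈ homTens d (n + 1), shiftOp X x ∈ homTens d (n + 1) := by
  have : homTens d (n + 1) ≤ (homTens d (n + 1)).comap (shiftOp X) := homTens_le fun w hw => by
    obtain _ | ⟨i, u⟩ := w
    · simp at hw
    · rw [Submodule.mem_comap, word_cons, shiftOp_cons]
      exact cons_mem_homTens i (hX _ (word_mem_homTens' (by simpa using hw)))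
  exact fun x hx => this hx

lemma legOp_mem_homTens (k n : ℕ) : ∀ x ∈ homTens d n, legOp m k x ∈ homTens d n := by
  induction k generalizing n with
  | zero =>
    have : homTens d n ≤ (homTens d n).comap (legOp m 0) := homTens_le fun w hw => by
      rw [Submodule.mem_comap]
      match w, hw with
      | [], _ => simp [legOp]
      | [i], _ => simp [legOp, word_cons, stripLeft_stripLeft_ι]
      | i :: j :: u, hw =>
        rw [word_cons, word_cons, legOp_zero_cons]
        refine Submodule.sum_mem _ fun p _ => Submodule.smul_mem _ _ ?_
        rw [← hw]
        exact cons_mem_homTens _ (cons_mem_homTens _ (word_mem_homTens u))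
    exact fun x hx => this hx
  | succ k ih =>
    obtain _ | n := n
    · have : homTens d 0 ≤ (homTens d 0).comap (legOp m (k + 1)) := homTens_le fun w hw => by
        rw [List.length_eq_zero_iff.1 hw]
        simp [legOp]
      exact fun x hx => this hx
    · exact shiftOp_mem_homTens (ih n)

lemma shiftOp_mul_right {X : Module.End ℂ (Tens d)} {n : ℕ} {y : Tens d}
    (hX : ∀ x ∈ homTens d n, X (x * y) = X x * y) :
    ∀ x ∈ homTens d (n + 1), shiftOp X (x * y) = shiftOp X x * y := by
  intro x hx
  refine homTens_ext (f := shiftOp X ∘ₗ LinearMap.mulRight ℂ y)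
    (g := LinearMap.mulRight ℂ y ∘ₗ shiftOp X) (fun w hw => ?_) hx
  obtain _ | ⟨i, u⟩ := w
  · simp at hw
  · simp only [LinearMap.comp_apply, LinearMap.mulRight_apply, word_cons, mul_assoc, shiftOp_cons]
    rw [hX _ (word_mem_homTens' (by simpa using hw))]

lemma legOp_mul_right (k n : ℕ) (h : k + 2 ≤ n) (y : Tens d) :
    ∀ x ∈ homTens d n, legOp m k (x * y) = legOp m k x * y := by
  induction k generalizing n with
  | zero =>
    intro x hx
    refine homTens_ext (f := legOp m 0 ∘ₗ LinearMap.mulRight ℂ y)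
      (g := LinearMap.mulRight ℂ y ∘ₗ legOp m 0) (fun w hw => ?_) hx
    match w, hw with
    | [], hw => simp at hw; omega
    | [i], hw => simp at hw; omega
    | i :: j :: u, hw =>
      simp only [LinearMap.comp_apply, LinearMap.mulRight_apply, word_cons, mul_assoc,
        legOp_zero_cons, Finset.sum_mul, smul_mul_assoc]
  | succ k ih =>
    obtain _ | n := n
    · omega
    · exact shiftOp_mul_right (ih n (by omega))

lemma legOp_mul_left (u : List (Fin d)) (k : ℕ) (x : Tens d) :
    legOp m (u.length + k) (word u * x) = word u * legOp m k x := by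
  induction u with
  | nil => simp
  | cons i u ih =>
    rw [List.length_cons, show u.length + 1 + k = u.length + k + 1 by omega, legOp, word_cons,
      mul_assoc, shiftOp_cons, ih, mul_assoc]

lemma legOp_short (k : ℕ) (w : List (Fin d)) (h : w.length < k + 2) : legOp m k (word w) = 0 := by
  induction k generalizing w with
  | zero =>
    match w, h with
    | [], _ => simp [legOp]
    | [i], _ => simp [legOp, word_cons, stripLeft_stripLeft_ι]
    | i :: j :: u, h => simp at h
  | succ k ih =>
    obtain _ | ⟨i, u⟩ := w
    · simp [legOp]
    · rw [word_cons, legOp, shiftOp_cons, ih u (by simpa using h), mul_zero]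

lemma braidFst_cons (i j : Fin d) (x : Tens d) :
    braidFst m (FreeAlgebra.ι ℂ i * (FreeAlgebra.ι ℂ j * x)) =
      legOp m 0 (FreeAlgebra.ι ℂ i * (FreeAlgebra.ι ℂ j * x)) := by
  have h : braidFst m ∘ₗ gen i ∘ₗ gen j = legOp m 0 ∘ₗ gen i ∘ₗ gen j := by
    refine tens_ext fun w => ?_
    simp only [LinearMap.comp_apply, gen_apply, legOp_zero_cons]
    rw [← word_cons, ← word_cons, braidFst, onWords_word, Fintype.sum_prod_type]
    simp only [word_cons]
  exact LinearMap.congr_fun h x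

/-- Degree at least two is essential: on shorter tensors `braidFst` is the identity while `legOp m
0` is zero. -/
lemma braidFst_eq {n : ℕ} {x : Tens d} (hx : x ∈ homTens d (n + 2)) :
    braidFst m x = legOp m 0 x := by
  refine homTens_ext (fun w hw => ?_) hx
  match w, hw with
  | i :: j :: u, _ => rw [word_cons, word_cons, braidFst_cons]

lemma idTensor_cons (X : Tens d →ₗ[ℂ] Tens d) (i : Fin d) (x : Tens d) :
    idTensor X (FreeAlgebra.ι ℂ i * x) = FreeAlgebra.ι ℂ i * X x := by
  have h : idTensor X ∘ₗ gen i = gen i ∘ₗ X := by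
    refine tens_ext fun w => ?_
    simp only [LinearMap.comp_apply, gen_apply]
    rw [← word_cons, idTensor, onWords_word]
  exact LinearMap.congr_fun h x

lemma idTensor_eq {X Y : Module.End ℂ (Tens d)} {n : ℕ} (h : ∀ x ∈ homTens d n, X x = Y x)
    {x : Tens d} (hx : x ∈ homTens d (n + 1)) : idTensor X x = shiftOp Y x := by
  refine homTens_ext (fun w hw => ?_) hx
  match w, hw with
  | i :: u, hw =>
    rw [word_cons, idTensor_cons, shiftOp_cons, h _ (word_mem_homTens' (by simpa using hw))]

lemma legOp_braid (h : ∀ i j k : Fin d,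
    braidFst m (idTensor (braidFst m) (braidFst m (word [i, j, k]))) =
      idTensor (braidFst m) (braidFst m (idTensor (braidFst m) (word [i, j, k])))) (n : ℕ) :
    legOp m n * legOp m (n + 1) * legOp m n = legOp m (n + 1) * legOp m n * legOp m (n + 1) := by
  induction n with
  | zero =>
    refine tens_ext fun w => ?_
    simp only [Module.End.mul_apply]
    -- Below degree three both sides vanish, since each contains `legOp m 1` and leg operators
    -- preserve the degree. From degree three on, only the first three letters matter.
    rcases Nat.lt_or_ge w.length 3 with hw | hw
    · rw [legOp_short m 1 w (by omega)]
      have h1 : legOp m 1 (legOp m 0 (word w)) = 0 :=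
        (homTens_ext (n := w.length) (f := legOp m 1) (g := 0)
          (fun u hu => legOp_short m 1 u (by omega)) (legOp_mem_homTens m 0 _ _
            (word_mem_homTens w)))
      simp only [zero_add] at h1 ⊢
      rw [h1]
      simp
    · match w, hw with
      | i :: j :: k :: u, _ =>
        have e3 : word [i, j, k] ∈ homTens d 3 := word_mem_homTens' rfl
        have hb : ∀ x ∈ homTens d 3, braidFst m x = legOp m 0 x := fun x hx => braidFst_eq m hx
        have hi : ∀ x ∈ homTens d 3, idTensor (braidFst m) x = legOp m 1 x := fun x hx =>
          idTensor_eq (n := 2) (fun x hx => braidFst_eq m hx) hx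
        have hm := fun k => legOp_mem_homTens m k 3
        have hh := h i j k
        rw [hb _ e3, hi _ (hm 0 _ e3), hb _ (hm 1 _ (hm 0 _ e3)), hi _ e3, hb _ (hm 1 _ e3),
          hi _ (hm 0 _ (hm 1 _ e3))] at hh
        have e : word (i :: j :: k :: u) = word [i, j, k] * word u := by rw [← word_append]; rfl
        have r0 := legOp_mul_right m 0 3 (by omega) (word u)
        have r1 := legOp_mul_right m 1 3 (by omega) (word u)
        simp only [zero_add]
        rw [e, r0 _ e3, r1 _ (hm 0 _ e3), r0 _ (hm 1 _ (hm 0 _ e3)), r1 _ e3, r0 _ (hm 1 _ e3),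
          r1 _ (hm 0 _ (hm 1 _ e3)), hh]
  | succ n ih =>
    have h1 : legOp m (n + 1) = shiftOp (legOp m n) := rfl
    have h2 : legOp m (n + 1 + 1) = shiftOp (legOp m (n + 1)) := rfl
    rw [h2]
    simp only [h1]
    rw [← shiftOp_mul, ← shiftOp_mul, ← shiftOp_mul, ← shiftOp_mul]
    rw [← h1, ih]

/-! ### The braided antisymmetrizer -/

/-- The sum over the coset representatives, as an operator on the tensor algebra. -/
def cosetOp : Module.End ℂ (Tens d) := onWords (cosetSum m)

lemma cosetSum_mem (w : List (Fin d)) : cosetSum m w ∈ homTens d w.length := by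
  match w with
  | [] => exact word_mem_homTens' rfl
  | [i] => exact word_mem_homTens' rfl
  | i :: j :: u =>
    rw [cosetSum]
    have h := cons_mem_homTens i (cosetSum_mem (j :: u))
    refine Submodule.sub_mem _ (word_mem_homTens _) ?_
    rw [braidFst_eq m (n := u.length) h]
    exact legOp_mem_homTens m 0 _ _ h

lemma cosetOp_one : cosetOp m (1 : Tens d) = 1 := by
  rw [← word_nil, cosetOp, onWords_word]
  rfl

lemma cosetOp_mem {n : ℕ} : ∀ x ∈ homTens d n, cosetOp m x ∈ homTens d n := by
  have : homTens d n ≤ (homTens d n).comap (cosetOp m) := homTens_le fun w hw => by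
    rw [Submodule.mem_comap, cosetOp, onWords_word, ← hw]
    exact cosetSum_mem m w
  exact fun x hx => this hx

/-- The recursion of `cosetSum` as an operator identity without reference to degrees. On a single
leg it stays correct because `legOp m 0` vanishes there. The Clifford relations come from this
identity. -/
lemma cosetOp_mul_gen (j : Fin d) :
    cosetOp m * gen j = gen j - legOp m 0 * gen j * cosetOp m := by
  refine tens_ext fun w => ?_
  simp only [Module.End.mul_apply, LinearMap.sub_apply, gen_apply]
  rw [← word_cons, cosetOp, onWords_word, onWords_word]
  match w with
  | [] => simp [cosetSum, word_cons, legOp, stripLeft_stripLeft_ι]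
  | i :: u =>
    rw [cosetSum, braidFst_eq m (n := u.length) (cons_mem_homTens j (cosetSum_mem m (i :: u)))]

lemma antisym_one : antisym m (1 : Tens d) = 1 := by
  rw [← word_nil, antisym, onWords_word]
  rfl

lemma antisym_eq_deg {n : ℕ} {x : Tens d} (hx : x ∈ homTens d n) :
    antisym m x = antisymDeg m n x := by
  refine homTens_ext (fun w hw => ?_) hx
  rw [antisym, onWords_word, hw]

/-- In positive degree `A_σ` is `id ⊗ A_σ` after the coset sum. A contraction of the first leg
therefore maps the image of `A_σ` into itself. -/
lemma antisym_mul_gen (j : Fin d) :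
    (antisym m : Module.End ℂ (Tens d)) * gen j = shiftOp (antisym m) * cosetOp m * gen j := by
  refine tens_ext fun w => ?_
  simp only [Module.End.mul_apply, gen_apply]
  have h := cons_mem_homTens j (word_mem_homTens w)
  rw [antisym_eq_deg m h, antisymDeg, LinearMap.comp_apply]
  exact idTensor_eq (fun x hx => (antisym_eq_deg m hx).symm) (cosetOp_mem m _ h)

lemma antisym_mem (n : ℕ) : ∀ x ∈ homTens d n, antisym m x ∈ homTens d n := by
  induction n with
  | zero =>
    have : homTens d 0 ≤ (homTens d 0).comap (antisym m) := homTens_le fun w hw => by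
      rw [List.length_eq_zero_iff.1 hw, Submodule.mem_comap, word_nil, antisym_one]
      exact word_mem_homTens' (w := []) rfl
    exact fun x hx => this hx
  | succ n ih =>
    have : homTens d (n + 1) ≤ (homTens d (n + 1)).comap (antisym m) := homTens_le fun w hw => by
      match w, hw with
      | j :: u, hw =>
        rw [Submodule.mem_comap, word_cons]
        have h := LinearMap.congr_fun (antisym_mul_gen m j) (word u)
        simp only [Module.End.mul_apply, gen_apply] at h
        rw [h]
        refine shiftOp_mem_homTens ih _ (cosetOp_mem m _ ?_)
        exact cons_mem_homTens j (word_mem_homTens' (by simpa using hw))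
    exact fun x hx => this hx

lemma shiftOp_cosetUp_mul_gen (k n : ℕ) (j : Fin d) :
    cosetUp (legOp m) (k + 1) n * gen j = gen j * cosetUp (legOp m) k n := by
  induction n generalizing k with
  | zero => simp [cosetUp]
  | succ n ih =>
    rw [cosetUp, sub_mul, mul_assoc, ih, ← mul_assoc, legOp, shiftOp_mul_gen, cosetUp, mul_sub]
    simp only [one_mul, mul_one, mul_assoc]

lemma shiftOp_antisymUp_mul_gen (k n : ℕ) (j : Fin d) :
    antisymUp (legOp m) (k + 1) n * gen j = gen j * antisymUp (legOp m) k n := by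
  induction n generalizing k with
  | zero => simp [antisymUp]
  | succ n ih =>
    rw [antisymUp, mul_assoc, shiftOp_cosetUp_mul_gen, ← mul_assoc, ih, antisymUp, mul_assoc]

lemma cosetOp_eq_cosetUp (n : ℕ) :
    ∀ x ∈ homTens d (n + 1), cosetOp m x = cosetUp (legOp m) 0 n x := by
  induction n with
  | zero =>
    refine fun x hx => homTens_ext (fun w hw => ?_) hx
    match w, hw with
    | [i], _ => rw [cosetOp, onWords_word]; rfl
  | succ n ih =>
    refine fun x hx => homTens_ext (fun w hw => ?_) hx
    match w, hw with
    | j :: u, hw =>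
      have h := LinearMap.congr_fun (cosetOp_mul_gen m j) (word u)
      have h2 := LinearMap.congr_fun (shiftOp_cosetUp_mul_gen m 0 n j) (word u)
      simp only [Module.End.mul_apply, gen_apply, LinearMap.sub_apply] at h h2
      rw [word_cons, h, ih _ (word_mem_homTens' (by simpa using hw)), cosetUp,
        LinearMap.sub_apply, Module.End.mul_apply, h2]
      rfl

/-- A tensor of degree `n + 1` has `n` pairs of neighbouring legs. This identification makes the
factorizations from the other end available for `A_σ`. -/
lemma antisym_eq_antisymUp (n : ℕ) :
    ∀ x ∈ homTens d (n + 1), antisym m x = antisymUp (legOp m) 0 n x := by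
  induction n with
  | zero =>
    refine fun x hx => homTens_ext (fun w hw => ?_) hx
    match w, hw with
    | [i], _ =>
      have h := LinearMap.congr_fun (antisym_mul_gen m i) 1
      have h2 := cosetOp_eq_cosetUp m 0 _ (word_mem_homTens [i])
      simp only [Module.End.mul_apply, gen_apply] at h
      rw [word_cons, word_nil] at h2 ⊢
      rw [h, h2]
      simp [cosetUp, antisymUp, shiftOp_cons, antisym_one, -mul_one]
  | succ n ih =>
    refine fun x hx => homTens_ext (fun w hw => ?_) hx
    match w, hw with
    | j :: u, hw =>
      have hu : word (j :: u) ∈ homTens d (n + 1 + 1) := word_mem_homTens' hw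
      have h := LinearMap.congr_fun (antisym_mul_gen m j) (word u)
      simp only [Module.End.mul_apply, gen_apply] at h
      rw [← word_cons] at h
      have hc : ∀ y ∈ homTens d (n + 1 + 1), shiftOp (antisym m) y =
          antisymUp (legOp m) 1 n y := by
        refine fun y hy => homTens_ext (fun w hw => ?_) hy
        match w, hw with
        | i :: v, hv =>
          have h3 := LinearMap.congr_fun (shiftOp_antisymUp_mul_gen m 0 n i) (word v)
          simp only [Module.End.mul_apply, gen_apply] at h3
          rw [word_cons, shiftOp_cons, ih _ (word_mem_homTens' (by simpa using hv)), h3]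
      rw [h, hc _ (cosetOp_mem m _ hu), cosetOp_eq_cosetUp m (n + 1) _ hu, antisymUp]
      rfl

end TensOps

end QRiem

namespace QRiem

/-! ### Leg operators of the identity matrix -/

section UnitLeg

variable {d : ℕ} (m : Matrix (Fin d × Fin d) (Fin d × Fin d) ℂ)

/-- `legOp 1 k` is the projection onto the tensors that possess the legs `k` and `k + 1`, not the
identity. It is what remains of a leg operator multiplied by that of the inverse matrix. -/
lemma legOp_one_word (k : ℕ) (w : List (Fin d)) :
    legOp (1 : Matrix (Fin d × Fin d) (Fin d × Fin d) ℂ) k (word w) =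
      if k + 2 ≤ w.length then word w else 0 := by
  induction k generalizing w with
  | zero =>
    match w with
    | [] => simp [legOp]
    | [i] => simp [legOp, word_cons, stripLeft_stripLeft_ι]
    | i :: j :: u =>
      rw [word_cons, word_cons, legOp_zero_cons]
      simp [Matrix.one_apply]
  | succ k ih =>
    obtain _ | ⟨i, u⟩ := w
    · simp [legOp]
    · rw [word_cons, legOp, shiftOp_cons, ih]
      simp only [List.length_cons]
      by_cases h : k + 2 ≤ u.length
      · rw [if_pos h, if_pos (by omega)]
      · rw [if_neg h, if_neg (by omega), mul_zero]

lemma legOp_one_of_le {k n : ℕ} (h : k + 2 ≤ n) {x : Tens d} (hx : x ∈ homTens d n) :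
    legOp 1 k x = x :=
  homTens_ext (g := LinearMap.id)
    (fun w hw => by rw [legOp_one_word, if_pos (by omega)]; rfl) hx

lemma legOp_one_of_lt {k n : ℕ} (h : n < k + 2) {x : Tens d} (hx : x ∈ homTens d n) :
    legOp 1 k x = 0 :=
  homTens_ext (g := 0) (fun w hw => by rw [legOp_one_word, if_neg (by omega)]; rfl) hx

lemma legOp_one_comm (k n : ℕ) : legOp 1 k * legOp m n = legOp m n * legOp 1 k := by
  refine tens_ext fun w => ?_
  simp only [Module.End.mul_apply]
  have h := legOp_mem_homTens m n _ _ (word_mem_homTens w)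
  rw [legOp_one_word]
  split_ifs with hk
  · exact legOp_one_of_le hk h
  · rw [legOp_one_of_lt (by omega) h, map_zero]

lemma legOp_mul_one {k n : ℕ} (hk : k ≤ n) : legOp m n * legOp 1 k = legOp m n := by
  refine tens_ext fun w => ?_
  rw [Module.End.mul_apply, legOp_one_word]
  split_ifs with h
  · rfl
  · rw [legOp_short m n w (by omega), map_zero]

lemma legOp_one_mul {k n : ℕ} (hk : k ≤ n) : legOp 1 k * legOp m n = legOp m n := by
  rw [legOp_one_comm, legOp_mul_one m hk]

end UnitLeg

/-! ### Coefficients from `Σ`: extension from the generators and operators on `Σ ⊗ 𝕍^⊗` -/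

section Extended

variable {A : Type*} [Ring A] [StarRing A] [HopfAlgebra ℂ A] [StarModule ℂ A] {d : ℕ}
  {Q : CoordForms A d} {Sg : Type*} [Ring Sg] [StarRing Sg] [Algebra ℂ Sg] [StarModule ℂ Sg]

namespace BraidedMetric

/-- An identity which holds for the generators `g_{ij}` holds on all of `Σ`. -/
lemma gen_induction (M : BraidedMetric Q Sg) {W : Type*} [AddCommGroup W] (Ψ : Sg →+ W)
    (act : Sg → W →+ W)
    (act_add : ∀ p q w, act (p + q) w = act p w + act q w) (act_one : ∀ w, act 1 w = w)
    (act_mul : ∀ p q w, act (p * q) w = act q (act p w))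
    (halg : ∀ (c : ℂ) p, Ψ (p * algebraMap ℂ Sg c) = act (algebraMap ℂ Sg c) (Ψ p))
    (hg : ∀ i j p, Ψ (p * M.g i j) = act (M.g i j) (Ψ p)) (q p : Sg) :
    Ψ (p * q) = act q (Ψ p) := by
  have act_zero : ∀ w, act 0 w = 0 := fun w => by
    have := act_add 0 0 w
    simpa using this
  have act_sum : ∀ (f : Fin d → Sg) w, act (∑ i, f i) w = ∑ i, act (f i) w := fun f w =>
    map_sum (⟨⟨fun q => act q w, act_zero w⟩, fun p q => act_add p q w⟩ : Sg →+ W) f _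
  have hq : q ∈ Algebra.adjoin ℂ {q | ∃ i j, q = M.g i j ∨ q = M.gInv i j} := by
    rw [M.minimal]; trivial
  induction hq using Algebra.adjoin_induction generalizing p with
  | algebraMap c => exact halg c p
  | add x y _ _ hx hy => rw [mul_add, map_add, hx, hy, act_add]
  | mul x y _ _ hx hy => rw [← mul_assoc, hy, hx, act_mul]
  | mem x hx =>
    obtain ⟨k, n, rfl | rfl⟩ := hx
    · exact hg k n p
    -- For the entries of `g⁻¹`, the values `Ψ (p * M.gInv k l)` solve a linear system with matrix
    -- `g`, by the known case of the entries of `g` and `g⁻¹ g = 1`. Acting with `g⁻¹` and using `g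
    -- g⁻¹ = 1` solves it.
    · have h1 : ∀ m, ∑ l, act (M.g l m) (Ψ (p * M.gInv k l)) = if k = m then Ψ p else 0 := by
        intro m
        have h := congrFun (congrFun M.gInv_mul_g k) m
        rw [Matrix.mul_apply] at h
        simp only [← hg, ← map_sum, mul_assoc, ← Finset.mul_sum, h, Matrix.one_apply]
        split_ifs <;> simp
      have h2 : ∀ l, ∑ m, act (M.gInv m n) (act (M.g l m) (Ψ (p * M.gInv k l))) =
          if l = n then Ψ (p * M.gInv k l) else 0 := by
        intro l
        have h := congrFun (congrFun M.g_mul_gInv l) n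
        rw [Matrix.mul_apply] at h
        simp only [← act_mul]
        rw [← act_sum, h, Matrix.one_apply]
        split_ifs
        · exact act_one _
        · exact act_zero _
      calc Ψ (p * M.gInv k n) = ∑ l, if l = n then Ψ (p * M.gInv k l) else 0 := by simp
        _ = ∑ l, ∑ m, act (M.gInv m n) (act (M.g l m) (Ψ (p * M.gInv k l))) := by simp only [h2]
        _ = ∑ m, act (M.gInv m n) (∑ l, act (M.g l m) (Ψ (p * M.gInv k l))) := by
          rw [Finset.sum_comm]; simp only [map_sum]
        _ = _ := by simp [h1, apply_ite]

/-! ### Operators on `Σ ⊗ 𝕍^⊗` -/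

/-- `id ⊗ X` on `Σ ⊗ 𝕍^⊗`. -/
def onTens (Sg : Type*) [Ring Sg] [Algebra ℂ Sg] :
    Module.End ℂ (Tens d) →ₐ[ℂ] Module.End ℂ (Sg ⊗[ℂ] Tens d) :=
  Module.End.lTensorAlgHom ℂ (Tens d) Sg

@[simp] lemma onTens_tmul (X : Module.End ℂ (Tens d)) (q : Sg) (x : Tens d) :
    onTens Sg X (q ⊗ₜ x) = q ⊗ₜ X x := rfl

/-- `f ⊗ id` on `Σ ⊗ 𝕍^⊗`. -/
def onCoef (d : ℕ) (Sg : Type*) [Ring Sg] [Algebra ℂ Sg] :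
    Module.End ℂ Sg →ₐ[ℂ] Module.End ℂ (Sg ⊗[ℂ] Tens d) :=
  Module.End.rTensorAlgHom ℂ Sg (Tens d)

@[simp] lemma onCoef_tmul (f : Module.End ℂ Sg) (q : Sg) (x : Tens d) :
    onCoef d Sg f (q ⊗ₜ x) = f q ⊗ₜ x := rfl

lemma onCoef_comm (f : Module.End ℂ Sg) (X : Module.End ℂ (Tens d)) :
    onTens Sg X * onCoef d Sg f = onCoef d Sg f * onTens Sg X :=
  TensorProduct.ext' fun _ _ => rfl

/-- Left multiplication by `q ∈ Σ`. -/
def lam (d : ℕ) (q : Sg) : Module.End ℂ (Sg ⊗[ℂ] Tens d) := onCoef d Sg (LinearMap.mulLeft ℂ q)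

@[simp] lemma lam_tmul (q p : Sg) (x : Tens d) : lam d q (p ⊗ₜ x) = (q * p) ⊗ₜ x := rfl

lemma onTens_lam (q : Sg) (X : Module.End ℂ (Tens d)) :
    onTens Sg X * lam d q = lam d q * onTens Sg X := onCoef_comm _ _

lemma lam_mul (p q : Sg) : lam d (p * q) = lam d p * lam d q :=
  TensorProduct.ext' fun _ _ => by simp [mul_assoc]

lemma lam_add (p q : Sg) : lam d (p + q) = lam d p + lam d q :=
  TensorProduct.ext' fun _ _ => by simp [add_mul, TensorProduct.add_tmul]

lemma lam_sum {ι : Type*} (s : Finset ι) (f : ι → Sg) : lam d (∑ i ∈ s, f i) = ∑ i ∈ s, lam d (f i) :=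
  TensorProduct.ext' fun _ _ => by
    simp [Finset.sum_mul, TensorProduct.sum_tmul, LinearMap.sum_apply]

@[simp] lemma lam_one : lam d (1 : Sg) = 1 := TensorProduct.ext' fun _ _ => by simp

@[simp] lemma lam_zero : lam d (0 : Sg) = 0 := TensorProduct.ext' fun _ _ => by simp

lemma lam_smul (c : ℂ) (q : Sg) : lam d (c • q) = c • lam d q :=
  TensorProduct.ext' fun _ _ => by simp [TensorProduct.smul_tmul']

variable (M : BraidedMetric Q Sg)

/-- `q ⊗ t ↦ ν_Σ(q)_{ij} ⊗ t`. -/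
def nuOp (i j : Fin d) : Module.End ℂ (Sg ⊗[ℂ] Tens d) :=
  onCoef d Sg (Matrix.entryLinearMap ℂ Sg i j ∘ₗ M.nuS.toLinearMap)

@[simp] lemma nuOp_tmul (i j : Fin d) (q : Sg) (x : Tens d) :
    M.nuOp i j (q ⊗ₜ x) = M.nuS q i j ⊗ₜ x := rfl

/-- Left multiplication by `θ_i`. -/
def lmulT (i : Fin d) : Module.End ℂ (Sg ⊗[ℂ] Tens d) :=
  ∑ j, M.nuOp i j * onTens Sg (gen j)

lemma lmulT_tmul (i : Fin d) (q : Sg) (x : Tens d) :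
    M.lmulT i (q ⊗ₜ x) = ∑ j, M.nuS q i j ⊗ₜ (FreeAlgebra.ι ℂ j * x) := by
  simp [lmulT, LinearMap.sum_apply]

lemma lmulT_one_tmul (i : Fin d) (x : Tens d) :
    M.lmulT i (1 ⊗ₜ x) = 1 ⊗ₜ (FreeAlgebra.ι ℂ i * x) := by
  rw [lmulT_tmul, map_one, Finset.sum_eq_single i]
  · simp
  · intro j _ hj; simp [Matrix.one_apply_ne' hj]
  · simp

lemma lmulT_lam (i : Fin d) (q : Sg) :
    M.lmulT i * lam d q = ∑ j, lam d (M.nuS q i j) * M.lmulT j := by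
  refine TensorProduct.ext' fun p x => ?_
  simp only [Module.End.mul_apply, lam_tmul, lmulT_tmul, LinearMap.sum_apply, map_mul,
    Matrix.mul_apply, map_sum, TensorProduct.sum_tmul]
  exact Finset.sum_comm

lemma onTens_lmulT (X : Module.End ℂ (Tens d)) (i : Fin d) :
    onTens Sg X * M.lmulT i = ∑ j, M.nuOp i j * onTens Sg (X * gen j) := by
  simp only [lmulT, Finset.mul_sum, map_mul]
  refine Finset.sum_congr rfl fun j _ => ?_
  rw [← mul_assoc, nuOp, onCoef_comm, mul_assoc]

lemma shiftOp_lmulT (X : Module.End ℂ (Tens d)) (i : Fin d) :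
    onTens Sg (shiftOp X) * M.lmulT i = M.lmulT i * onTens Sg X := by
  rw [onTens_lmulT, lmulT, Finset.sum_mul]
  simp only [shiftOp_mul_gen, map_mul, mul_assoc]

/-- The contraction `q ⊗ θ_a ⊗ θ_b ⊗ t ↦ q g_{ab} ⊗ t`. -/
def pairOp : Module.End ℂ (Sg ⊗[ℂ] Tens d) :=
  ∑ a, ∑ b, onCoef d Sg (LinearMap.mulRight ℂ (M.g a b)) * onTens Sg (stripLeft b * stripLeft a)

lemma pairOp_cons (q : Sg) (i j : Fin d) (x : Tens d) :
    M.pairOp (q ⊗ₜ (FreeAlgebra.ι ℂ i * (FreeAlgebra.ι ℂ j * x))) = (q * M.g i j) ⊗ₜ x := by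
  simp only [pairOp, LinearMap.sum_apply, Module.End.mul_apply, onTens_tmul, onCoef_tmul,
    stripLeft_cons, LinearMap.mulRight_apply]
  rw [Finset.sum_eq_single i]
  · rw [Finset.sum_eq_single j]
    · simp [stripLeft_cons]
    · intro b _ hb; simp [stripLeft_cons, Ne.symm hb]
    · simp
  · intro a _ ha; simp [Ne.symm ha]
  · simp

lemma pairOp_lam (q : Sg) : M.pairOp * lam d q = lam d q * M.pairOp := by
  refine TensorProduct.ext' fun p x => ?_
  simp [pairOp, LinearMap.sum_apply, mul_assoc]

lemma pairOp_short (w : List (Fin d)) (h : w.length < 2) (q : Sg) :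
    M.pairOp (q ⊗ₜ word w) = 0 := by
  match w, h with
  | [], _ => simp [pairOp]
  | [i], _ => simp [pairOp, word_cons, stripLeft_stripLeft_ι]

/-- Contracting the first two legs renumbers the later ones, so an operator that leaves those two
legs alone passes through, shifted down by two. -/
lemma pairOp_shift (X : Module.End ℂ (Tens d)) :
    M.pairOp * onTens Sg (shiftOp (shiftOp X)) = onTens Sg X * M.pairOp := by
  simp only [pairOp, Finset.mul_sum, Finset.sum_mul]
  refine Finset.sum_congr rfl fun a _ => Finset.sum_congr rfl fun b _ => ?_
  rw [mul_assoc, ← map_mul, mul_assoc (stripLeft b), stripLeft_mul_shiftOp, ← mul_assoc,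
    stripLeft_mul_shiftOp, mul_assoc, map_mul, ← mul_assoc, ← onCoef_comm, mul_assoc]

lemma contrT_tmul (i : Fin d) (q : Sg) (x : Tens d) : M.contrT i (q ⊗ₜ x) =
    ∑ j, ∑ k, (M.nuS q i j * M.g j k) ⊗ₜ stripLeft k x := by
  simp [contrT, LinearMap.sum_apply]

lemma pairOp_tmul (q : Sg) (x : Tens d) : M.pairOp (q ⊗ₜ x) =
    ∑ j, ∑ k, (q * M.g j k) ⊗ₜ stripLeft k (stripLeft j x) := by
  simp [pairOp, LinearMap.sum_apply]

lemma contrT_eq (i : Fin d) : M.contrT i = M.pairOp * M.lmulT i := by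
  refine TensorProduct.ext' fun q x => ?_
  rw [contrT_tmul, Module.End.mul_apply, lmulT_tmul, map_sum]
  refine Finset.sum_congr rfl fun j _ => ?_
  rw [pairOp_tmul]
  conv_rhs => rw [Finset.sum_eq_single j (fun a _ ha => by simp [stripLeft_cons, Ne.symm ha])
    (by simp)]
  simp [stripLeft_cons]

lemma contrT_shiftOp (X : Module.End ℂ (Tens d)) (i : Fin d) :
    M.contrT i * onTens Sg (shiftOp X) = onTens Sg X * M.contrT i := by
  rw [contrT_eq, mul_assoc, ← shiftOp_lmulT, ← mul_assoc, pairOp_shift, mul_assoc]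

lemma contrT_lam (i : Fin d) (q : Sg) :
    M.contrT i * lam d q = ∑ j, lam d (M.nuS q i j) * M.contrT j := by
  simp only [contrT_eq]
  rw [mul_assoc, lmulT_lam, Finset.mul_sum]
  simp only [← mul_assoc, pairOp_lam]

lemma contrT_tmul_one (i : Fin d) (q : Sg) : M.contrT i (q ⊗ₜ 1) = 0 := by
  simp [contrT, LinearMap.sum_apply]

/-- Two families of operators which move coefficients from `Σ` in the same way agree if they agree
on `1 ⊗ 𝕍^⊗`. -/
lemma op_ext {ι : Type*} [Fintype ι] {X Y : ι → Module.End ℂ (Sg ⊗[ℂ] Tens d)}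
    (c : Sg → ι → ι → Sg) (hX : ∀ i q, X i * lam d q = ∑ j, lam d (c q i j) * X j)
    (hY : ∀ i q, Y i * lam d q = ∑ j, lam d (c q i j) * Y j)
    (h : ∀ i w, X i (1 ⊗ₜ word w) = Y i (1 ⊗ₜ word w)) (i : ι) : X i = Y i := by
  have h' : ∀ i x, X i (1 ⊗ₜ x) = Y i (1 ⊗ₜ x) := fun i x =>
    LinearMap.congr_fun (tens_ext (f := X i ∘ₗ TensorProduct.mk ℂ Sg (Tens d) 1)
      (g := Y i ∘ₗ TensorProduct.mk ℂ Sg (Tens d) 1) (h i)) x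
  refine TensorProduct.ext' fun q x => ?_
  have e : q ⊗ₜ[ℂ] x = lam d q (1 ⊗ₜ x) := by simp
  rw [e, ← Module.End.mul_apply, ← Module.End.mul_apply, hX, hY]
  simp [LinearMap.sum_apply, h']

/-- The operator `σ` on the legs `n`, `n + 1`. -/
def sg (n : ℕ) : Module.End ℂ (Tens d) := legOp M.sigma n

/-- The operator `σ⁻¹` on the legs `n`, `n + 1`. -/
def sgInv (n : ℕ) : Module.End ℂ (Tens d) := legOp M.sigma⁻¹ n

lemma sg_mul_sgInv (n : ℕ) : M.sg n * M.sgInv n = legOp 1 n := by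
  rw [sg, sgInv, legOp_mul_legOp, Matrix.mul_nonsing_inv _ ((Matrix.isUnit_iff_isUnit_det _).1
    M.sigma_isUnit)]

lemma sgInv_mul_sg (n : ℕ) : M.sgInv n * M.sg n = legOp 1 n := by
  rw [sg, sgInv, legOp_mul_legOp, Matrix.nonsing_inv_mul _ ((Matrix.isUnit_iff_isUnit_det _).1
    M.sigma_isUnit)]

lemma sg_far (i j : ℕ) (h : i + 2 ≤ j) : M.sg i * M.sg j = M.sg j * M.sg i := legOp_far _ _ i j h

lemma sg_braid (n : ℕ) : M.sg n * M.sg (n + 1) * M.sg n = M.sg (n + 1) * M.sg n * M.sg (n + 1) :=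
  legOp_braid _ M.sigma_braid n

/-- The braid relation solved for inverses. As `sg` and `sgInv` are mutually inverse only up to
`legOp 1 _`, these projections are inserted and then absorbed by operators on the same or later
legs. -/
lemma sg_sgInv_sgInv : M.sg 1 * M.sgInv 0 * M.sgInv 1 = M.sgInv 0 * M.sgInv 1 * M.sg 0 := by
  have h0 : M.sgInv 0 * M.sgInv 1 * (M.sg 1 * M.sg 0) = legOp 1 1 := by
    rw [mul_assoc, ← mul_assoc (M.sgInv 1), sgInv_mul_sg, sg, legOp_one_comm, ← sg, ← mul_assoc,
      sgInv_mul_sg, legOp_one_mul _ (by omega)]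
  calc M.sg 1 * M.sgInv 0 * M.sgInv 1
      = legOp 1 1 * M.sg 1 * M.sgInv 0 * M.sgInv 1 := by rw [sg, legOp_one_mul _ le_rfl]
    _ = M.sgInv 0 * M.sgInv 1 * (M.sg 1 * M.sg 0 * M.sg 1) * M.sgInv 0 * M.sgInv 1 := by
        rw [← h0]; simp only [mul_assoc]
    _ = M.sgInv 0 * M.sgInv 1 * M.sg 0 * (M.sg 1 * (M.sg 0 * M.sgInv 0)) * M.sgInv 1 := by
        rw [← M.sg_braid 0]; simp only [mul_assoc]
    _ = M.sgInv 0 * M.sgInv 1 * (M.sg 0 * legOp 1 1) := by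
        have h : M.sg 1 * legOp 1 0 = M.sg 1 := legOp_mul_one _ (Nat.zero_le 1)
        rw [sg_mul_sgInv, h, mul_assoc _ (M.sg 1), sg_mul_sgInv, mul_assoc]
    _ = _ := by
        have h : M.sgInv 1 * legOp 1 1 = M.sgInv 1 := legOp_mul_one _ le_rfl
        have h2 : M.sg 0 * legOp 1 1 = legOp 1 1 * M.sg 0 := by
          rw [sg, legOp_one_comm]
        rw [h2, ← mul_assoc, mul_assoc _ (M.sgInv 1), h]

lemma legOp_one_lmulT (i j : Fin d) :
    onTens Sg (legOp 1 0) * (M.lmulT i * M.lmulT j) = M.lmulT i * M.lmulT j := by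
  have h : ∀ a b : Fin d, legOp 1 0 * (gen a * gen b) = gen a * gen b := fun a b => by
    rw [legOp_zero_mul_gen]
    simp [Matrix.one_apply]
  rw [← mul_assoc, onTens_lmulT, Finset.sum_mul]
  conv_rhs => rw [lmulT, Finset.sum_mul]
  refine Finset.sum_congr rfl fun a _ => ?_
  rw [mul_assoc, mul_assoc, onTens_lmulT, onTens_lmulT]
  simp only [mul_assoc, h]

/-- The defining relation of `ν_Σ` in operator form: to pass `g(x, y)`, the vector `θ_i` is braided
past `x` by `σ⁻¹` and past `y` by `σ`. Both sides move coefficients through `ν_Σ`, so words with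
coefficient `1` suffice, and there `nuS_g` applies. -/
lemma lmulT_pairOp (i : Fin d) :
    M.lmulT i * M.pairOp = M.pairOp * onTens Sg (M.sg 1 * M.sgInv 0) * M.lmulT i := by
  refine op_ext (X := fun i => M.lmulT i * M.pairOp)
    (Y := fun i => M.pairOp * onTens Sg (M.sg 1 * M.sgInv 0) * M.lmulT i)
    (fun q i j => M.nuS q i j) (fun i q => ?_) (fun i q => ?_) (fun i w => ?_) i
  · rw [mul_assoc, pairOp_lam, ← mul_assoc, lmulT_lam, Finset.sum_mul]
    simp only [mul_assoc]
  · rw [mul_assoc, lmulT_lam, Finset.mul_sum]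
    refine Finset.sum_congr rfl fun j _ => ?_
    rw [← mul_assoc, mul_assoc _ _ (lam d _), onTens_lam, ← mul_assoc, pairOp_lam]
    simp only [mul_assoc]
  · simp only [Module.End.mul_apply, lmulT_one_tmul, onTens_tmul]
    match w with
    | [] =>
      rw [pairOp_short _ _ (by simp), word_nil]
      have h : M.sg 1 (M.sgInv 0 (word [i])) = 0 := by
        rw [sgInv, legOp_short _ _ _ (by simp), map_zero]
      rw [word_cons, word_nil] at h
      rw [h]
      simp
    | [a] =>
      rw [pairOp_short _ _ (by simp)]
      -- `σ` on the legs `1, 2` absorbs `legOp 1 1`, which commutes with `σ⁻¹` on the first two legs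
      -- and kills words of length two.
      have h : M.sg 1 (M.sgInv 0 (word [i, a])) = 0 := by
        rw [← Module.End.mul_apply, sg, ← legOp_mul_one M.sigma (le_refl 1), mul_assoc, sgInv,
          legOp_one_comm, ← mul_assoc, Module.End.mul_apply, legOp_short _ 1 _ (by simp), map_zero]
      rw [word_cons] at h
      rw [h]
      simp
    | a :: b :: u =>
      rw [word_cons, word_cons, pairOp_cons, one_mul, lmulT_tmul, sgInv, legOp_zero_cons]
      have h : ∀ p : Fin d × Fin d, M.sg 1 (FreeAlgebra.ι ℂ p.1 *
            (FreeAlgebra.ι ℂ p.2 * (FreeAlgebra.ι ℂ b * word u))) = ∑ r : Fin d × Fin d,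
            M.sigma r (p.2, b) • (FreeAlgebra.ι ℂ p.1 * (FreeAlgebra.ι ℂ r.1 *
              (FreeAlgebra.ι ℂ r.2 * word u))) := fun p => by
        rw [sg, legOp, shiftOp_cons, legOp_zero_cons, Finset.mul_sum]
        simp only [mul_smul_comm]
      simp only [map_sum, map_smul, h, TensorProduct.tmul_sum, TensorProduct.tmul_smul,
        pairOp_cons, one_mul]
      simp only [M.nuS_g, TensorProduct.sum_tmul, TensorProduct.smul_tmul',
        Finset.smul_sum, smul_smul, Fintype.sum_prod_type]
      rw [Finset.sum_comm]
      refine Finset.sum_congr rfl fun x _ => ?_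
      rw [Finset.sum_comm]
      refine Finset.sum_congr rfl fun y _ => ?_
      rw [Finset.sum_comm]

lemma lmulT_lmulT_pairOp (i j : Fin d) : M.lmulT i * M.lmulT j * M.pairOp =
    M.pairOp * onTens Sg (M.sg 1 * M.sg 2 * M.sgInv 0 * M.sgInv 1) * (M.lmulT i * M.lmulT j) := by
  have h : M.lmulT i * onTens Sg (M.sg 1 * M.sgInv 0) =
      onTens Sg (M.sg 2 * M.sgInv 1) * M.lmulT i := by
    rw [← shiftOp_lmulT, shiftOp_mul]; rfl
  have h2 : M.sg 1 * M.sgInv 0 * (M.sg 2 * M.sgInv 1) =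
      M.sg 1 * M.sg 2 * M.sgInv 0 * M.sgInv 1 := by
    have := legOp_far M.sigma⁻¹ M.sigma 0 2 le_rfl
    simp only [mul_assoc]
    congr 1
    rw [← mul_assoc, sgInv, sg, this]
    simp only [mul_assoc]
  rw [mul_assoc, lmulT_pairOp, ← mul_assoc, ← mul_assoc, lmulT_pairOp, mul_assoc _ (M.lmulT i), h,
    ← mul_assoc, mul_assoc M.pairOp, ← map_mul, h2, mul_assoc]

/-- The axiom for `g ⊗ g` on the first four legs: braiding one contracted pair past the other
changes nothing. -/
lemma pairOp_pairOp : M.pairOp * M.pairOp =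
    M.pairOp * M.pairOp * onTens Sg (M.sg 1 * M.sg 2 * M.sgInv 0 * M.sgInv 1) := by
  refine op_ext (ι := Unit) (X := fun _ => M.pairOp * M.pairOp) (Y := fun _ =>
    M.pairOp * M.pairOp * onTens Sg (M.sg 1 * M.sg 2 * M.sgInv 0 * M.sgInv 1))
    (fun q _ _ => q) (fun _ q => ?_) (fun _ q => ?_) (fun _ w => ?_) ()
  · simp only [Finset.univ_unique, Finset.sum_singleton]
    rw [mul_assoc, pairOp_lam, ← mul_assoc, pairOp_lam, mul_assoc]
  · simp only [Finset.univ_unique, Finset.sum_singleton]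
    rw [mul_assoc, onTens_lam, ← mul_assoc, mul_assoc M.pairOp, pairOp_lam, ← mul_assoc, pairOp_lam]
    simp only [mul_assoc]
  · simp only [Module.End.mul_apply, onTens_tmul]
    -- Two contractions need four legs and leg operators preserve the degree, so both sides vanish
    -- on shorter words.
    have short : ∀ n < 4, ∀ x ∈ homTens d n, ∀ q : Sg, M.pairOp (M.pairOp (q ⊗ₜ x)) = 0 := by
      intro n hn x hx q
      refine homTens_ext (f := M.pairOp ∘ₗ M.pairOp ∘ₗ TensorProduct.mk ℂ Sg (Tens d) q) (g := 0)
        (fun w hw => ?_) hx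
      simp only [LinearMap.comp_apply, TensorProduct.mk_apply, LinearMap.zero_apply]
      match w, hw with
      | [], _ => rw [pairOp_short _ _ (by simp), map_zero]
      | [a], _ => rw [pairOp_short _ _ (by simp), map_zero]
      | a :: b :: u, hu =>
        rw [word_cons, word_cons, pairOp_cons, pairOp_short]
        simp at hu
        omega
    rcases Nat.lt_or_ge w.length 4 with hw | hw
    · rw [short _ hw _ (word_mem_homTens w), short _ hw]
      exact legOp_mem_homTens _ _ _ _ (legOp_mem_homTens _ _ _ _ (legOp_mem_homTens _ _ _ _
        (legOp_mem_homTens _ _ _ _ (word_mem_homTens w))))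
    · match w, hw with
      | i :: j :: k :: l :: u, _ =>
        simp only [word_cons, pairOp_cons, one_mul]
        have s1 : ∀ (m : Matrix (Fin d × Fin d) (Fin d × Fin d) ℂ) (i j k : Fin d) (x : Tens d),
            legOp m 1 (FreeAlgebra.ι ℂ i * (FreeAlgebra.ι ℂ j * (FreeAlgebra.ι ℂ k * x))) =
              ∑ p : Fin d × Fin d, m p (j, k) • (FreeAlgebra.ι ℂ i * (FreeAlgebra.ι ℂ p.1 *
                (FreeAlgebra.ι ℂ p.2 * x))) := fun m i j k x => by
          rw [legOp, shiftOp_cons, legOp_zero_cons, Finset.mul_sum]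
          simp only [mul_smul_comm]
        have s2 : ∀ (m : Matrix (Fin d × Fin d) (Fin d × Fin d) ℂ) (i j k l : Fin d) (x : Tens d),
            legOp m 2 (FreeAlgebra.ι ℂ i * (FreeAlgebra.ι ℂ j * (FreeAlgebra.ι ℂ k *
              (FreeAlgebra.ι ℂ l * x)))) = ∑ p : Fin d × Fin d, m p (k, l) • (FreeAlgebra.ι ℂ i *
                (FreeAlgebra.ι ℂ j * (FreeAlgebra.ι ℂ p.1 * (FreeAlgebra.ι ℂ p.2 * x)))) :=
            fun m i j k l x => by
          rw [legOp, shiftOp_cons, s1, Finset.mul_sum]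
          simp only [mul_smul_comm]
        simp only [sg, sgInv, s1, s2, legOp_zero_cons, map_sum, map_smul]
        simp only [TensorProduct.tmul_sum, TensorProduct.tmul_smul, map_sum, map_smul, pairOp_cons,
          one_mul]
        rw [M.g_funny]
        simp only [Fintype.sum_prod_type, TensorProduct.sum_tmul, TensorProduct.smul_tmul',
          Finset.smul_sum, smul_smul, mul_assoc]

/-! ### The braiding and the metric are compatible with the coefficients from `Σ` -/

/-- The homomorphism `Σ → M_{d²}(Σ)` which moves coefficients through `𝕍 ⊗ 𝕍`. -/
def nuPair : Sg →+* Matrix (Fin d × Fin d) (Fin d × Fin d) Sg where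
  toFun q := Matrix.of fun p r => M.nuS (M.nuS q p.2 r.2) p.1 r.1
  map_one' := by
    ext p r
    obtain ⟨a, b⟩ := p
    obtain ⟨c, e⟩ := r
    by_cases h1 : b = e
    · by_cases h2 : a = c
      · subst h1 h2
        simp
      · subst h1
        have : (a, b) ≠ (c, b) := fun h => h2 (Prod.mk.inj h).1
        simp [Matrix.one_apply_ne this, h2]
    · have : (a, b) ≠ (c, e) := fun h => h1 (Prod.mk.inj h).2
      simp [Matrix.one_apply_ne this, h1]
  map_zero' := by ext; simp
  map_add' p q := by ext; simp
  map_mul' p q := by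
    ext a b
    simp [Matrix.mul_apply, Matrix.sum_apply, Fintype.sum_prod_type_right]

lemma nuPair_apply (q : Sg) (i j k l : Fin d) :
    M.nuPair q (i, j) (k, l) = M.nuS (M.nuS q j l) i k := rfl

lemma lmulT_lmulT_tmul (i j : Fin d) (q : Sg) (x : Tens d) :
    M.lmulT i (M.lmulT j (q ⊗ₜ x)) = ∑ p : Fin d × Fin d,
      M.nuPair q (i, j) p ⊗ₜ (FreeAlgebra.ι ℂ p.1 * (FreeAlgebra.ι ℂ p.2 * x)) := by
  rw [lmulT_tmul, map_sum, Fintype.sum_prod_type_right]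
  simp only [lmulT_tmul, nuPair_apply]

/-- The coefficient of `θ_a ⊗ θ_b`. -/
def coeffPair (Sg : Type*) [Ring Sg] [Algebra ℂ Sg] (p : Fin d × Fin d) :
    Sg ⊗[ℂ] Tens d →ₗ[ℂ] Sg :=
  (TensorProduct.rid ℂ Sg).toLinearMap ∘ₗ (wordCoeff [p.1, p.2]).lTensor Sg

lemma coeffPair_tmul (p : Fin d × Fin d) (q : Sg) (r : Fin d × Fin d) :
    coeffPair Sg p (q ⊗ₜ (FreeAlgebra.ι ℂ r.1 * FreeAlgebra.ι ℂ r.2)) = if r = p then q else 0 := by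
  have h : wordCoeff [p.1, p.2] (FreeAlgebra.ι ℂ r.1 * FreeAlgebra.ι ℂ r.2) =
      if r = p then 1 else 0 := by
    have : FreeAlgebra.ι ℂ r.1 * FreeAlgebra.ι ℂ r.2 = word [r.1, r.2] := by simp [word_cons]
    rw [this, wordCoeff, onWords_word]
    simp [Prod.ext_iff]
  simp only [coeffPair, LinearMap.comp_apply, LinearMap.lTensor_tmul, h]
  split_ifs <;> simp

lemma sum_coeffPair {f h : Fin d × Fin d → Sg}
    (e : ∑ r : Fin d × Fin d, f r ⊗ₜ[ℂ] (FreeAlgebra.ι ℂ r.1 * FreeAlgebra.ι ℂ r.2) =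
      ∑ r : Fin d × Fin d, h r ⊗ₜ[ℂ] (FreeAlgebra.ι ℂ r.1 * FreeAlgebra.ι ℂ r.2)) (p : Fin d × Fin d) :
    f p = h p := by
  have := congrArg (coeffPair Sg p) e
  simpa [map_sum, coeffPair_tmul] using this

lemma sg_zero_cons (a b : Fin d) (x : Tens d) :
    M.sg 0 (FreeAlgebra.ι ℂ a * (FreeAlgebra.ι ℂ b * x)) =
      ∑ p : Fin d × Fin d, M.sigma p (a, b) • (FreeAlgebra.ι ℂ p.1 * (FreeAlgebra.ι ℂ p.2 * x)) :=
  legOp_zero_cons _ _ _ _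

lemma g_tmul_one (k l : Fin d) : M.g k l ⊗ₜ[ℂ] (1 : Tens d) =
    M.pairOp (1 ⊗ₜ (FreeAlgebra.ι ℂ k * (FreeAlgebra.ι ℂ l * 1))) := by
  rw [pairOp_cons, one_mul]

/-- Moving `θ_i ⊗ θ_j` through `g_{kl}` is the crossing of two pairs of legs followed by a
contraction, and `σ` passes through such a crossing by the braid equation. This is the generator
case of `sigma_nuPair`. -/
lemma sigma_nuPair_g (k l : Fin d) :
    M.nuPair (M.g k l) * M.sigmaᵀ.map (algebraMap ℂ Sg) =
      M.sigmaᵀ.map (algebraMap ℂ Sg) * M.nuPair (M.g k l) := by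
  -- The crossing of the pairs `(0, 1)` and `(2, 3)` intertwines `σ` on the first pair with `σ` on
  -- the second.
  have key : M.sg 2 * (M.sg 1 * M.sg 2 * M.sgInv 0 * M.sgInv 1) =
      M.sg 1 * M.sg 2 * M.sgInv 0 * M.sgInv 1 * M.sg 0 := by
    calc _ = (M.sg 2 * M.sg 1 * M.sg 2) * M.sgInv 0 * M.sgInv 1 := by simp only [mul_assoc]
      _ = M.sg 1 * M.sg 2 * (M.sg 1 * M.sgInv 0 * M.sgInv 1) := by
        rw [← M.sg_braid 1]; simp only [mul_assoc]
      _ = _ := by rw [sg_sgInv_sgInv]; simp only [mul_assoc]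
  ext ⟨i, j⟩ p
  have e1 : onTens Sg (M.sg 0) (M.lmulT i (M.lmulT j (M.g k l ⊗ₜ 1))) =
      ∑ r : Fin d × Fin d, M.sigma r (i, j) • M.lmulT r.1 (M.lmulT r.2 (M.g k l ⊗ₜ 1)) := by
    have h2 : ∀ i j, M.lmulT i (M.lmulT j (M.g k l ⊗ₜ 1)) =
        M.pairOp (1 ⊗ₜ ((M.sg 1 * M.sg 2 * M.sgInv 0 * M.sgInv 1) (FreeAlgebra.ι ℂ i *
          (FreeAlgebra.ι ℂ j * (FreeAlgebra.ι ℂ k * (FreeAlgebra.ι ℂ l * 1)))))) := by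
      intro i j
      have := LinearMap.congr_fun (M.lmulT_lmulT_pairOp i j)
        (1 ⊗ₜ (FreeAlgebra.ι ℂ k * (FreeAlgebra.ι ℂ l * 1)))
      rw [Module.End.mul_apply, Module.End.mul_apply, Module.End.mul_apply, Module.End.mul_apply,
        Module.End.mul_apply, lmulT_one_tmul, lmulT_one_tmul, ← g_tmul_one] at this
      exact this
    have h3 : M.sg 2 = shiftOp (shiftOp (M.sg 0)) := rfl
    simp only [h2]
    rw [← Module.End.mul_apply, ← pairOp_shift, ← h3, Module.End.mul_apply, onTens_tmul,
      ← Module.End.mul_apply (M.sg 2), key, Module.End.mul_apply _ (M.sg 0), sg_zero_cons]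
    simp only [map_sum, map_smul, TensorProduct.tmul_sum, TensorProduct.tmul_smul]
  have e2 := sum_coeffPair (Sg := Sg)
    (f := fun p => ∑ r : Fin d × Fin d, M.sigma p r • M.nuPair (M.g k l) (i, j) r)
    (h := fun p => ∑ r : Fin d × Fin d, M.sigma r (i, j) • M.nuPair (M.g k l) r p) (by
      simp only [lmulT_lmulT_tmul, map_sum, onTens_tmul, sg_zero_cons,
        TensorProduct.tmul_sum, TensorProduct.tmul_smul, TensorProduct.smul_tmul'] at e1
      simp only [mul_one] at e1
      simp only [TensorProduct.sum_tmul, ← TensorProduct.smul_tmul']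
      rw [Finset.sum_comm, Finset.sum_comm (γ := Fin d × Fin d)]
      rw [Finset.sum_comm]
      simp only [TensorProduct.smul_tmul']
      rw [e1]
      simp only [Finset.smul_sum, TensorProduct.smul_tmul']
      exact Finset.sum_comm) p
  simp only [Matrix.mul_apply, Matrix.map_apply, Matrix.transpose_apply]
  simp only [Algebra.smul_def] at e2
  rw [← e2]
  exact Finset.sum_congr rfl fun r _ => (Algebra.commutes _ _).symm

lemma nuPair_algebraMap (c : ℂ) : M.nuPair (algebraMap ℂ Sg c) =
    algebraMap ℂ (Matrix (Fin d × Fin d) (Fin d × Fin d) Sg) c := by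
  ext ⟨i, j⟩ ⟨k, l⟩
  rw [nuPair_apply, AlgHom.commutes, Matrix.algebraMap_matrix_apply]
  by_cases h1 : j = l
  · subst h1
    rw [if_pos rfl, AlgHom.commutes, Matrix.algebraMap_matrix_apply, Matrix.algebraMap_matrix_apply]
    simp
  · rw [if_neg h1, map_zero, Matrix.algebraMap_matrix_apply]
    simp [h1]

/-- `σ` extends `Σ`-bilinearly. -/
lemma sigma_nuPair (q : Sg) : M.nuPair q * M.sigmaᵀ.map (algebraMap ℂ Sg) =
    M.sigmaᵀ.map (algebraMap ℂ Sg) * M.nuPair q := by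
  set S := M.sigmaᵀ.map (algebraMap ℂ Sg) with hS
  have h := M.gen_induction (W := Matrix (Fin d × Fin d) (Fin d × Fin d) Sg)
    ((AddMonoidHom.mulRight S).comp M.nuPair.toAddMonoidHom)
    (fun q => AddMonoidHom.mulRight (M.nuPair q)) (fun p q w => by simp [mul_add])
    (fun w => by simp) (fun p q w => by simp [mul_assoc])
    (fun c p => by
      simp only [AddMonoidHom.comp_apply, AddMonoidHom.mulRight_apply, RingHom.toAddMonoidHom_eq_coe,
        AddMonoidHom.coe_coe, map_mul, nuPair_algebraMap]
      rw [mul_assoc, mul_assoc, Algebra.commutes])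
    (fun i j p => by
      simp only [AddMonoidHom.comp_apply, AddMonoidHom.mulRight_apply, RingHom.toAddMonoidHom_eq_coe,
        AddMonoidHom.coe_coe, map_mul]
      rw [mul_assoc, mul_assoc, hS, sigma_nuPair_g]) q 1
  simpa using h

/-- Since `σ` is `Σ`-bilinear, acting with it after `θ_i` and `θ_j` have crossed the coefficient is
the same as multiplying by `σ(θ_i ⊗ θ_j)`. -/
lemma sg_lmulT_lmulT (i j : Fin d) : onTens Sg (M.sg 0) * (M.lmulT i * M.lmulT j) =
    ∑ p : Fin d × Fin d, M.sigma p (i, j) • (M.lmulT p.1 * M.lmulT p.2) := by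
  refine TensorProduct.ext' fun q x => ?_
  simp only [Module.End.mul_apply, LinearMap.sum_apply, LinearMap.smul_apply, lmulT_lmulT_tmul,
    map_sum, onTens_tmul, sg_zero_cons, TensorProduct.tmul_sum, TensorProduct.tmul_smul,
    Finset.smul_sum]
  rw [Finset.sum_comm]
  conv_rhs => rw [Finset.sum_comm]
  refine Finset.sum_congr rfl fun p _ => ?_
  have h := congrFun (congrFun (M.sigma_nuPair q) (i, j)) p
  simp only [Matrix.mul_apply, Matrix.map_apply, Matrix.transpose_apply] at h
  simp only [TensorProduct.smul_tmul', ← TensorProduct.sum_tmul, Algebra.smul_def]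
  rw [← h]
  congr 1
  exact Finset.sum_congr rfl fun r _ => (Algebra.commutes _ _)

/-- The metric is left `Σ`-linear. -/
lemma contrT_lmulT (i j : Fin d) : M.contrT i * M.lmulT j = lam d (M.g i j) := by
  have e : ∀ (q : Sg) (x : Tens d), M.contrT i (M.lmulT j (q ⊗ₜ x)) =
      (∑ p : Fin d × Fin d, M.nuPair q (i, j) p * M.g p.1 p.2) ⊗ₜ x := by
    intro q x
    rw [contrT_eq, Module.End.mul_apply, lmulT_lmulT_tmul, map_sum]
    simp only [pairOp_cons, TensorProduct.sum_tmul]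
  -- On a coefficient `g_{kl}`, passing `θ_i ⊗ θ_j` through it is the crossing of two pairs, and the
  -- double contraction is invariant under this crossing by `pairOp_pairOp`.
  have hgen : ∀ (i j k l : Fin d), ∑ p : Fin d × Fin d, M.nuPair (M.g k l) (i, j) p * M.g p.1 p.2 =
      M.g i j * M.g k l := by
    intro i j k l
    have h1 := LinearMap.congr_fun (M.lmulT_lmulT_pairOp i j)
      (1 ⊗ₜ (FreeAlgebra.ι ℂ k * (FreeAlgebra.ι ℂ l * 1)))
    have h2 := (congrArg M.pairOp h1).trans (LinearMap.congr_fun M.pairOp_pairOp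
      ((M.lmulT i * M.lmulT j) (1 ⊗ₜ (FreeAlgebra.ι ℂ k * (FreeAlgebra.ι ℂ l * 1))))).symm
    simp only [Module.End.mul_apply] at h2
    rw [← g_tmul_one, lmulT_one_tmul, lmulT_one_tmul, lmulT_lmulT_tmul, map_sum] at h2
    simp only [pairOp_cons, one_mul, ← TensorProduct.sum_tmul] at h2
    have h3 := congrArg degZero h2
    simpa [degZero] using h3
  have h := fun q => congrFun (M.gen_induction (W := Fin d × Fin d → Sg)
    (⟨⟨fun q r => ∑ p : Fin d × Fin d, M.nuPair q r p * M.g p.1 p.2, by ext; simp⟩,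
      fun p q => by ext; simp [add_mul, Finset.sum_add_distrib]⟩)
    (fun q => ⟨⟨fun w r => w r * q, by ext; simp⟩, fun w w' => by ext; simp [add_mul]⟩)
    (fun p q w => by ext; simp [mul_add]) (fun w => by ext; simp)
    (fun p q w => by ext; simp [mul_assoc])
    (fun c p => by
      ext r
      simp only [AddMonoidHom.coe_mk, ZeroHom.coe_mk, map_mul, nuPair_algebraMap]
      rw [← Algebra.commutes, ← Algebra.commutes, ← Algebra.smul_def, ← Algebra.smul_def,
        Finset.smul_sum]
      simp only [Matrix.smul_apply, smul_mul_assoc])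
    (fun k l p => by
      ext r
      simp only [AddMonoidHom.coe_mk, ZeroHom.coe_mk, map_mul, Matrix.mul_apply, Finset.sum_mul]
      rw [Finset.sum_comm]
      refine Finset.sum_congr rfl fun a _ => ?_
      simp only [mul_assoc, ← Finset.mul_sum]
      rw [← hgen a.1 a.2 k l]) q 1) (i, j)
  refine TensorProduct.ext' fun q x => ?_
  rw [Module.End.mul_apply, e, lam_tmul]
  have h4 := h q
  simp only [AddMonoidHom.coe_mk, ZeroHom.coe_mk, one_mul, map_one, Matrix.one_apply, ite_mul,
    zero_mul, Finset.sum_ite_eq, Finset.mem_univ, if_true] at h4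
  rw [h4]

/-- The two-leg case of the symmetry of `σ` for the pairing. Braiding the contracting vectors leaves
`σ` on the legs `1, 2` of a double contraction; invariance under the crossing of pairs trades it for
`σ` on the argument. -/
lemma sg_contrT_contrT (i j : Fin d) :
    ∑ p : Fin d × Fin d, M.sigma p (i, j) • (M.contrT p.1 * M.contrT p.2) =
      M.contrT i * M.contrT j * onTens Sg (M.sg 0) := by
  have h1 : ∀ a b, M.contrT a * M.contrT b =
      M.pairOp * M.pairOp * onTens Sg (M.sg 1 * M.sgInv 0) * (M.lmulT a * M.lmulT b) := by
    intro a b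
    rw [contrT_eq, contrT_eq, mul_assoc, ← mul_assoc (M.lmulT a), lmulT_pairOp]
    simp only [mul_assoc]
  have h2 : M.lmulT i * M.lmulT j * onTens Sg (M.sg 0) =
      onTens Sg (M.sg 2) * (M.lmulT i * M.lmulT j) := by
    rw [mul_assoc, ← shiftOp_lmulT, ← mul_assoc, ← shiftOp_lmulT, mul_assoc]
    rfl
  -- The crossing ends with `σ⁻¹` on the legs `1, 2`, which cancels the given `σ`; the remaining
  -- factors on the legs `0, 1` and `2, 3` commute.
  have h3 : M.pairOp * M.pairOp * onTens Sg (M.sg 1) =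
      M.pairOp * M.pairOp * onTens Sg (M.sg 1 * M.sgInv 0 * M.sg 2) := by
    rw [pairOp_pairOp, mul_assoc _ _ (onTens Sg (M.sg 1)), ← map_mul, mul_assoc _ (M.sgInv 1),
      sgInv_mul_sg]
    have h4 := legOp_far M.sigma⁻¹ M.sigma 0 2 le_rfl
    have h5 : M.sg 1 * M.sg 2 * M.sgInv 0 * legOp 1 1 = M.sg 1 * M.sgInv 0 * M.sg 2 := by
      rw [mul_assoc (M.sg 1), sg, sg, sgInv, ← h4, mul_assoc, mul_assoc,
        legOp_mul_one _ (by omega), mul_assoc]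
    rw [h5, ← pairOp_pairOp]
  simp only [h1, ← mul_smul_comm (_ : ℂ) (M.pairOp * _ * _), ← Finset.mul_sum]
  have h6 : onTens Sg (M.sg 1 * M.sgInv 0) * (onTens Sg (M.sg 0) * (M.lmulT i * M.lmulT j)) =
      onTens Sg (M.sg 1) * (M.lmulT i * M.lmulT j) := by
    rw [← mul_assoc, ← map_mul, mul_assoc (M.sg 1), sgInv_mul_sg, map_mul, mul_assoc,
      legOp_one_lmulT]
  rw [← sg_lmulT_lmulT, mul_assoc (M.pairOp * M.pairOp), h6, ← mul_assoc, h3,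
    mul_assoc _ (M.lmulT i * M.lmulT j), h2, map_mul]
  simp only [mul_assoc]

/-- This produces the cross term of the Clifford relation: a `σ` between a multiplication and a
contraction exchanges the two. -/
lemma contrT_sg_lmulT (i j : Fin d) : M.contrT i * onTens Sg (M.sg 0) * M.lmulT j =
    ∑ p : Fin d × Fin d, M.sigma p (i, j) • (M.lmulT p.1 * M.contrT p.2) := by
  have h : ∀ a b, M.lmulT a * M.contrT b =
      M.pairOp * onTens Sg (M.sg 1 * M.sgInv 0) * (M.lmulT a * M.lmulT b) := by
    intro a b
    rw [contrT_eq, ← mul_assoc, lmulT_pairOp, mul_assoc]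
  simp only [h, ← mul_smul_comm (_ : ℂ) (M.pairOp * _), ← Finset.mul_sum]
  have h6 : onTens Sg (M.sg 1 * M.sgInv 0) * (onTens Sg (M.sg 0) * (M.lmulT i * M.lmulT j)) =
      onTens Sg (M.sg 1) * (M.lmulT i * M.lmulT j) := by
    rw [← mul_assoc, ← map_mul, mul_assoc (M.sg 1), sgInv_mul_sg, map_mul, mul_assoc,
      legOp_one_lmulT]
  rw [← sg_lmulT_lmulT, mul_assoc M.pairOp, h6, contrT_eq, mul_assoc M.pairOp, ← shiftOp_lmulT]
  simp only [mul_assoc]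
  rfl

end BraidedMetric

end Extended

end QRiem

namespace QRiem

/-! ### The involution on tensors and its compatibility with `σ` and `A_σ` -/

section TensorStar

variable {A : Type*} [Ring A] [StarRing A] [HopfAlgebra ℂ A] [StarModule ℂ A] {d : ℕ}

lemma legOp_mul_left_hom (m : Matrix (Fin d × Fin d) (Fin d × Fin d) ℂ) (n k : ℕ) (x : Tens d) :
    ∀ u ∈ homTens d n, legOp m (n + k) (u * x) = u * legOp m k x := by
  intro u hu
  refine homTens_ext (f := legOp m (n + k) ∘ₗ LinearMap.mulRight ℂ x)
    (g := LinearMap.mulRight ℂ (legOp m k x)) (fun w hw => ?_) hu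
  simp only [LinearMap.comp_apply, LinearMap.mulRight_apply]
  rw [← hw, legOp_mul_left]

lemma exists_eq_append_pair (w : List (Fin d)) (k : ℕ) (h : k + 2 ≤ w.length) :
    ∃ u a b v, w = u ++ a :: b :: v ∧ u.length = k := by
  refine ⟨w.take k, w[k]'(by omega), w[k + 1]'(by omega), w.drop (k + 2), ?_, ?_⟩
  · rw [← List.drop_eq_getElem_cons, ← List.drop_eq_getElem_cons, List.take_append_drop]
  · rw [List.length_take]; omega

namespace CoordForms

variable (Q : CoordForms A d)

/-- `θ_i^*` in the tensor algebra. -/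
def tensStarGen (i : Fin d) : Tens d := ∑ j, Q.cHalf⁻¹ j i • FreeAlgebra.ι ℂ j

/-- The antimultiplicative involution of `𝕍^⊗`. -/
def tensStar : Tens d →ₗ⋆[ℂ] Tens d where
  toFun x := (conjLift (fun i => MulOpposite.op (Q.tensStarGen i)) x).unop
  map_add' x y := by simp
  map_smul' c x := by simp [conjLift_smul]

lemma tensStar_mul (x y : Tens d) : Q.tensStar (x * y) = Q.tensStar y * Q.tensStar x := by
  simp [tensStar]

@[simp] lemma tensStar_one : Q.tensStar 1 = 1 := by simp [tensStar]

@[simp] lemma tensStar_ι (i : Fin d) : Q.tensStar (FreeAlgebra.ι ℂ i) = Q.tensStarGen i := by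
  simp [tensStar, conjLift_gen]

lemma tensStar_tensStarGen (i : Fin d) : Q.tensStar (Q.tensStarGen i) = FreeAlgebra.ι ℂ i := by
  have h : ∀ k, ∑ j, conj (Q.cHalf i j) * Q.cHalf j k = if i = k then 1 else 0 := fun k => by
    have := congrFun (congrFun Q.cHalf_conj i) k
    rw [Matrix.mul_apply, Matrix.one_apply] at this
    exact this
  conv_lhs => rw [tensStarGen]
  simp only [map_sum, LinearMap.map_smulₛₗ, tensStar_ι, tensStarGen, Finset.smul_sum, smul_smul,
    cHalf_inv]
  rw [Finset.sum_comm]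
  simp only [← Finset.sum_smul, h]
  simp

lemma tensStar_tensStar (x : Tens d) : Q.tensStar (Q.tensStar x) = x := by
  have h : Q.tensStar.comp Q.tensStar = LinearMap.id := by
    refine tens_ext fun w => ?_
    induction w with
    | nil => simp
    | cons i w ih =>
      simp only [LinearMap.comp_apply, LinearMap.id_apply] at ih ⊢
      rw [word_cons, tensStar_mul, tensStar_mul, ih, tensStar_ι, tensStar_tensStarGen]
  exact LinearMap.congr_fun h x

lemma tensStarGen_mem (i : Fin d) : Q.tensStarGen i ∈ homTens d 1 :=
  Submodule.sum_mem _ fun j _ => Submodule.smul_mem _ _ (ι_mem_homTens j)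

lemma tensStar_word_mem (w : List (Fin d)) : Q.tensStar (word w) ∈ homTens d w.length := by
  induction w with
  | nil => simpa using word_mem_homTens ([] : List (Fin d))
  | cons i w ih =>
    rw [word_cons, tensStar_mul, tensStar_ι]
    exact mul_mem_homTens ih (Q.tensStarGen_mem i)

lemma tensStar_mem {n : ℕ} : ∀ x ∈ homTens d n, Q.tensStar x ∈ homTens d n := by
  have : homTens d n ≤ (homTens d n).comap Q.tensStar := homTens_le fun w hw => by
    rw [Submodule.mem_comap, ← hw]
    exact Q.tensStar_word_mem w
  exact fun x hx => this hx

lemma starHom_proj (x : Tens d) : Q.starExt (Q.proj x) = Q.proj (Q.tensStar x) := by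
  have e : ∀ y, Q.starExt (Q.proj y) =
      (conjLift (fun i => MulOpposite.op (Q.thetaStar i)) y).unop := by
    intro y
    change (Q.starHom (RingQuot.mkAlgHom ℂ Q.extRel y)).unop = _
    rw [← RingHom.coe_coe (RingQuot.mkAlgHom ℂ Q.extRel), RingQuot.mkAlgHom_coe, starHom,
      RingQuot.lift_mkRingHom_apply]
  have h : Q.starExt.comp Q.proj.toLinearMap = Q.proj.toLinearMap.comp Q.tensStar := by
    refine tens_ext fun w => ?_
    simp only [LinearMap.comp_apply, AlgHom.toLinearMap_apply]
    induction w with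
    | nil => rw [e]; simp
    | cons i w ih =>
      rw [e] at ih ⊢
      rw [word_cons, map_mul, MulOpposite.unop_mul, ih, conjLift_gen, tensStar_mul, map_mul,
        tensStar_ι]
      simp [tensStarGen, thetaStar, theta]
  exact LinearMap.congr_fun h x

end CoordForms

variable {Q : CoordForms A d} {Sg : Type*} [Ring Sg] [StarRing Sg] [Algebra ℂ Sg]
  [StarModule ℂ Sg]

namespace BraidedMetric

variable (M : BraidedMetric Q Sg)

lemma sg_mem (k n : ℕ) : ∀ x ∈ homTens d n, M.sg k x ∈ homTens d n := legOp_mem_homTens _ k n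

lemma sg_mul_right {n N : ℕ} (h : n + 2 ≤ N) (x y : Tens d) (hx : x ∈ homTens d N) :
    M.sg n (x * y) = M.sg n x * y := legOp_mul_right M.sigma n N h y x hx

lemma sg_mul_left (n : ℕ) (x y : Tens d) (hx : x ∈ homTens d n) :
    M.sg n (x * y) = x * M.sg 0 y := legOp_mul_left_hom M.sigma n 0 y x hx

lemma tensStar_sg_zero (a b : Fin d) :
    Q.tensStar (M.sg 0 (FreeAlgebra.ι ℂ a * (FreeAlgebra.ι ℂ b * 1))) =
      M.sg 0 (Q.tensStarGen b * Q.tensStarGen a) := by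
  have e : ∀ i j, Q.tensStarGen j * Q.tensStarGen i = ∑ k, ∑ l,
      (Q.cHalf⁻¹ k j * Q.cHalf⁻¹ l i) • (FreeAlgebra.ι ℂ k * (FreeAlgebra.ι ℂ l * 1)) := by
    intro i j
    simp [CoordForms.tensStarGen, Finset.sum_mul_sum, smul_smul, mul_comm]
  rw [sg_zero_cons, map_sum]
  simp only [LinearMap.map_smulₛₗ, mul_one, CoordForms.tensStar_mul, CoordForms.tensStar_ι, e,
    map_sum, map_smul]
  have e2 : ∀ k l : Fin d, M.sg 0 (FreeAlgebra.ι ℂ k * FreeAlgebra.ι ℂ l) =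
      ∑ p : Fin d × Fin d, M.sigma p (k, l) • (FreeAlgebra.ι ℂ p.1 * FreeAlgebra.ι ℂ p.2) :=
    fun k l => by simpa using M.sg_zero_cons k l 1
  simp only [e2, Fintype.sum_prod_type]
  refine (CoordForms.sum4_swap (fun p q => conj (M.sigma (p, q) (a, b)))
    (fun p q k l => Q.cHalf⁻¹ k q * Q.cHalf⁻¹ l p)
    (fun k l => FreeAlgebra.ι ℂ k * FreeAlgebra.ι ℂ l)).trans (Eq.trans ?_
    (CoordForms.sum4_swap (fun p q => Q.cHalf⁻¹ p b * Q.cHalf⁻¹ q a)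
    (fun p q k l => M.sigma (k, l) (p, q))
    (fun k l => FreeAlgebra.ι ℂ k * FreeAlgebra.ι ℂ l)).symm)
  refine Finset.sum_congr rfl fun k _ => Finset.sum_congr rfl fun l _ => ?_
  rw [M.sigma_star]

lemma tensStar_sg_word (u v : List (Fin d)) (a b : Fin d) :
    Q.tensStar (M.sg u.length (word (u ++ a :: b :: v))) =
      M.sg v.length (Q.tensStar (word (u ++ a :: b :: v))) := by
  have e1 : word (u ++ a :: b :: v) =
      word u * ((FreeAlgebra.ι ℂ a * (FreeAlgebra.ι ℂ b * 1)) * word v) := by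
    simp [word_append, word_cons, mul_assoc]
  have h2 : ∃ N, 0 + 2 ≤ N ∧ FreeAlgebra.ι ℂ a * (FreeAlgebra.ι ℂ b * 1) ∈ homTens d N :=
    ⟨[a, b].length, le_rfl, word_mem_homTens [a, b]⟩
  have h3 : ∃ N, 0 + 2 ≤ N ∧ Q.tensStarGen b * Q.tensStarGen a ∈ homTens d N :=
    ⟨1 + 1, le_rfl, mul_mem_homTens (Q.tensStarGen_mem b) (Q.tensStarGen_mem a)⟩
  obtain ⟨N, hN, h2⟩ := h2
  obtain ⟨N', hN', h3⟩ := h3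
  have h5 : Q.tensStar (FreeAlgebra.ι ℂ a * (FreeAlgebra.ι ℂ b * 1)) =
      Q.tensStarGen b * Q.tensStarGen a := by
    simp [CoordForms.tensStar_mul]
  rw [e1, M.sg_mul_left _ _ _ (word_mem_homTens u), M.sg_mul_right hN _ _ h2, Q.tensStar_mul,
    Q.tensStar_mul, tensStar_sg_zero, Q.tensStar_mul, Q.tensStar_mul, h5, mul_assoc, mul_assoc,
    M.sg_mul_left _ _ _ (Q.tensStar_word_mem v), M.sg_mul_right hN' _ _ h3]

/-- The involution reverses the legs, so among the `n` neighbouring pairs of a tensor of degree `n +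
1` it exchanges the pair `k` with the pair `n - 1 - k`. On the pair itself this is `sigma_star`. -/
lemma tensStar_sg (n k : ℕ) (hk : k < n) (x : Tens d) (hx : x ∈ homTens d (n + 1)) :
    Q.tensStar (M.sg (n - 1 - k) x) = M.sg k (Q.tensStar x) := by
  have hle : homTens d (n + 1) ≤ LinearMap.eqLocus (Q.tensStar.comp (M.sg (n - 1 - k)))
      ((M.sg k).comp Q.tensStar) := homTens_le fun w hw => by
    obtain ⟨u, a, b, v, rfl, hu⟩ := exists_eq_append_pair w (n - 1 - k) (by omega)
    have hv : v.length = k := by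
      rw [List.length_append, List.length_cons, List.length_cons] at hw
      omega
    have := M.tensStar_sg_word u v a b
    rw [hu, hv] at this
    exact this
  exact hle hx

/-- Conjugation by `*` preserves products of operators and reverses the numbering of the generators.
The antisymmetrizer with reversed numbering is again `A_σ`, by its factorization from the other end.
-/
lemma tensStar_antisym (x : Tens d) :
    Q.tensStar (antisym M.sigma x) = antisym M.sigma (Q.tensStar x) := by
  have h : Q.tensStar.comp (antisym M.sigma) = (antisym M.sigma).comp Q.tensStar := by
    refine tens_ext fun w => ?_
    simp only [LinearMap.comp_apply]
    rcases hw : w.length with _ | n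
    · rw [List.length_eq_zero_iff.1 hw]
      simp [antisym_one]
    · have hx : word w ∈ homTens d (n + 1) := word_mem_homTens' hw
      rw [antisym_eq_antisymUp _ n _ hx, antisym_eq_antisymUp _ n _ (Q.tensStar_mem _ hx)]
      -- The relation records preservation of the degree `n + 1` as well, since the exchange rule
      -- for the generators holds in this degree only and must remain applicable inside products.
      have key := antisymUp_flip (s := M.sg) (t := M.sg) M.sg_far M.sg_braid
        (fun a b => ∀ x ∈ homTens d (n + 1), a x ∈ homTens d (n + 1) ∧
          Q.tensStar (a x) = b (Q.tensStar x))
        (fun x hx => ⟨hx, rfl⟩)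
        (fun a b a' b' h h' x hx => ⟨Submodule.sub_mem _ (h x hx).1 (h' x hx).1, by
          rw [LinearMap.sub_apply, LinearMap.sub_apply, map_sub, (h x hx).2, (h' x hx).2]⟩)
        (fun a b a' b' h h' x hx => ⟨(h _ (h' x hx).1).1, by
          rw [Module.End.mul_apply, Module.End.mul_apply, (h _ (h' x hx).1).2, (h' x hx).2]⟩)
        n (fun k hk x hx => ⟨M.sg_mem _ _ x hx, M.tensStar_sg n k hk x hx⟩)
      exact (key _ hx).2
  exact LinearMap.congr_fun h x

/-! ### The bimodule structure and the involution of `Σ ⊗ 𝕍^⊗` -/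

/-- Left multiplication by tensors. -/
def lmulTens : Tens d →ₐ[ℂ] Module.End ℂ (Sg ⊗[ℂ] Tens d) := FreeAlgebra.lift ℂ M.lmulT

@[simp] lemma lmulTens_ι (i : Fin d) : M.lmulTens (FreeAlgebra.ι ℂ i) = M.lmulT i := by
  simp [lmulTens]

lemma lmulT_mulRight (i : Fin d) (y : Tens d) :
    M.lmulT i * onTens Sg (LinearMap.mulRight ℂ y) =
      onTens Sg (LinearMap.mulRight ℂ y) * M.lmulT i := by
  refine TensorProduct.ext' fun q x => ?_
  simp [lmulT_tmul, mul_assoc]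

lemma lmulTens_mulRight (x y : Tens d) :
    M.lmulTens x * onTens Sg (LinearMap.mulRight ℂ y) =
      onTens Sg (LinearMap.mulRight ℂ y) * M.lmulTens x := by
  induction x using FreeAlgebra.induction with
  | grade0 c => rw [AlgHom.commutes, Algebra.commutes]
  | grade1 i => rw [lmulTens_ι, lmulT_mulRight]
  | mul a b ha hb => rw [map_mul, mul_assoc, hb, ← mul_assoc, ha, mul_assoc]
  | add a b ha hb => rw [map_add, add_mul, ha, hb, mul_add]

lemma lmulTens_one_tmul (x y : Tens d) : M.lmulTens x ((1 : Sg) ⊗ₜ y) = 1 ⊗ₜ (x * y) := by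
  have h : LinearMap.applyₗ (R := ℂ) (M := Sg ⊗[ℂ] Tens d) (M₂ := Sg ⊗[ℂ] Tens d) ((1 : Sg) ⊗ₜ[ℂ] y) ∘ₗ M.lmulTens.toLinearMap =
      TensorProduct.mk ℂ Sg (Tens d) 1 ∘ₗ LinearMap.mulRight ℂ y := by
    refine tens_ext fun w => ?_
    simp only [LinearMap.comp_apply, LinearMap.applyₗ_apply_apply, TensorProduct.mk_apply,
      AlgHom.toLinearMap_apply, LinearMap.mulRight_apply]
    induction w with
    | nil => simp
    | cons i w ih =>
      rw [word_cons, map_mul, Module.End.mul_apply, ih, lmulTens_ι, lmulT_one_tmul, mul_assoc]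
  exact LinearMap.congr_fun h x

/-- As `M.lmulTens x (q ⊗ₜ 1)` is the product `x q`, this is right `Σ`-linearity of `σ`. -/
lemma sg_lmulTens (k : ℕ) (q : Sg) (x : Tens d) :
    onTens Sg (M.sg k) (M.lmulTens x (q ⊗ₜ 1)) = M.lmulTens (M.sg k x) (q ⊗ₜ 1) := by
  have h : ∀ w, onTens Sg (M.sg k) (M.lmulTens (word w) (q ⊗ₜ 1)) =
      M.lmulTens (M.sg k (word w)) (q ⊗ₜ 1) := by
    induction k with
    | zero =>
      intro w
      match w with
      | [] => simp [sg, legOp]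
      | [i] =>
        have h : M.sg 0 (word [i]) = 0 := legOp_short _ _ _ (by simp)
        have h2 : ∀ j, M.sg 0 (FreeAlgebra.ι ℂ j) = 0 := fun j => by
          have h : M.sg 0 (word [j]) = 0 := legOp_short _ _ _ (by simp)
          simpa [word_cons] using h
        rw [h, map_zero, LinearMap.zero_apply, word_cons, word_nil, mul_one, lmulTens_ι, lmulT_tmul,
          map_sum]
        simp [h2]
      | i :: j :: u =>
        rw [word_cons, word_cons, sg_zero_cons, ← mul_assoc, map_mul, map_mul, lmulTens_ι,
          lmulTens_ι, ← Module.End.mul_apply, ← mul_assoc, sg_lmulT_lmulT, Module.End.mul_apply]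
        simp [LinearMap.sum_apply, ← mul_assoc]
    | succ k ih =>
      intro w
      match w with
      | [] => simp [sg, legOp]
      | i :: u =>
        have e : M.sg (k + 1) = shiftOp (M.sg k) := rfl
        rw [word_cons, e, shiftOp_cons, map_mul, map_mul, Module.End.mul_apply,
          Module.End.mul_apply, ← ih, lmulTens_ι, ← Module.End.mul_apply, shiftOp_lmulT]
        rfl
  exact LinearMap.congr_fun (tens_ext
    (f := onTens Sg (M.sg k) ∘ₗ LinearMap.applyₗ (R := ℂ) (M := Sg ⊗[ℂ] Tens d) (M₂ := Sg ⊗[ℂ] Tens d) (q ⊗ₜ[ℂ] (1 : Tens d)) ∘ₗ M.lmulTens.toLinearMap)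
    (g := LinearMap.applyₗ (R := ℂ) (M := Sg ⊗[ℂ] Tens d) (M₂ := Sg ⊗[ℂ] Tens d) (q ⊗ₜ[ℂ] (1 : Tens d)) ∘ₗ M.lmulTens.toLinearMap ∘ₗ M.sg k) h) x

lemma lmulT_eq_of_gen {X Y : Module.End ℂ (Tens d)} (h : ∀ j, X * gen j = Y * gen j) (i : Fin d) :
    onTens Sg X * M.lmulT i = onTens Sg Y * M.lmulT i := by
  simp only [onTens_lmulT, h]

lemma cosetOp_lmulT (j : Fin d) : onTens Sg (cosetOp M.sigma) * M.lmulT j +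
    onTens Sg (M.sg 0) * M.lmulT j * onTens Sg (cosetOp M.sigma) = M.lmulT j := by
  have h : ∀ i, cosetOp M.sigma * gen i + M.sg 0 * gen i * cosetOp M.sigma = gen i := fun i => by
    rw [cosetOp_mul_gen]
    exact sub_add_cancel _ _
  rw [onTens_lmulT, onTens_lmulT, Finset.sum_mul, ← Finset.sum_add_distrib]
  refine Finset.sum_congr rfl fun i _ => ?_
  rw [mul_assoc, ← mul_add, ← map_mul, ← map_add, h]

lemma antisym_lmulT (j : Fin d) : onTens Sg (antisym M.sigma) * M.lmulT j =
    onTens Sg (shiftOp (antisym M.sigma)) * onTens Sg (cosetOp M.sigma) * M.lmulT j := by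
  rw [← map_mul]
  exact M.lmulT_eq_of_gen (antisym_mul_gen M.sigma) j

lemma cosetOp_lmulTens (q : Sg) (x : Tens d) :
    onTens Sg (cosetOp M.sigma) (M.lmulTens x (q ⊗ₜ 1)) =
      M.lmulTens (cosetOp M.sigma x) (q ⊗ₜ 1) := by
  refine LinearMap.congr_fun (tens_ext (f := onTens Sg (cosetOp M.sigma) ∘ₗ
      LinearMap.applyₗ (R := ℂ) (M := Sg ⊗[ℂ] Tens d) (M₂ := Sg ⊗[ℂ] Tens d) (q ⊗ₜ[ℂ] (1 : Tens d)) ∘ₗ M.lmulTens.toLinearMap)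
    (g := LinearMap.applyₗ (R := ℂ) (M := Sg ⊗[ℂ] Tens d) (M₂ := Sg ⊗[ℂ] Tens d) (q ⊗ₜ[ℂ] (1 : Tens d)) ∘ₗ M.lmulTens.toLinearMap ∘ₗ
      cosetOp M.sigma) fun w => ?_) x
  simp only [LinearMap.comp_apply, LinearMap.applyₗ_apply_apply, AlgHom.toLinearMap_apply]
  induction w with
  | nil => simp [cosetOp_one]
  | cons i w ih =>
    have h1 := LinearMap.congr_fun (M.cosetOp_lmulT i) (M.lmulTens (word w) (q ⊗ₜ 1))
    have h2 := LinearMap.congr_fun (cosetOp_mul_gen M.sigma i) (word w)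
    simp only [Module.End.mul_apply, LinearMap.sub_apply, LinearMap.add_apply, gen_apply] at h1 h2
    rw [word_cons, map_mul, Module.End.mul_apply, lmulTens_ι, eq_sub_of_add_eq h1, ih, h2, map_sub,
      LinearMap.sub_apply, map_mul, Module.End.mul_apply, lmulTens_ι]
    congr 1
    rw [← sg, ← sg_lmulTens, map_mul, Module.End.mul_apply, lmulTens_ι]

/-- Right `Σ`-linearity of `A_σ`, by induction on the degree through its recursion; the coset sum
inherits it from `σ` in `cosetOp_lmulTens`. It is needed because the involution turns left
coefficients into right ones. -/
lemma antisym_lmulTens (q : Sg) (x : Tens d) :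
    onTens Sg (antisym M.sigma) (M.lmulTens x (q ⊗ₜ 1)) =
      M.lmulTens (antisym M.sigma x) (q ⊗ₜ 1) := by
  have main : ∀ n, ∀ x ∈ homTens d n, onTens Sg (antisym M.sigma) (M.lmulTens x (q ⊗ₜ 1)) =
      M.lmulTens (antisym M.sigma x) (q ⊗ₜ 1) := by
    intro n
    induction n with
    | zero =>
      intro x hx
      refine homTens_ext (f := onTens Sg (antisym M.sigma) ∘ₗ
        LinearMap.applyₗ (R := ℂ) (M := Sg ⊗[ℂ] Tens d) (M₂ := Sg ⊗[ℂ] Tens d) (q ⊗ₜ[ℂ] (1 : Tens d)) ∘ₗ M.lmulTens.toLinearMap)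
        (g := LinearMap.applyₗ (R := ℂ) (M := Sg ⊗[ℂ] Tens d) (M₂ := Sg ⊗[ℂ] Tens d) (q ⊗ₜ[ℂ] (1 : Tens d)) ∘ₗ M.lmulTens.toLinearMap ∘ₗ
          antisym M.sigma) (fun w hw => ?_) hx
      rw [List.length_eq_zero_iff.1 hw]
      simp [antisym_one]
    | succ n ih =>
      have hshift : ∀ y ∈ homTens d (n + 1),
          onTens Sg (shiftOp (antisym M.sigma)) (M.lmulTens y (q ⊗ₜ 1)) =
            M.lmulTens (shiftOp (antisym M.sigma) y) (q ⊗ₜ 1) := by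
        intro y hy
        refine homTens_ext (f := onTens Sg (shiftOp (antisym M.sigma)) ∘ₗ
          LinearMap.applyₗ (R := ℂ) (M := Sg ⊗[ℂ] Tens d) (M₂ := Sg ⊗[ℂ] Tens d) (q ⊗ₜ[ℂ] (1 : Tens d)) ∘ₗ M.lmulTens.toLinearMap)
          (g := LinearMap.applyₗ (R := ℂ) (M := Sg ⊗[ℂ] Tens d) (M₂ := Sg ⊗[ℂ] Tens d) (q ⊗ₜ[ℂ] (1 : Tens d)) ∘ₗ M.lmulTens.toLinearMap ∘ₗ
            shiftOp (antisym M.sigma)) (fun w hw => ?_) hy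
        match w, hw with
        | i :: u, hw =>
          simp only [LinearMap.comp_apply, LinearMap.applyₗ_apply_apply, AlgHom.toLinearMap_apply]
          rw [word_cons, shiftOp_cons, map_mul, map_mul, Module.End.mul_apply,
            Module.End.mul_apply, ← ih _ (word_mem_homTens' (by simpa using hw)), lmulTens_ι,
            ← Module.End.mul_apply, shiftOp_lmulT]
          rfl
      intro x hx
      refine homTens_ext (f := onTens Sg (antisym M.sigma) ∘ₗ
        LinearMap.applyₗ (R := ℂ) (M := Sg ⊗[ℂ] Tens d) (M₂ := Sg ⊗[ℂ] Tens d) (q ⊗ₜ[ℂ] (1 : Tens d)) ∘ₗ M.lmulTens.toLinearMap)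
        (g := LinearMap.applyₗ (R := ℂ) (M := Sg ⊗[ℂ] Tens d) (M₂ := Sg ⊗[ℂ] Tens d) (q ⊗ₜ[ℂ] (1 : Tens d)) ∘ₗ M.lmulTens.toLinearMap ∘ₗ
          antisym M.sigma) (fun w hw => ?_) hx
      match w, hw with
      | i :: u, hw =>
        simp only [LinearMap.comp_apply, LinearMap.applyₗ_apply_apply, AlgHom.toLinearMap_apply]
        have h1 := LinearMap.congr_fun (M.antisym_lmulT i) (M.lmulTens (word u) (q ⊗ₜ 1))
        have h2 := LinearMap.congr_fun (antisym_mul_gen M.sigma i) (word u)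
        simp only [Module.End.mul_apply, gen_apply] at h1 h2
        rw [word_cons, map_mul, Module.End.mul_apply, lmulTens_ι, h1, h2, ← lmulTens_ι,
          ← Module.End.mul_apply (M.lmulTens _), ← map_mul, cosetOp_lmulTens, hshift]
        exact cosetOp_mem _ _ (by rw [← word_cons]; exact word_mem_homTens' hw)
  refine LinearMap.congr_fun (tens_ext (f := onTens Sg (antisym M.sigma) ∘ₗ
      LinearMap.applyₗ (R := ℂ) (M := Sg ⊗[ℂ] Tens d) (M₂ := Sg ⊗[ℂ] Tens d) (q ⊗ₜ[ℂ] (1 : Tens d)) ∘ₗ M.lmulTens.toLinearMap)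
    (g := LinearMap.applyₗ (R := ℂ) (M := Sg ⊗[ℂ] Tens d) (M₂ := Sg ⊗[ℂ] Tens d) (q ⊗ₜ[ℂ] (1 : Tens d)) ∘ₗ M.lmulTens.toLinearMap ∘ₗ
      antisym M.sigma) fun w => main _ _ (word_mem_homTens w)) x

/-- Right multiplication by `q ∈ Σ`. -/
def rho (q : Sg) : Module.End ℂ (Sg ⊗[ℂ] Tens d) :=
  TensorProduct.lift (LinearMap.mk₂ ℂ (fun p x => lam d p (M.lmulTens x (q ⊗ₜ 1)))
    (fun p p' x => by simp [lam_add]) (fun c p x => by simp [lam_smul])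
    (fun p x x' => by simp) (fun c p x => by simp))

lemma rho_tmul (q p : Sg) (x : Tens d) :
    M.rho q (p ⊗ₜ x) = lam d p (M.lmulTens x (q ⊗ₜ 1)) := rfl

lemma rho_tmul_one (q p : Sg) : M.rho q (p ⊗ₜ 1) = (p * q) ⊗ₜ 1 := by simp [rho_tmul]

lemma rho_lam (q p : Sg) : M.rho q * lam d p = lam d p * M.rho q := by
  refine TensorProduct.ext' fun r x => ?_
  simp [rho_tmul, lam_mul]

lemma rho_lmulT (q : Sg) (i : Fin d) : M.rho q * M.lmulT i = M.lmulT i * M.rho q := by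
  refine TensorProduct.ext' fun p x => ?_
  rw [Module.End.mul_apply, Module.End.mul_apply, rho_tmul, lmulT_tmul, map_sum,
    ← Module.End.mul_apply, lmulT_lam]
  simp [rho_tmul, LinearMap.sum_apply]

lemma rho_lmulTens (q : Sg) (x : Tens d) : M.rho q * M.lmulTens x = M.lmulTens x * M.rho q := by
  induction x using FreeAlgebra.induction with
  | grade0 c => rw [AlgHom.commutes, Algebra.commutes]
  | grade1 i => rw [lmulTens_ι, rho_lmulT]
  | mul a b ha hb => rw [map_mul, ← mul_assoc, ha, mul_assoc, hb, mul_assoc]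
  | add a b ha hb => rw [map_add, mul_add, ha, hb, add_mul]

/-- The involution `(q ⊗ t)^* = t^* q^*` of `Σ ⊗ 𝕍^⊗`. -/
def starT : Sg ⊗[ℂ] Tens d →ₗ⋆[ℂ] Sg ⊗[ℂ] Tens d :=
  TensorProduct.lift (LinearMap.mk₂'ₛₗ (starRingEnd ℂ) (starRingEnd ℂ)
    (fun q x => M.lmulTens (Q.tensStar x) (star q ⊗ₜ[ℂ] 1))
    (fun q q' x => by simp [TensorProduct.add_tmul])
    (fun c q x => by rw [star_smul, ← TensorProduct.smul_tmul', map_smul]; rfl)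
    (fun q x x' => by simp)
    (fun c q x => by simp))

lemma starT_tmul (q : Sg) (x : Tens d) :
    M.starT (q ⊗ₜ x) = M.lmulTens (Q.tensStar x) (star q ⊗ₜ 1) := rfl

lemma starT_one_tmul (x : Tens d) : M.starT ((1 : Sg) ⊗ₜ x) = 1 ⊗ₜ Q.tensStar x := by
  rw [starT_tmul, star_one, lmulTens_one_tmul, mul_one]

lemma starT_antisym (X : Sg ⊗[ℂ] Tens d) :
    M.starT (onTens Sg (antisym M.sigma) X) = onTens Sg (antisym M.sigma) (M.starT X) := by
  induction X with
  | zero => simp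
  | add x y hx hy => simp only [map_add, hx, hy]
  | tmul q x =>
    rw [onTens_tmul, starT_tmul, starT_tmul, antisym_lmulTens, tensStar_antisym]

lemma starT_lam (p : Sg) (X : Sg ⊗[ℂ] Tens d) :
    M.starT (lam d p X) = M.rho (star p) (M.starT X) := by
  induction X with
  | zero => simp
  | add x y hx hy => simp only [map_add, hx, hy]
  | tmul q x =>
    rw [lam_tmul, starT_tmul, starT_tmul, ← Module.End.mul_apply, rho_lmulTens,
      Module.End.mul_apply, rho_tmul_one, star_mul]

end BraidedMetric

end TensorStar

end QRiem

namespace QRiem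

section Pairing

variable {A : Type*} [Ring A] [StarRing A] [HopfAlgebra ℂ A] [StarModule ℂ A] {d : ℕ}
  {Q : CoordForms A d} {Sg : Type*} [Ring Sg] [StarRing Sg] [Algebra ℂ Sg] [StarModule ℂ Sg]

namespace BraidedMetric

variable (M : BraidedMetric Q Sg)

/-! ### Compatibility of the involution with the bimodule structure -/

lemma tensStar_sgInv (x : Tens d) (hx : x ∈ homTens d 3) :
    Q.tensStar (M.sgInv 0 x) = M.sgInv 1 (Q.tensStar x) := by
  have hy : M.sgInv 0 x ∈ homTens d 3 := legOp_mem_homTens _ 0 3 x hx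
  have h1 : Q.tensStar (M.sg 0 (M.sgInv 0 x)) = M.sg 1 (Q.tensStar (M.sgInv 0 x)) :=
    M.tensStar_sg 2 1 (by norm_num) _ hy
  rw [← Module.End.mul_apply, sg_mul_sgInv, legOp_one_of_le (by norm_num) hx] at h1
  rw [h1, ← Module.End.mul_apply, sgInv_mul_sg,
    legOp_one_of_le (by norm_num) (Q.tensStar_mem _ hy)]

lemma lmulTens_tensStarGen_pairOp (i : Fin d) :
    M.lmulTens (Q.tensStarGen i) * M.pairOp =
      M.pairOp * onTens Sg (M.sg 1 * M.sgInv 0) * M.lmulTens (Q.tensStarGen i) := by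
  simp only [CoordForms.tensStarGen, map_sum, map_smul, lmulTens_ι, Finset.sum_mul, Finset.mul_sum,
    smul_mul_assoc, mul_smul_comm, lmulT_pairOp]

lemma star_g_tmul_one (a b : Fin d) : star (M.g a b) ⊗ₜ[ℂ] (1 : Tens d) =
    M.pairOp (1 ⊗ₜ (Q.tensStarGen b * Q.tensStarGen a)) := by
  have e : Q.tensStarGen b * Q.tensStarGen a = ∑ k, ∑ l,
      (Q.cHalf⁻¹ k b * Q.cHalf⁻¹ l a) • (FreeAlgebra.ι ℂ k * (FreeAlgebra.ι ℂ l * 1)) := by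
    simp [CoordForms.tensStarGen, Finset.sum_mul_sum, smul_smul, mul_comm]
  rw [e, M.g_star]
  simp only [TensorProduct.tmul_sum, TensorProduct.tmul_smul, map_sum, map_smul, pairOp_cons,
    one_mul, TensorProduct.sum_tmul]
  simp only [TensorProduct.smul_tmul']

/-- In `(g_{ab} θ_c)^* = θ_c^* g_{ab}^*` the vector stands to the left of the coefficient, and
moving it past the contraction costs the braiding of `lmulT_pairOp`. -/
lemma starT_pairOp (y : Tens d) (hy : y ∈ homTens d 3) : M.starT (M.pairOp (1 ⊗ₜ y)) =
    M.pairOp (1 ⊗ₜ M.sg 1 (M.sgInv 0 (Q.tensStar y))) := by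
  refine homTens_ext (f := M.starT.comp (M.pairOp ∘ₗ TensorProduct.mk ℂ Sg (Tens d) 1))
    (g := (M.pairOp ∘ₗ TensorProduct.mk ℂ Sg (Tens d) 1 ∘ₗ M.sg 1 ∘ₗ M.sgInv 0).comp Q.tensStar)
    (fun w hw => ?_) hy
  match w, hw with
  | [a, b, c], _ =>
    simp only [LinearMap.comp_apply, TensorProduct.mk_apply]
    have e : word [a, b, c] =
      FreeAlgebra.ι ℂ a * (FreeAlgebra.ι ℂ b * FreeAlgebra.ι ℂ c) := by simp [word_cons]
    rw [e, pairOp_cons, starT_tmul, Q.tensStar_mul, Q.tensStar_mul, Q.tensStar_ι, Q.tensStar_ι,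
      Q.tensStar_ι, one_mul, star_g_tmul_one]
    have h := LinearMap.congr_fun (M.lmulTens_tensStarGen_pairOp c)
      (1 ⊗ₜ (Q.tensStarGen b * Q.tensStarGen a))
    simp only [Module.End.mul_apply, lmulTens_one_tmul, onTens_tmul] at h
    rw [h, mul_assoc]

/-- Moving `θ_i` past `g_{kl}` introduces `σ_1 σ_0⁻¹`, whose image under the leg reversal is `σ_0
σ_1⁻¹`. The star of the contraction introduces another `σ_1 σ_0⁻¹`, and everything cancels. -/
lemma starT_lmulT_g (i k l : Fin d) : M.starT (M.lmulT i (M.g k l ⊗ₜ 1)) =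
    star (M.g k l) ⊗ₜ Q.tensStarGen i := by
  have hx : word [i, k, l] ∈ homTens d 3 := word_mem_homTens [i, k, l]
  have hx' := Q.tensStar_mem _ hx
  have h1 : M.lmulT i (M.g k l ⊗ₜ 1) = M.pairOp (1 ⊗ₜ M.sg 1 (M.sgInv 0 (word [i, k, l]))) := by
    have h := LinearMap.congr_fun (M.lmulT_pairOp i)
      (1 ⊗ₜ (FreeAlgebra.ι ℂ k * (FreeAlgebra.ι ℂ l * 1)))
    simp only [Module.End.mul_apply, lmulT_one_tmul, onTens_tmul] at h
    rw [g_tmul_one, h]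
    rfl
  have hy : M.sgInv 0 (word [i, k, l]) ∈ homTens d 3 := legOp_mem_homTens _ 0 3 _ hx
  have h2 : Q.tensStar (M.sg 1 (M.sgInv 0 (word [i, k, l]))) =
      M.sg 0 (Q.tensStar (M.sgInv 0 (word [i, k, l]))) := M.tensStar_sg 2 0 (by norm_num) _ hy
  have hz : M.sgInv 1 (Q.tensStar (word [i, k, l])) ∈ homTens d 3 := legOp_mem_homTens _ 1 3 _ hx'
  rw [h1, starT_pairOp _ _ (M.sg_mem 1 3 _ hy), h2, tensStar_sgInv _ _ hx,
    ← Module.End.mul_apply (M.sgInv 0), sgInv_mul_sg, legOp_one_of_le (by norm_num) hz,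
    ← Module.End.mul_apply (M.sg 1), sg_mul_sgInv, legOp_one_of_le (by norm_num) hx', word_cons,
    word_cons, word_cons, word_nil, mul_one, Q.tensStar_mul, Q.tensStar_mul, Q.tensStar_ι,
    Q.tensStar_ι, Q.tensStar_ι]
  have h3 : ∀ (y : Tens d) (z : Tens d), y ∈ homTens d 2 → M.pairOp (1 ⊗ₜ (y * z)) =
      onTens Sg (LinearMap.mulRight ℂ z) (M.pairOp (1 ⊗ₜ y)) := by
    intro y z hy
    refine homTens_ext (f := M.pairOp ∘ₗ TensorProduct.mk ℂ Sg (Tens d) 1 ∘ₗ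
        LinearMap.mulRight ℂ z)
      (g := onTens Sg (LinearMap.mulRight ℂ z) ∘ₗ M.pairOp ∘ₗ TensorProduct.mk ℂ Sg (Tens d) 1)
      (fun w hw => ?_) hy
    match w, hw with
    | [a, b], _ =>
      simp only [LinearMap.comp_apply, TensorProduct.mk_apply, LinearMap.mulRight_apply]
      rw [word_cons, word_cons, pairOp_cons, mul_assoc, mul_assoc, pairOp_cons, onTens_tmul,
        LinearMap.mulRight_apply]
  have h4 : ∃ N, N = 2 ∧ Q.tensStarGen l * Q.tensStarGen k ∈ homTens d N :=
    ⟨1 + 1, rfl, mul_mem_homTens (Q.tensStarGen_mem l) (Q.tensStarGen_mem k)⟩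
  obtain ⟨N, rfl, h4⟩ := h4
  rw [h3 _ _ h4, ← star_g_tmul_one, onTens_tmul, LinearMap.mulRight_apply, one_mul]

lemma starT_add_hom_lmulT (p q : Sg) (i : Fin d)
    (h : ∀ j, M.starT (M.lmulT j (q ⊗ₜ 1)) = star q ⊗ₜ Q.tensStarGen j) :
    M.starT (M.lmulT i ((p * q) ⊗ₜ 1)) =
      lam d (star q) (M.starT (M.lmulT i (p ⊗ₜ 1))) := by
  have e : (p * q) ⊗ₜ[ℂ] (1 : Tens d) = lam d p (q ⊗ₜ 1) := rfl
  rw [e, ← Module.End.mul_apply, lmulT_lam, LinearMap.sum_apply, map_sum, lmulT_tmul, map_sum,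
    map_sum]
  refine Finset.sum_congr rfl fun j _ => ?_
  have e2 : M.nuS p i j ⊗ₜ[ℂ] (FreeAlgebra.ι ℂ j * 1 : Tens d) =
    lam d (M.nuS p i j) (1 ⊗ₜ (FreeAlgebra.ι ℂ j)) := by rw [lam_tmul, mul_one, mul_one]
  have e3 : star q ⊗ₜ[ℂ] Q.tensStarGen j = lam d (star q) (1 ⊗ₜ Q.tensStarGen j) := by
    rw [lam_tmul, mul_one]
  rw [Module.End.mul_apply, starT_lam, h, e2, starT_lam, starT_one_tmul, Q.tensStar_ι, e3,
    ← Module.End.mul_apply, rho_lam]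
  rfl

/-- The relation `(θ_i q)^* = q^* θ_i^*` is the core of antimultiplicativity, since the involution
was defined on products with the coefficient on the left. It is known for `q = g_{kl}` and
propagates along products by `starT_add_hom_lmulT`. -/
lemma starT_lmulT_one (i : Fin d) (q : Sg) :
    M.starT (M.lmulT i (q ⊗ₜ 1)) = star q ⊗ₜ Q.tensStarGen i := by
  have h1 : ∀ j, M.starT (M.lmulT j ((1 : Sg) ⊗ₜ 1)) = 1 ⊗ₜ Q.tensStarGen j := fun j => by
    rw [lmulT_one_tmul, starT_one_tmul, mul_one, Q.tensStar_ι]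
  have h := congrFun (M.gen_induction (W := Fin d → Sg ⊗[ℂ] Tens d)
    (⟨⟨fun q j => M.starT (M.lmulT j (q ⊗ₜ 1)), by ext; simp⟩,
      fun p q => by ext; simp [TensorProduct.add_tmul]⟩)
    (fun q => ⟨⟨fun w r => lam d (star q) (w r), by ext; simp⟩, fun w w' => by ext; simp⟩)
    (fun p q w => by ext; simp [lam_add]) (fun w => by ext; simp)
    (fun p q w => by ext; simp [lam_mul])
    (fun c p => by
      ext j
      simp only [AddMonoidHom.coe_mk, ZeroHom.coe_mk]
      refine M.starT_add_hom_lmulT p _ j fun k => ?_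
      rw [Algebra.algebraMap_eq_smul_one, ← TensorProduct.smul_tmul', map_smul,
        LinearMap.map_smulₛₗ, h1, star_smul, star_one, TensorProduct.smul_tmul']
      rfl)
    (fun k l p => by
      ext j
      simp only [AddMonoidHom.coe_mk, ZeroHom.coe_mk]
      exact M.starT_add_hom_lmulT p _ j fun r => M.starT_lmulT_g r k l) q 1) i
  simp only [AddMonoidHom.coe_mk, ZeroHom.coe_mk, one_mul] at h
  rw [h, h1, lam_tmul, mul_one]

lemma starT_mulRight (x : Tens d) (X : Sg ⊗[ℂ] Tens d) :
    M.starT (onTens Sg (LinearMap.mulRight ℂ x) X) = M.lmulTens (Q.tensStar x) (M.starT X) := by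
  induction X with
  | zero => simp
  | add a b ha hb => simp only [map_add, ha, hb]
  | tmul q y =>
    rw [onTens_tmul, LinearMap.mulRight_apply, starT_tmul, Q.tensStar_mul, map_mul, starT_tmul]
    rfl

lemma starT_lmulT (i : Fin d) (X : Sg ⊗[ℂ] Tens d) :
    M.starT (M.lmulT i X) = onTens Sg (LinearMap.mulRight ℂ (Q.tensStarGen i)) (M.starT X) := by
  induction X with
  | zero => simp
  | add a b ha hb => simp only [map_add, ha, hb]
  | tmul q x =>
    have e : q ⊗ₜ[ℂ] x = onTens Sg (LinearMap.mulRight ℂ x) (q ⊗ₜ 1) := by simp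
    have e2 : star q ⊗ₜ[ℂ] Q.tensStarGen i =
      onTens Sg (LinearMap.mulRight ℂ (Q.tensStarGen i)) (star q ⊗ₜ 1) := by simp
    rw [starT_tmul, e, ← Module.End.mul_apply, lmulT_mulRight, Module.End.mul_apply,
      starT_mulRight, starT_lmulT_one, e2, ← Module.End.mul_apply, lmulTens_mulRight]
    rfl

lemma starT_lmulTens (x : Tens d) (X : Sg ⊗[ℂ] Tens d) :
    M.starT (M.lmulTens x X) = onTens Sg (LinearMap.mulRight ℂ (Q.tensStar x)) (M.starT X) := by
  induction x using FreeAlgebra.induction generalizing X with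
  | grade0 c =>
    rw [Algebra.algebraMap_eq_smul_one, map_smul, map_one, LinearMap.smul_apply,
      LinearMap.map_smulₛₗ, LinearMap.map_smulₛₗ, Q.tensStar_one, Module.End.one_apply]
    have : LinearMap.mulRight ℂ (conj c • (1 : Tens d)) = conj c • 1 := by ext; simp
    rw [this, map_smul, map_one]
    rfl
  | grade1 i => rw [lmulTens_ι, starT_lmulT, Q.tensStar_ι]
  | mul a b ha hb =>
    rw [map_mul, Module.End.mul_apply, ha, hb, ← Module.End.mul_apply, ← map_mul, Q.tensStar_mul]
    congr 2
    exact LinearMap.ext fun y => by simp [mul_assoc]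
  | add a b ha hb =>
    have : LinearMap.mulRight ℂ (Q.tensStar a + Q.tensStar b) =
      LinearMap.mulRight ℂ (Q.tensStar a) + LinearMap.mulRight ℂ (Q.tensStar b) :=
        LinearMap.ext fun y => by simp [mul_add]
    rw [map_add, LinearMap.add_apply, map_add, ha, hb, map_add, this, map_add, LinearMap.add_apply]

lemma starT_starT (X : Sg ⊗[ℂ] Tens d) : M.starT (M.starT X) = X := by
  induction X with
  | zero => simp
  | add a b ha hb => simp only [map_add, ha, hb]
  | tmul q x =>
    rw [starT_tmul, starT_lmulTens, starT_tmul, Q.tensStar_one, map_one, star_star,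
      Q.tensStar_tensStar]
    simp

lemma starT_rho (q : Sg) (X : Sg ⊗[ℂ] Tens d) :
    M.starT (M.rho q X) = lam d (star q) (M.starT X) := by
  have h := M.starT_lam (star q) (M.starT X)
  rw [star_star, starT_starT] at h
  rw [← h, starT_starT]

lemma rho_mulRight (i : Fin d) (q : Sg) (X : Sg ⊗[ℂ] Tens d) :
    M.rho q (onTens Sg (LinearMap.mulRight ℂ (FreeAlgebra.ι ℂ i)) X) =
      ∑ j, onTens Sg (LinearMap.mulRight ℂ (FreeAlgebra.ι ℂ j)) (M.rho (M.nuS q i j) X) := by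
  induction X with
  | zero => simp
  | add a b ha hb => simp only [map_add, ha, hb, Finset.sum_add_distrib]
  | tmul p x =>
    rw [onTens_tmul, LinearMap.mulRight_apply, rho_tmul, map_mul, Module.End.mul_apply,
      lmulTens_ι, lmulT_tmul, map_sum, map_sum]
    refine Finset.sum_congr rfl fun j _ => ?_
    have e : M.nuS q i j ⊗ₜ[ℂ] (FreeAlgebra.ι ℂ j * 1 : Tens d) =
      onTens Sg (LinearMap.mulRight ℂ (FreeAlgebra.ι ℂ j)) (M.nuS q i j ⊗ₜ 1) := by simp
    rw [rho_tmul, e, ← Module.End.mul_apply (M.lmulTens x), lmulTens_mulRight,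
      Module.End.mul_apply, ← Module.End.mul_apply, ← onTens_lam]
    rfl

/-- The star of the commutation rule `θ_i q = ∑ ν_Σ(q)_{ij} θ_j`, in the form `rho_mulRight`. -/
lemma lam_lmulTens_tensStarGen (i : Fin d) (q : Sg) (X : Sg ⊗[ℂ] Tens d) :
    lam d (star q) (M.lmulTens (Q.tensStarGen i) X) =
      ∑ j, M.lmulTens (Q.tensStarGen j) (lam d (star (M.nuS q i j)) X) := by
  have h := congrArg M.starT (M.rho_mulRight i q (M.starT X))
  simp only [map_sum, starT_rho, starT_mulRight, starT_starT, Q.tensStar_ι] at h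
  exact h

/-! ### The pairing of the extended tensor algebra with itself -/

/-- The iterated contraction with a tensor. -/
def contrWord : Tens d →ₐ[ℂ] Module.End ℂ (Sg ⊗[ℂ] Tens d) := FreeAlgebra.lift ℂ M.contrT

@[simp] lemma contrWord_ι (i : Fin d) : M.contrWord (FreeAlgebra.ι ℂ i) = M.contrT i := by
  simp [contrWord]

lemma degZero_tmul (q : Sg) (x : Tens d) :
    degZero (q ⊗ₜ[ℂ] x) = (FreeAlgebra.algebraMapInv x : ℂ) • q := by simp [degZero]

lemma degZero_lam (q : Sg) (X : Sg ⊗[ℂ] Tens d) : degZero (lam d q X) = q * degZero X := by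
  induction X with
  | zero => simp
  | add a b ha hb => simp only [map_add, ha, hb, mul_add]
  | tmul p x => simp [degZero_tmul]

@[simp] lemma degZero_lmulT (i : Fin d) (X : Sg ⊗[ℂ] Tens d) : degZero (M.lmulT i X) = 0 := by
  induction X with
  | zero => simp
  | add a b ha hb => simp only [map_add, ha, hb, add_zero]
  | tmul p x => simp [degZero_tmul, lmulT_tmul, FreeAlgebra.algebraMapInv]

lemma gTens_tmul (p : Sg) (x : Tens d) (Y : Sg ⊗[ℂ] Tens d) :
    M.gTens (p ⊗ₜ x) Y = p * degZero (M.contrWord x Y) := rfl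

/-- The iterated contraction with an element of the extended tensor algebra. -/
def contr : Sg ⊗[ℂ] Tens d →ₗ[ℂ] Module.End ℂ (Sg ⊗[ℂ] Tens d) :=
  TensorProduct.lift (LinearMap.mk₂ ℂ (fun p x => lam d p * M.contrWord x)
    (fun p p' x => by rw [lam_add, add_mul]) (fun c p x => by rw [lam_smul, smul_mul_assoc])
    (fun p x x' => by rw [map_add, mul_add])
    (fun c p x => by rw [map_smul, mul_smul_comm]))

lemma contr_tmul (p : Sg) (x : Tens d) : M.contr (p ⊗ₜ x) = lam d p * M.contrWord x := rfl

lemma gTens_eq (X Y : Sg ⊗[ℂ] Tens d) : M.gTens X Y = degZero (M.contr X Y) := by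
  induction X with
  | zero => simp
  | add a b ha hb => simp only [map_add, LinearMap.add_apply, ha, hb]
  | tmul p x => rw [gTens_tmul, contr_tmul, Module.End.mul_apply, degZero_lam]

lemma contr_lam (q : Sg) (X : Sg ⊗[ℂ] Tens d) : M.contr (lam d q X) = lam d q * M.contr X := by
  induction X with
  | zero => simp
  | add a b ha hb => rw [map_add, map_add, map_add, ha, hb, mul_add]
  | tmul p x => rw [lam_tmul, contr_tmul, contr_tmul, lam_mul, mul_assoc]

lemma contr_mulRight (x : Tens d) (X : Sg ⊗[ℂ] Tens d) :
    M.contr (onTens Sg (LinearMap.mulRight ℂ x) X) = M.contr X * M.contrWord x := by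
  induction X with
  | zero => simp
  | add a b ha hb => rw [map_add, map_add, map_add, ha, hb, add_mul]
  | tmul p y =>
    rw [onTens_tmul, LinearMap.mulRight_apply, contr_tmul, contr_tmul, map_mul, mul_assoc]

/-- Contractions move coefficients by the same rule as multiplications (`contrT_lam` and
`lmulT_lam`). Hence `contr` respects products, which turns right multiplication of the first
argument of `gTens` into an operation on the second. -/
lemma contr_lmulT (i : Fin d) (X : Sg ⊗[ℂ] Tens d) :
    M.contr (M.lmulT i X) = M.contrT i * M.contr X := by
  induction X with
  | zero => simp
  | add a b ha hb => rw [map_add, map_add, map_add, ha, hb, mul_add]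
  | tmul p y =>
    rw [lmulT_tmul, map_sum, contr_tmul, ← mul_assoc, contrT_lam, Finset.sum_mul]
    refine Finset.sum_congr rfl fun j _ => ?_
    rw [contr_tmul, map_mul, contrWord_ι, mul_assoc]

lemma contr_lmulTens (x : Tens d) (X : Sg ⊗[ℂ] Tens d) :
    M.contr (M.lmulTens x X) = M.contrWord x * M.contr X := by
  induction x using FreeAlgebra.induction generalizing X with
  | grade0 c =>
    rw [AlgHom.commutes, AlgHom.commutes, Algebra.algebraMap_eq_smul_one, LinearMap.smul_apply,
      map_smul, smul_mul_assoc, one_mul, Module.End.one_apply]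
  | grade1 i => rw [lmulTens_ι, contr_lmulT, contrWord_ι]
  | mul a b ha hb => rw [map_mul, Module.End.mul_apply, ha, hb, map_mul, mul_assoc]
  | add a b ha hb => rw [map_add, LinearMap.add_apply, map_add, ha, hb, map_add, add_mul]

lemma contr_tmul_one (q : Sg) : M.contr (q ⊗ₜ 1) = lam d q := by
  rw [contr_tmul, map_one, mul_one]

lemma contr_rho (q : Sg) (X : Sg ⊗[ℂ] Tens d) : M.contr (M.rho q X) = M.contr X * lam d q := by
  induction X with
  | zero => simp
  | add a b ha hb => rw [map_add, map_add, map_add, ha, hb, add_mul]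
  | tmul p y =>
    rw [rho_tmul, contr_lam, contr_lmulTens, contr_tmul_one, contr_tmul, mul_assoc]

lemma gTens_rho (X Y : Sg ⊗[ℂ] Tens d) (q : Sg) :
    M.gTens (M.rho q X) Y = M.gTens X (lam d q Y) := by
  rw [gTens_eq, gTens_eq, contr_rho, Module.End.mul_apply]

lemma gTens_mulRight (x : Tens d) (X Y : Sg ⊗[ℂ] Tens d) :
    M.gTens (onTens Sg (LinearMap.mulRight ℂ x) X) Y = M.gTens X (M.contrWord x Y) := by
  rw [gTens_eq, gTens_eq, contr_mulRight, Module.End.mul_apply]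

end BraidedMetric

end Pairing

end QRiem

namespace QRiem

/-! ### Adjointness, symmetry and nondegeneracy of the pairing; descent to `𝕍_Σ^∧` -/

section Wedge

variable {A : Type*} [Ring A] [StarRing A] [HopfAlgebra ℂ A] [StarModule ℂ A] {d : ℕ}
  {Q : CoordForms A d} {Sg : Type*} [Ring Sg] [StarRing Sg] [Algebra ℂ Sg] [StarModule ℂ Sg]

lemma tmul_word_induction {p : Sg ⊗[ℂ] Tens d → Prop} (zero : p 0)
    (add : ∀ x y, p x → p y → p (x + y)) (tmul : ∀ (q : Sg) (w : List (Fin d)), p (q ⊗ₜ word w))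
    (X : Sg ⊗[ℂ] Tens d) : p X := by
  induction X with
  | zero => exact zero
  | add a b ha hb => exact add a b ha hb
  | tmul q x =>
    have hx : x ∈ Submodule.span ℂ (Set.range (word (d := d))) := by
      rw [span_word]
      trivial
    induction hx using Submodule.span_induction generalizing q with
    | mem x hx => obtain ⟨w, rfl⟩ := hx; exact tmul q w
    | zero => rw [TensorProduct.tmul_zero]; exact zero
    | add x y _ _ hx hy => rw [TensorProduct.tmul_add]; exact add _ _ (hx q) (hy q)
    | smul c x _ hx => rw [← TensorProduct.smul_tmul]; exact hx (c • q)

namespace BraidedMetric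

variable (M : BraidedMetric Q Sg)

lemma contrWord_lmulTens_tensStarGen (j n : Fin d) :
    M.contrWord (Q.tensStarGen n) * M.lmulTens (Q.tensStarGen j) = lam d (star (M.g j n)) := by
  simp only [CoordForms.tensStarGen, map_sum, map_smul, contrWord_ι, lmulTens_ι, Finset.sum_mul,
    Finset.mul_sum, smul_mul_assoc, mul_smul_comm, contrT_lmulT, M.g_star, lam_sum, lam_smul]
  simp only [Finset.smul_sum, smul_smul]
  rw [Finset.sum_comm]
  simp only [mul_comm]

lemma degZero_lmulTens_tensStarGen (i : Fin d) (X : Sg ⊗[ℂ] Tens d) :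
    degZero (M.lmulTens (Q.tensStarGen i) X) = 0 := by
  simp [CoordForms.tensStarGen, LinearMap.sum_apply]

lemma starT_tmul' (q : Sg) (x : Tens d) :
    M.starT (q ⊗ₜ x) = M.rho (star q) (1 ⊗ₜ Q.tensStar x) := by
  rw [← starT_one_tmul, ← starT_lam, lam_tmul, mul_one]

/-- Contraction with `θ_i` is adjoint to multiplication by `θ_i^*`. For `Y = p θ_n u` the involution
puts `θ_n^*` next to the second argument. There `p^*` moves past `θ_i^*`, giving `θ_j^*
ν_Σ(p)_{ij}^*`, and contraction of `θ_n^*` with `θ_j^*` gives `g_{jn}^*`. The result is the star of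
the coefficient `ν_Σ(p)_{ij} g_{jn}` of the contraction. -/
lemma gTens_starT_contrT (i : Fin d) (Y Z : Sg ⊗[ℂ] Tens d) :
    M.gTens (M.starT (M.contrT i Y)) Z =
      M.gTens (M.starT Y) (M.lmulTens (Q.tensStarGen i) Z) := by
  have main : ∀ (p : Sg) (w : List (Fin d)), M.gTens (M.starT (M.contrT i (p ⊗ₜ word w))) Z =
      M.gTens (M.starT (p ⊗ₜ word w)) (M.lmulTens (Q.tensStarGen i) Z) := by
    intro p w
    cases w with
    | nil =>
      rw [word_nil, contrT_tmul_one, map_zero, map_zero, LinearMap.zero_apply, starT_tmul,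
        Q.tensStar_one, map_one, Module.End.one_apply, gTens_tmul, map_one, Module.End.one_apply,
        degZero_lmulTens_tensStarGen, mul_zero]
    | cons n u =>
      have e1 : M.contrT i (p ⊗ₜ (FreeAlgebra.ι ℂ n * word u)) =
          ∑ j, (M.nuS p i j * M.g j n) ⊗ₜ word u := by
        rw [contrT_tmul]
        refine Finset.sum_congr rfl fun j _ => ?_
        rw [Finset.sum_eq_single n]
        · rw [stripLeft_cons, if_pos rfl]
        · intro k _ hk
          rw [stripLeft_cons, if_neg (Ne.symm hk), TensorProduct.tmul_zero]
        · simp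
      have e2 : (1 : Sg) ⊗ₜ[ℂ] (Q.tensStar (word u) * Q.tensStarGen n) =
        onTens Sg (LinearMap.mulRight ℂ (Q.tensStarGen n)) (1 ⊗ₜ Q.tensStar (word u)) := rfl
      rw [word_cons, e1, map_sum, map_sum, LinearMap.sum_apply, M.starT_tmul' p, gTens_rho,
        Q.tensStar_mul, Q.tensStar_ι, e2, gTens_mulRight, lam_lmulTens_tensStarGen, map_sum,
        map_sum]
      refine Finset.sum_congr rfl fun j _ => ?_
      rw [starT_tmul', gTens_rho, star_mul, lam_mul, Module.End.mul_apply,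
        ← contrWord_lmulTens_tensStarGen]
      rfl
  induction Y using tmul_word_induction with
  | zero => simp
  | add a b ha hb => simp only [map_add, LinearMap.add_apply, ha, hb]
  | tmul p w => exact main p w

/-! ### Symmetry of the antisymmetrizer with respect to the pairing -/

lemma contrWord_word_sg (v : List (Fin d)) (j : ℕ) :
    M.contrWord (word v) * onTens Sg (M.sg (v.length + j)) =
      onTens Sg (M.sg j) * M.contrWord (word v) := by
  induction v generalizing j with
  | nil => simp
  | cons i v ih =>
    have e : M.sg (v.length + (j + 1)) = shiftOp (M.sg (v.length + j)) := rfl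
    have e' : M.sg (j + 1) = shiftOp (M.sg j) := rfl
    rw [List.length_cons, add_assoc, add_comm 1 j, word_cons, map_mul, contrWord_ι, mul_assoc, ih,
      e', ← mul_assoc, contrT_shiftOp, mul_assoc]

/-- The last letter of `x` is contracted first, so the legs of `x` meet those of the argument in
reversed order: the pair `n - 1 - k` on one side is the pair `k` on the other. -/
lemma contrWord_sg (n k : ℕ) (hk : k < n) (x : Tens d) (hx : x ∈ homTens d (n + 1)) :
    M.contrWord (M.sg (n - 1 - k) x) = M.contrWord x * onTens Sg (M.sg k) := by
  have hle : homTens d (n + 1) ≤ LinearMap.eqLocus (M.contrWord.toLinearMap ∘ₗ M.sg (n - 1 - k))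
      ((LinearMap.lcomp ℂ (Sg ⊗[ℂ] Tens d) (onTens Sg (M.sg k))) ∘ₗ M.contrWord.toLinearMap) :=
    homTens_le fun w hw => ?_
  · exact hle hx
  obtain ⟨u, a, b, v, rfl, hu⟩ := exists_eq_append_pair w (n - 1 - k) (by omega)
  have hv : v.length = k := by
    rw [List.length_append, List.length_cons, List.length_cons] at hw
    omega
  have e1 : word (u ++ a :: b :: v) =
      word u * (FreeAlgebra.ι ℂ a * (FreeAlgebra.ι ℂ b * word v)) := by
    simp [word_append, word_cons]
  have h := M.contrWord_word_sg v 0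
  rw [add_zero, hv] at h
  change M.contrWord (M.sg (n - 1 - k) (word (u ++ a :: b :: v))) =
    M.contrWord (word (u ++ a :: b :: v)) * onTens Sg (M.sg k)
  rw [e1, ← hu, M.sg_mul_left _ _ _ (word_mem_homTens u), sg_zero_cons, map_mul, map_mul, map_mul,
    map_mul, mul_assoc, mul_assoc, mul_assoc, h, contrWord_ι, contrWord_ι,
    ← mul_assoc (M.contrT b), ← mul_assoc (M.contrT a), ← mul_assoc (M.contrT a),
    ← sg_contrT_contrT, map_sum, Finset.sum_mul]
  congr 1
  refine Finset.sum_congr rfl fun p _ => ?_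
  rw [map_smul, map_mul, map_mul, contrWord_ι, contrWord_ι, smul_mul_assoc, mul_assoc]

/-- Passing to the argument reverses both the numbering of the generators and the order of products,
hence `antisymUp_flip_rev`. -/
lemma contrWord_antisym (n : ℕ) (x : Tens d) (hx : x ∈ homTens d (n + 1)) :
    M.contrWord (antisym M.sigma x) = M.contrWord x * onTens Sg (antisymUp M.sg 0 n) := by
  rw [antisym_eq_antisymUp _ n _ hx]
  exact (antisymUp_flip_rev (s := M.sg) (t := M.sg) M.sg_far M.sg_braid
    (fun a b => ∀ x ∈ homTens d (n + 1), a x ∈ homTens d (n + 1) ∧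
      M.contrWord (a x) = M.contrWord x * onTens Sg b)
    (fun x hx => ⟨hx, by rw [Module.End.one_apply, map_one, mul_one]⟩)
    (fun a b a' b' h h' x hx => ⟨Submodule.sub_mem _ (h x hx).1 (h' x hx).1, by
      rw [LinearMap.sub_apply, map_sub, (h x hx).2, (h' x hx).2, map_sub, eq_comm]
      exact LinearMap.ext fun y => map_sub (M.contrWord x) _ _⟩)
    (fun a b a' b' h h' x hx => ⟨(h _ (h' x hx).1).1, by
      rw [Module.End.mul_apply, (h _ (h' x hx).1).2, (h' x hx).2, map_mul, mul_assoc]⟩)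
    n (fun k hk x hx => ⟨M.sg_mem _ _ x hx, M.contrWord_sg n k hk x hx⟩) x hx).2

lemma contrT_tmul_cons (i k : Fin d) (q : Sg) (x : Tens d) :
    M.contrT i (q ⊗ₜ (FreeAlgebra.ι ℂ k * x)) = (∑ j, M.nuS q i j * M.g j k) ⊗ₜ x := by
  rw [contrT_tmul, TensorProduct.sum_tmul]
  refine Finset.sum_congr rfl fun j _ => ?_
  rw [Finset.sum_eq_single k]
  · rw [stripLeft_cons, if_pos rfl]
  · intro l _ hl
    rw [stripLeft_cons, if_neg (Ne.symm hl), TensorProduct.tmul_zero]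
  · simp

/-- Tensors of different degrees are orthogonal. -/
lemma degZero_contrWord_of_ne (u v : List (Fin d)) (q : Sg) (h : u.length ≠ v.length) :
    degZero (M.contrWord (word u) (q ⊗ₜ word v)) = 0 := by
  induction u using List.reverseRecOn generalizing v q with
  | nil =>
    match v, h with
    | i :: v, _ => simp [degZero_tmul, word_cons, FreeAlgebra.algebraMapInv]
  | append_singleton u i ih =>
    rw [word_append, map_mul, Module.End.mul_apply, word_cons, word_nil, mul_one, contrWord_ι]
    match v, h with
    | [], _ => rw [word_nil, contrT_tmul_one, map_zero, map_zero]
    | k :: v, h =>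
      rw [word_cons, contrT_tmul_cons]
      exact ih _ _ (by simpa using h)

lemma degZero_contrWord_of_mem {m n : ℕ} (hmn : m ≠ n) {x y : Tens d} (hx : x ∈ homTens d m)
    (hy : y ∈ homTens d n) (q : Sg) : degZero (M.contrWord x (q ⊗ₜ y)) = 0 := by
  have h1 : ∀ u : List (Fin d), u.length = m → degZero (M.contrWord (word u) (q ⊗ₜ y)) = 0 := by
    intro u hu
    refine homTens_ext (f := degZero ∘ₗ M.contrWord (word u) ∘ₗ TensorProduct.mk ℂ Sg (Tens d) q)
      (g := 0) (fun v hv => ?_) hy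
    exact M.degZero_contrWord_of_ne u v q (by omega)
  refine homTens_ext (f := degZero ∘ₗ LinearMap.applyₗ (R := ℂ) (M := Sg ⊗[ℂ] Tens d)
    (M₂ := Sg ⊗[ℂ] Tens d) (q ⊗ₜ[ℂ] y) ∘ₗ M.contrWord.toLinearMap) (g := 0) (fun u hu => ?_) hx
  exact h1 u hu

lemma gTens_antisym (X Y : Sg ⊗[ℂ] Tens d) :
    M.gTens (onTens Sg (antisym M.sigma) X) Y = M.gTens X (onTens Sg (antisym M.sigma) Y) := by
  induction X using tmul_word_induction with
  | zero => simp
  | add a b ha hb => simp only [map_add, LinearMap.add_apply, ha, hb]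
  | tmul p u =>
    induction Y using tmul_word_induction with
    | zero => simp
    | add a b ha hb => simp only [map_add, ha, hb]
    | tmul q v =>
      rw [onTens_tmul, gTens_tmul, onTens_tmul, gTens_tmul]
      congr 1
      -- In equal positive degrees `contrWord_antisym` applies, and degree zero is separate because
      -- `antisymUp` describes `A_σ` only from degree one on. In different degrees both sides
      -- vanish.
      by_cases h : u.length = v.length
      · rcases hu : u.length with _ | n
        · rw [List.length_eq_zero_iff.1 hu, List.length_eq_zero_iff.1 (h.symm.trans hu), word_nil,
            antisym_one]
        · rw [M.contrWord_antisym n _ (word_mem_homTens' hu),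
            antisym_eq_antisymUp _ n _ (word_mem_homTens' (h.symm.trans hu))]
          rfl
      · rw [M.degZero_contrWord_of_mem h (antisym_mem _ _ _ (word_mem_homTens u))
          (word_mem_homTens v), M.degZero_contrWord_of_mem h (word_mem_homTens u)
          (antisym_mem _ _ _ (word_mem_homTens v))]

/-! ### Nondegeneracy of the pairing -/

/-- Left multiplication by the element dual to `θ_j`. -/
def dualT (j : Fin d) : Module.End ℂ (Sg ⊗[ℂ] Tens d) := ∑ k, M.lmulT k * lam d (M.gInv k j)

lemma contrT_dualT (i j : Fin d) : M.contrT i * M.dualT j = if i = j then 1 else 0 := by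
  have h := congrFun (congrFun M.g_mul_gInv i) j
  rw [Matrix.mul_apply, Matrix.one_apply] at h
  rw [dualT, Finset.mul_sum]
  simp only [← mul_assoc, contrT_lmulT, ← lam_mul, ← lam_sum]
  rw [h]
  split_ifs
  · exact lam_one
  · exact lam_zero

lemma degZero_dualT (j : Fin d) (X : Sg ⊗[ℂ] Tens d) : degZero (M.dualT j X) = 0 := by
  simp [dualT, LinearMap.sum_apply]

/-- The tensor dual to `word w`. -/
def dualWord : List (Fin d) → Sg ⊗[ℂ] Tens d :=
  fun w => w.reverseRecOn (1 ⊗ₜ 1) fun _ i X => M.dualT i X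

lemma dualWord_append (w : List (Fin d)) (i : Fin d) :
    M.dualWord (w ++ [i]) = M.dualT i (M.dualWord w) := by
  rw [dualWord, List.reverseRecOn_concat]
  rfl

lemma dualWord_nil : M.dualWord [] = 1 ⊗ₜ 1 := by
  rw [dualWord, List.reverseRecOn_nil]

/-- The matrix `g⁻¹` yields multiplications dual to the contractions. The last letter of `u` is
contracted first and the last letter of `w` is multiplied last, so the letters cancel in pairs. -/
lemma degZero_contrWord_dualWord (u w : List (Fin d)) :
    degZero (M.contrWord (word u) (M.dualWord w)) = if u = w then 1 else 0 := by
  induction u using List.reverseRecOn generalizing w with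
  | nil =>
    rcases List.eq_nil_or_concat w with rfl | ⟨w, i, rfl⟩
    · simp [dualWord_nil, degZero_tmul]
    · rw [List.concat_eq_append, dualWord_append, word_nil, map_one, Module.End.one_apply,
        degZero_dualT, if_neg (by simp)]
  | append_singleton u i ih =>
    rw [word_append, map_mul, Module.End.mul_apply, word_cons, word_nil, mul_one, contrWord_ι]
    rcases List.eq_nil_or_concat w with rfl | ⟨w, j, rfl⟩
    · rw [dualWord_nil, contrT_tmul_one, map_zero, map_zero, if_neg (by simp)]
    · rw [List.concat_eq_append, dualWord_append, ← Module.End.mul_apply (M.contrT i), contrT_dualT]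
      by_cases hij : i = j
      · subst hij
        rw [if_pos rfl, Module.End.one_apply, ih]
        simp
      · rw [if_neg hij, LinearMap.zero_apply, map_zero, map_zero, if_neg (by simp [hij])]

lemma gTens_dualWord (X : Sg ⊗[ℂ] Tens d) (w : List (Fin d)) :
    M.gTens X (M.dualWord w) = TensorProduct.rid ℂ Sg ((wordCoeff w).lTensor Sg X) := by
  induction X using tmul_word_induction with
  | zero => simp
  | add a b ha hb => simp only [map_add, LinearMap.add_apply, ha, hb]
  | tmul p u =>
    rw [gTens_tmul, degZero_contrWord_dualWord, LinearMap.lTensor_tmul, wordCoeff, onWords_word]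
    split_ifs <;> simp

lemma eq_zero_of_gTens (X : Sg ⊗[ℂ] Tens d) (h : ∀ Y, M.gTens X Y = 0) : X = 0 := by
  classical
  refine (TensorProduct.equivFinsuppOfBasisRight
    (FreeAlgebra.basisFreeMonoid ℂ (Fin d))).injective ?_
  rw [map_zero]
  ext w
  rw [TensorProduct.equivFinsuppOfBasisRight_apply, Finsupp.zero_apply,
    ← h (M.dualWord w.toList), gTens_dualWord]
  have e : (FreeAlgebra.basisFreeMonoid ℂ (Fin d)).coord w = wordCoeff w.toList := by
    refine (FreeAlgebra.basisFreeMonoid ℂ (Fin d)).ext fun u => ?_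
    rw [wordCoeff, onWords, Module.Basis.constr_basis, Module.Basis.coord_apply,
      Module.Basis.repr_self]
    by_cases h : u = w
    · subst h
      simp
    · rw [Finsupp.single_eq_of_ne (Ne.symm h), if_neg fun h' => h (FreeMonoid.toList.injective h')]
  rw [e]

/-! ### The extended exterior algebra -/

/-- The projection `Σ ⊗ 𝕍^⊗ → 𝕍_Σ^∧`. -/
def projS : Sg ⊗[ℂ] Tens d →ₗ[ℂ] M.VS := Q.proj.toLinearMap.lTensor Sg

@[simp] lemma projS_tmul (q : Sg) (x : Tens d) : M.projS (q ⊗ₜ x) = q ⊗ₜ Q.proj x := rfl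

lemma projS_surjective : Function.Surjective M.projS :=
  LinearMap.lTensor_surjective _ Q.proj_surjective

lemma lmulS_projS (q : Sg) (X : Sg ⊗[ℂ] Tens d) : M.lmulS q (M.projS X) = M.projS (lam d q X) := by
  refine LinearMap.congr_fun (TensorProduct.ext' (g := M.lmulS q ∘ₗ M.projS)
    (h := M.projS ∘ₗ lam d q) fun p x => rfl) X

lemma lmulE_theta_tmul (i : Fin d) (q : Sg) (η : Q.Ext) :
    M.lmulE (Q.theta i) (q ⊗ₜ η) = ∑ j, M.nuS q i j ⊗ₜ (Q.theta j * η) := by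
  rw [lmulE, CoordForms.extLift_theta, LinearMap.sum_apply]
  rfl

lemma lmulE_theta_projS (i : Fin d) (X : Sg ⊗[ℂ] Tens d) :
    M.lmulE (Q.theta i) (M.projS X) = M.projS (M.lmulT i X) := by
  induction X with
  | zero => simp
  | add a b ha hb => simp only [map_add, ha, hb]
  | tmul q x =>
    rw [projS_tmul, lmulE_theta_tmul, lmulT_tmul, map_sum]
    simp only [projS_tmul, map_mul, CoordForms.theta]

lemma lmulE_proj_projS (x : Tens d) (X : Sg ⊗[ℂ] Tens d) :
    M.lmulE (Q.proj x) (M.projS X) = M.projS (M.lmulTens x X) := by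
  induction x using FreeAlgebra.induction generalizing X with
  | grade0 c =>
    rw [AlgHom.commutes, AlgHom.commutes, AlgHom.commutes, Algebra.algebraMap_eq_smul_one,
      Algebra.algebraMap_eq_smul_one, LinearMap.smul_apply, LinearMap.smul_apply, map_smul,
      Module.End.one_apply, Module.End.one_apply]
  | grade1 i => rw [lmulTens_ι, ← lmulE_theta_projS, CoordForms.theta]
  | mul a b ha hb => rw [map_mul, map_mul, Module.End.mul_apply, hb, ha, map_mul, Module.End.mul_apply]
  | add a b ha hb =>
    rw [map_add, map_add, LinearMap.add_apply, ha, hb, map_add, LinearMap.add_apply, map_add]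

lemma real_projS (X : Sg ⊗[ℂ] Tens d) :
    M.real.lTensor Sg (M.projS X) = onTens Sg (antisym M.sigma) X := by
  refine LinearMap.congr_fun (TensorProduct.ext' (g := M.real.lTensor Sg ∘ₗ M.projS)
    (h := onTens Sg (antisym M.sigma)) fun p x => ?_) X
  simp [real_proj]

/-- Since `A_σ` is `id ⊗ A_σ` after the coset sum, contracting the first leg keeps the image of
`A_σ` stable. The formula also describes `ι[θ_i]` on representatives, without `retr`. -/
lemma contrT_antisym (i : Fin d) (X : Sg ⊗[ℂ] Tens d) :
    M.contrT i (onTens Sg (antisym M.sigma) X) =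
      onTens Sg (antisym M.sigma) (M.contrT i (onTens Sg (cosetOp M.sigma) X)) := by
  induction X using tmul_word_induction with
  | zero => simp
  | add a b ha hb => simp only [map_add, ha, hb]
  | tmul p w =>
    cases w with
    | nil => rw [word_nil, onTens_tmul, onTens_tmul, antisym_one, cosetOp_one, contrT_tmul_one,
        map_zero]
    | cons j u =>
      have h := LinearMap.congr_fun (antisym_mul_gen M.sigma j) (word u)
      simp only [Module.End.mul_apply, gen_apply] at h
      rw [word_cons, onTens_tmul, h, ← onTens_tmul, ← Module.End.mul_apply (M.contrT i),
        contrT_shiftOp, Module.End.mul_apply, onTens_tmul]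

lemma retr_antisym (X : Sg ⊗[ℂ] Tens d) :
    M.retr.lTensor Sg (onTens Sg (antisym M.sigma) X) = M.projS X := by
  rw [← real_projS, ← LinearMap.comp_apply, ← LinearMap.lTensor_comp]
  have : M.retr ∘ₗ M.real = LinearMap.id := LinearMap.ext M.retr_real
  rw [this, LinearMap.lTensor_id]
  rfl

lemma iota_projS (i : Fin d) (X : Sg ⊗[ℂ] Tens d) :
    M.iota i (M.projS X) = M.projS (M.contrT i (onTens Sg (cosetOp M.sigma) X)) := by
  rw [iota, LinearMap.comp_apply, LinearMap.comp_apply, real_projS, contrT_antisym, retr_antisym]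

/-- The Clifford relations between contractions and multiplications. -/
lemma iota_lmulE (i j : Fin d) (x : M.VS) :
    M.iota i (M.lmulE (Q.theta j) x) + ∑ p : Fin d × Fin d,
      M.sigma p (i, j) • M.lmulE (Q.theta p.1) (M.iota p.2 x) = M.lmulS (M.g i j) x := by
  obtain ⟨X, rfl⟩ := M.projS_surjective x
  -- On representatives `ι[θ_i]` is the coset sum followed by the contraction. The recursion of the
  -- coset sum past `θ_j` has two terms, and contracting them gives the metric and the braided
  -- exchange.
  have h := congrArg (fun Z => M.projS (M.contrT i Z)) (LinearMap.congr_fun (M.cosetOp_lmulT j) X)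
  have h2 := LinearMap.congr_fun (M.contrT_sg_lmulT i j) (onTens Sg (cosetOp M.sigma) X)
  have h3 := LinearMap.congr_fun (M.contrT_lmulT i j) X
  simp only [LinearMap.add_apply, Module.End.mul_apply, map_add, LinearMap.sum_apply,
    LinearMap.smul_apply] at h h2 h3
  rw [h2, h3] at h
  have e : ∀ p : Fin d × Fin d, M.sigma p (i, j) • M.lmulE (Q.theta p.1) (M.iota p.2 (M.projS X)) =
      M.projS (M.sigma p (i, j) •
        M.lmulT p.1 (M.contrT p.2 (onTens Sg (cosetOp M.sigma) X))) := fun p => by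
    rw [iota_projS, lmulE_theta_projS, map_smul]
  rw [lmulE_theta_projS, iota_projS, lmulS_projS, Finset.sum_congr rfl fun p _ => e p, ← h,
    map_sum]

lemma starV_projS (X : Sg ⊗[ℂ] Tens d) : M.starV (M.projS X) = M.projS (M.starT X) := by
  induction X with
  | zero => simp
  | add a b ha hb => simp only [map_add, ha, hb]
  | tmul q x =>
    have e : star q ⊗ₜ[ℂ] (1 : Q.Ext) = M.projS (star q ⊗ₜ 1) := by rw [projS_tmul, map_one]
    have e2 : M.starV (q ⊗ₜ Q.proj x) = M.lmulE (Q.starExt (Q.proj x)) (star q ⊗ₜ 1) := rfl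
    rw [projS_tmul, e2, CoordForms.starHom_proj, e, lmulE_proj_projS, starT_tmul]

lemma starV_starV (x : M.VS) : M.starV (M.starV x) = x := by
  obtain ⟨X, rfl⟩ := M.projS_surjective x
  rw [starV_projS, starV_projS, starT_starT]

/-- Symmetry of `A_σ` shows that the value does not depend on the representatives chosen by `sec`.
-/
lemma gWedge_projS (X Y : Sg ⊗[ℂ] Tens d) :
    M.gWedge (M.projS X) (M.projS Y) = M.gTens X (onTens Sg (antisym M.sigma) Y) := by
  have e : M.gWedge (M.projS X) (M.projS Y) =
    M.gTens ((sec Q).lTensor Sg (M.projS X)) (M.real.lTensor Sg (M.projS Y)) := rfl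
  have e2 : onTens Sg (antisym M.sigma) ((sec Q).lTensor Sg (M.projS X)) =
      M.real.lTensor Sg (M.projS X) := by
    rw [real, LinearMap.lTensor_comp]
    rfl
  rw [e, real_projS, ← gTens_antisym, e2, real_projS, gTens_antisym]

/-- The adjointness on tensors descends: `A_σ` is shifted to the first argument, where it commutes
with the involution and is compatible with the contraction by `contrT_antisym`. -/
lemma gWedge_starV_iota (n : Fin d) (ϑ η : M.VS) :
    M.gWedge (M.starV ϑ) (M.lmulE (Q.thetaStar n) η) = M.gWedge (M.starV (M.iota n ϑ)) η := by
  obtain ⟨X, rfl⟩ := M.projS_surjective ϑ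
  obtain ⟨Y, rfl⟩ := M.projS_surjective η
  have e : Q.thetaStar n = Q.proj (Q.tensStarGen n) := by
    simp [CoordForms.thetaStar, CoordForms.tensStarGen, CoordForms.theta]
  rw [e, lmulE_proj_projS, iota_projS, starV_projS, starV_projS, gWedge_projS, gWedge_projS,
    ← gTens_antisym, ← starT_antisym, ← gTens_starT_contrT, contrT_antisym, starT_antisym,
    gTens_antisym]

/-- For a representative `X`, the tensor `A_σ X` is orthogonal to everything, hence zero, and it
determines the class of `X`. -/
lemma eq_zero_of_gWedge (x : M.VS) (h : ∀ y, M.gWedge x y = 0) : x = 0 := by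
  obtain ⟨X, rfl⟩ := M.projS_surjective x
  rw [← retr_antisym, M.eq_zero_of_gTens (onTens Sg (antisym M.sigma) X) fun Y => ?_, map_zero]
  rw [gTens_antisym, ← gWedge_projS]
  exact h _

end BraidedMetric

end Wedge

end QRiem

namespace QRiem

/-! ### The right `𝒜`-module structures on `𝕍^∧` and `𝕍_Σ^∧` -/

section Module

variable {A : Type*} [Ring A] [StarRing A] [HopfAlgebra ℂ A] [StarModule ℂ A] {d : ℕ}

namespace CoordForms

variable (Q : CoordForms A d)

lemma ext_induction {p : Q.Ext → Prop} (one : p 1) (theta : ∀ i, p (Q.theta i))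
    (mul : ∀ x y, p x → p y → p (x * y)) (add : ∀ x y, p x → p y → p (x + y))
    (smul : ∀ (c : ℂ) x, p x → p (c • x)) (x : Q.Ext) : p x := by
  obtain ⟨t, rfl⟩ := Q.proj_surjective x
  induction t using FreeAlgebra.induction with
  | grade0 c => rw [AlgHom.commutes, Algebra.algebraMap_eq_smul_one]; exact smul c 1 one
  | grade1 i => exact theta i
  | mul a b ha hb => rw [map_mul]; exact mul _ _ ha hb
  | add a b ha hb => rw [map_add]; exact add _ _ ha hb

lemma circ_theta (i : Fin d) (a : A) : Q.circ (Q.theta i) a = ∑ j, Q.nu i j a • Q.theta j := by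
  have e : Q.circ (Q.theta i) = (Q.circHom (Q.theta i)).ofConv := rfl
  rw [e, circHom, extLift_theta, WithConv.ofConv_toConv, LinearMap.sum_apply]
  rfl

lemma circ_mul_left (x y : Q.Ext) (a : A) : Q.circ (x * y) a =
    LinearMap.mul' ℂ Q.Ext (TensorProduct.map (Q.circ x) (Q.circ y) (Coalgebra.comul a)) := by
  have e : Q.circ (x * y) = (Q.circHom x * Q.circHom y).ofConv := by rw [← map_mul]; rfl
  rw [e]
  exact LinearMap.convMul_apply _ _ _

lemma circ_one_left (a : A) : Q.circ 1 a = Coalgebra.counit (R := ℂ) a • 1 := by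
  have e : Q.circ 1 = (1 : WithConv (A →ₗ[ℂ] Q.Ext)).ofConv := by
    rw [← map_one Q.circHom]; rfl
  rw [e]
  exact (LinearMap.convOne_apply _).trans (Algebra.algebraMap_eq_smul_one _)

lemma nu_one (i j : Fin d) : Q.nu i j 1 = if i = j then 1 else 0 := by
  simp [nu, Matrix.one_apply]

lemma nu_mul (i j : Fin d) (a b : A) : Q.nu i j (a * b) = ∑ k, Q.nu i k a * Q.nu k j b := by
  simp [nu, Matrix.mul_apply]

lemma circ_one (x : Q.Ext) : Q.circ x 1 = x := by
  induction x using Q.ext_induction with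
  | one => simp [circ_one_left]
  | theta i => simp [circ_theta, nu_one]
  | mul x y hx hy =>
    rw [circ_mul_left, Bialgebra.comul_one, Algebra.TensorProduct.one_def,
      TensorProduct.map_tmul, hx, hy, LinearMap.mul'_apply]
  | add x y hx hy => rw [map_add, LinearMap.add_apply, hx, hy]
  | smul c x hx => rw [map_smul, LinearMap.smul_apply, hx]

lemma circ_mul (x : Q.Ext) (a b : A) : Q.circ x (a * b) = Q.circ (Q.circ x a) b := by
  induction x using Q.ext_induction generalizing a b with
  | one => simp [circ_one_left, smul_smul]
  | theta i =>
    simp only [circ_theta, nu_mul, map_sum, map_smul, LinearMap.sum_apply, LinearMap.smul_apply,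
      Finset.smul_sum, Finset.sum_smul, smul_smul]
    exact Finset.sum_comm
  | mul x y hx hy =>
    -- The module laws for `x` and `y`, leg by leg on `𝒜 ⊗ 𝒜`. Together with multiplicativity of the
    -- coproduct they give the law for `x * y`.
    have h : ∀ s t : A ⊗[ℂ] A,
        LinearMap.mul' ℂ Q.Ext (TensorProduct.map (Q.circ x) (Q.circ y) (s * t)) =
          LinearMap.mul' ℂ Q.Ext (TensorProduct.lift ((TensorProduct.mapBilinear (RingHom.id ℂ) A A Q.Ext Q.Ext).compl₁₂
            (Q.circ ∘ₗ Q.circ x) (Q.circ ∘ₗ Q.circ y)) s t) := by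
      intro s t
      induction s with
      | zero => simp
      | add s s' h h' => rw [add_mul, map_add, map_add, map_add, h, h', LinearMap.add_apply, map_add]
      | tmul a a' =>
        induction t with
        | zero => simp
        | add t t' h h' => rw [mul_add, map_add, map_add, map_add, h, h', map_add]
        | tmul b b' =>
          rw [Algebra.TensorProduct.tmul_mul_tmul, TensorProduct.map_tmul, hx, hy]
          rfl
    rw [circ_mul_left, circ_mul_left, Bialgebra.comul_mul, h]
    generalize Coalgebra.comul (R := ℂ) a = s
    induction s with
    | zero => simp
    | add s s' h h' => simp only [map_add, LinearMap.add_apply, h, h']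
    | tmul a a' =>
      rw [TensorProduct.map_tmul, LinearMap.mul'_apply, circ_mul_left]
      rfl
  | add x y hx hy => simp only [map_add, LinearMap.add_apply, hx, hy]
  | smul c x hx => simp only [map_smul, LinearMap.smul_apply, hx]

end CoordForms

variable {Q : CoordForms A d} {Sg : Type*} [Ring Sg] [StarRing Sg] [Algebra ℂ Sg]
  [StarModule ℂ Sg]

namespace BraidedMetric

variable (M : BraidedMetric Q Sg)

lemma circV_tmul (q : Sg) (η : Q.Ext) (a : A) : M.circV (q ⊗ₜ η) a =
    TensorProduct.map (M.circS q) (Q.circ η) (Coalgebra.comul a) := rfl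

lemma circV_one (x : M.VS) : M.circV x 1 = x := by
  induction x using TensorProduct.induction_on with
  | zero => simp
  | add x y hx hy => rw [map_add, LinearMap.add_apply, hx, hy]
  | tmul q η =>
    rw [circV_tmul, Bialgebra.comul_one, Algebra.TensorProduct.one_def, TensorProduct.map_tmul,
      M.circS_one, Q.circ_one]

lemma circV_mul (x : M.VS) (a b : A) : M.circV x (a * b) = M.circV (M.circV x a) b := by
  induction x using TensorProduct.induction_on with
  | zero => simp
  | add x y hx hy => simp only [map_add, LinearMap.add_apply, hx, hy]
  | tmul q η =>
    rw [circV_tmul, circV_tmul, Bialgebra.comul_mul]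
    generalize Coalgebra.comul (R := ℂ) a = s
    induction s with
    | zero => simp
    | add s s' h h' => simp only [add_mul, map_add, LinearMap.add_apply, h, h']
    | tmul a a' =>
      rw [TensorProduct.map_tmul, circV_tmul]
      generalize Coalgebra.comul (R := ℂ) b = t
      induction t with
      | zero => simp
      | add t t' h h' => simp only [mul_add, map_add, h, h']
      | tmul b b' =>
        rw [Algebra.TensorProduct.tmul_mul_tmul, TensorProduct.map_tmul, TensorProduct.map_tmul,
          M.circS_mul, Q.circ_mul]

end BraidedMetric

end Module

/-! ### Matrix identities for `ϰ`, its conjugate and its dual -/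

section Rep

variable {A : Type*} [Ring A] [StarRing A] [HopfAlgebra ℂ A] [StarModule ℂ A] {d : ℕ}

lemma transpose_map_mul (S : Matrix (Fin d) (Fin d) ℂ) (Y : Matrix (Fin d) (Fin d) A) :
    (S.map (algebraMap ℂ A) * Y)ᵀ = Yᵀ * Sᵀ.map (algebraMap ℂ A) := by
  ext i j
  simp only [Matrix.transpose_apply, Matrix.mul_apply, Matrix.map_apply, Algebra.commutes]

lemma transpose_mul_map (S : Matrix (Fin d) (Fin d) ℂ) (Y : Matrix (Fin d) (Fin d) A) :
    (Y * S.map (algebraMap ℂ A))ᵀ = Sᵀ.map (algebraMap ℂ A) * Yᵀ := by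
  ext i j
  simp only [Matrix.transpose_apply, Matrix.mul_apply, Matrix.map_apply, Algebra.commutes]

namespace CoordForms

variable (Q : CoordForms A d)

/-- `C^{1/2}` as a matrix over `𝒜`. -/
def matE : Matrix (Fin d) (Fin d) A := Q.cHalf.map (algebraMap ℂ A)

/-- `C^{-1/2}` as a matrix over `𝒜`. -/
def matEt : Matrix (Fin d) (Fin d) A := Q.cHalfᵀ.map (algebraMap ℂ A)

lemma matE_mul_matEt : Q.matE * Q.matEt = 1 := by
  rw [matE, matEt, ← Matrix.map_mul, Q.cHalf_mul_transpose]
  simp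

lemma matEt_mul_matE : Q.matEt * Q.matE = 1 := by
  rw [matE, matEt, ← Matrix.map_mul, Q.cHalf_transpose_mul]
  simp

/-- `C^{-1/2} ϰ C^{1/2}`, the inverse of the transpose of `ϰ`. -/
def repDual : Matrix (Fin d) (Fin d) A := Q.matEt * Q.rep * Q.matE

lemma rep_map_star_transpose_mul : (Q.rep.map star)ᵀ * Q.rep = 1 := (Unitary.mem_iff.1 Q.rep_unitary).1

lemma rep_mul_map_star_transpose : Q.rep * (Q.rep.map star)ᵀ = 1 := (Unitary.mem_iff.1 Q.rep_unitary).2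

lemma rep_transpose_mul_matEt : Q.repᵀ * Q.matEt = Q.matEt * (Q.rep.map star)ᵀ := by
  have h := congrArg Matrix.transpose Q.rep_star
  rwa [transpose_map_mul, transpose_mul_map] at h

lemma matE_mul_rep_transpose : Q.matE * Q.repᵀ = (Q.rep.map star)ᵀ * Q.matE := by
  calc Q.matE * Q.repᵀ = Q.matE * (Q.repᵀ * Q.matEt) * Q.matE := by
        rw [mul_assoc, mul_assoc, Q.matEt_mul_matE, mul_one]
    _ = _ := by rw [rep_transpose_mul_matEt, ← mul_assoc, Q.matE_mul_matEt, one_mul]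

lemma rep_transpose_mul_repDual : Q.repᵀ * Q.repDual = 1 := by
  rw [repDual, mul_assoc, ← mul_assoc, rep_transpose_mul_matEt, mul_assoc,
    ← mul_assoc (Q.rep.map star)ᵀ, rep_map_star_transpose_mul, one_mul, matEt_mul_matE]

lemma repDual_mul_rep_transpose : Q.repDual * Q.repᵀ = 1 := by
  rw [repDual, mul_assoc, matE_mul_rep_transpose, mul_assoc, ← mul_assoc Q.rep,
    rep_mul_map_star_transpose, one_mul, matEt_mul_matE]

/-- Invariance of `C`: it is what makes the divergence of a covariant family a function on the base.
-/
lemma rep_mul_repDual_transpose :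
    Q.rep * (Q.matE * Q.matE) * Q.repDualᵀ = Q.matE * Q.matE := by
  have h : Q.repDualᵀ = Q.matEt * Q.repᵀ * Q.matE := by
    rw [repDual, matE, transpose_mul_map, matEt, transpose_map_mul, Matrix.transpose_transpose,
      mul_assoc]
  rw [h, mul_assoc, mul_assoc, mul_assoc, ← mul_assoc Q.matE Q.matEt, matE_mul_matEt, one_mul,
    ← mul_assoc Q.matE, matE_mul_rep_transpose, mul_assoc, ← mul_assoc,
    rep_mul_map_star_transpose, one_mul]

/-- `C` intertwines the conjugate of `ϰ`, against which elements are averaged, with the dual of `ϰ`,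
by which the `∂_i` transform. -/
lemma matEt_mul_map_star : Q.matEt * Q.matEt * Q.rep.map star = Q.repDual * (Q.matEt * Q.matEt) := by
  have h : Q.matEt * Q.rep.map star = Q.rep * Q.matEt := by
    have h := Q.rep_star
    change Q.matE * Q.rep = Q.rep.map star * Q.matE at h
    calc _ = Q.matEt * (Q.rep.map star * Q.matE) * Q.matEt := by
          rw [mul_assoc, mul_assoc, Q.matE_mul_matEt, mul_one]
      _ = _ := by rw [← h, ← mul_assoc, Q.matEt_mul_matE, one_mul]
  rw [mul_assoc, h, repDual, mul_assoc, mul_assoc, ← mul_assoc Q.matE, matE_mul_matEt, one_mul]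

end CoordForms

end Rep

end QRiem

namespace QRiem

/-! ### Horizontal forms in coordinates -/

section BundleForms

variable {A : Type*} [Ring A] [StarRing A] [HopfAlgebra ℂ A] [StarModule ℂ A] {d : ℕ}
  {B : Type*} [Ring B] [StarRing B] [Algebra ℂ B] [StarModule ℂ B]

namespace QPB

variable (P : QPB A B)

section Crossed

variable {W : Type*} [AddCommGroup W] [Module ℂ W]

lemma crossMul_tmul (mulW : W →ₗ[ℂ] W →ₗ[ℂ] W) (circW : W →ₗ[ℂ] A →ₗ[ℂ] W) (q b : B) (ϑ η : W) :
    P.crossMul mulW circW (q ⊗ₜ ϑ) (b ⊗ₜ η) =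
      TensorProduct.map (LinearMap.mulLeft ℂ q) (mulW.flip η ∘ₗ circW ϑ) (P.F b) := by
  have e : P.crossMul mulW circW (q ⊗ₜ ϑ) (b ⊗ₜ η) =
      TensorProduct.map (LinearMap.mul ℂ B q)
        (TensorProduct.lift (mulW ∘ₗ circW ϑ)) (TensorProduct.assoc ℂ B A W (P.F b ⊗ₜ η)) := rfl
  rw [e]
  generalize P.F b = x
  induction x with
  | zero => simp
  | add x y hx hy => rw [TensorProduct.add_tmul, map_add, map_add, map_add, hx, hy]
  | tmul b c => simp

lemma crossStar_tmul (starW : W →ₗ⋆[ℂ] W) (circW : W →ₗ[ℂ] A →ₗ[ℂ] W) (b : B) (ϑ : W) :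
    P.crossStar starW circW (b ⊗ₜ ϑ) = (circW (starW ϑ)).lTensor B (P.F (star b)) := by
  rw [map_star]
  rfl

/-- `(b ⊗ ϑ)^* (q ⊗ η)` depends only on `b^* q`. -/
lemma crossMul_crossStar (starW : W →ₗ⋆[ℂ] W) (circW : W →ₗ[ℂ] A →ₗ[ℂ] W)
    (circ_mul : ∀ x a b, circW x (a * b) = circW (circW x a) b)
    (mulW : W →ₗ[ℂ] W →ₗ[ℂ] W) (b q : B) (ϑ η : W) :
    P.crossMul mulW circW (P.crossStar starW circW (b ⊗ₜ ϑ)) (q ⊗ₜ η) =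
      (mulW.flip η ∘ₗ circW (starW ϑ)).lTensor B (P.F (star b * q)) := by
  rw [crossStar_tmul, map_mul]
  generalize P.F (star b) = x
  induction x with
  | zero => simp
  | add x y hx hy => simp only [map_add, add_mul, LinearMap.add_apply, hx, hy]
  | tmul b c =>
    rw [LinearMap.lTensor_tmul, crossMul_tmul]
    generalize P.F q = y
    induction y with
    | zero => simp
    | add x y hx hy => simp only [map_add, mul_add, hx, hy]
    | tmul q c' =>
      rw [Algebra.TensorProduct.tmul_mul_tmul, LinearMap.lTensor_tmul, TensorProduct.map_tmul,
        LinearMap.comp_apply, LinearMap.comp_apply, circ_mul]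
      rfl

end Crossed

variable (Q : CoordForms A d)

lemma horMul_tmul (q b : B) (ϑ η : Q.Ext) : P.horMul Q (q ⊗ₜ ϑ) (b ⊗ₜ η) =
    TensorProduct.map (LinearMap.mulLeft ℂ q) (LinearMap.mulRight ℂ η ∘ₗ Q.circ ϑ) (P.F b) :=
  P.crossMul_tmul _ _ _ _ _ _

lemma map_circ_one (f : B →ₗ[ℂ] B) (η : Q.Ext) (b : B) :
    TensorProduct.map f (LinearMap.mulRight ℂ η ∘ₗ Q.circ 1) (P.F b) = f b ⊗ₜ η := by
  conv_rhs => rw [← P.counit b]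
  generalize P.F b = x
  induction x with
  | zero => simp
  | add x y hx hy => rw [map_add, map_add, map_add, map_add, TensorProduct.add_tmul, hx, hy]
  | tmul b c =>
    simp [Q.circ_one_left, TensorProduct.smul_tmul']

lemma horMul_one_left (q b : B) (η : Q.Ext) :
    P.horMul Q (q ⊗ₜ 1) (b ⊗ₜ η) = (q * b) ⊗ₜ η := by
  rw [horMul_tmul, map_circ_one, LinearMap.mulLeft_apply]

lemma horMul_one_right (q : B) (ϑ η : Q.Ext) :
    P.horMul Q (q ⊗ₜ ϑ) (1 ⊗ₜ η) = q ⊗ₜ (ϑ * η) := by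
  rw [horMul_tmul, map_one, Algebra.TensorProduct.one_def, TensorProduct.map_tmul]
  simp [Q.circ_one]

/-- The operator `b ↦ ∑_k ν_{ij}(c_k) b_k`, where `F(b) = ∑_k b_k ⊗ c_k`. -/
def twist (i j : Fin d) : B →ₗ[ℂ] B :=
  (TensorProduct.rid ℂ B).toLinearMap ∘ₗ (Q.nu i j).lTensor B ∘ₗ P.Flin

lemma twist_apply (i j : Fin d) (b : B) :
    P.twist Q i j b = TensorProduct.rid ℂ B ((Q.nu i j).lTensor B (P.F b)) := rfl

lemma twist_mul (i j : Fin d) (b q : B) :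
    P.twist Q i j (b * q) = ∑ k, P.twist Q i k b * P.twist Q k j q := by
  simp only [twist_apply, map_mul]
  generalize P.F b = x
  generalize P.F q = y
  induction x with
  | zero => simp
  | add x x' h h' => simp only [add_mul, map_add, h, h', Finset.sum_add_distrib]
  | tmul b c =>
    induction y with
    | zero => simp
    | add x x' h h' => simp only [mul_add, map_add, h, h', Finset.sum_add_distrib]
    | tmul q c' =>
      simp [Q.nu_mul, Finset.sum_smul, smul_smul, mul_comm]

lemma horMul_theta (q b : B) (i : Fin d) (η : Q.Ext) :
    P.horMul Q (q ⊗ₜ Q.theta i) (b ⊗ₜ η) = ∑ j, (q * P.twist Q i j b) ⊗ₜ (Q.theta j * η) := by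
  rw [horMul_tmul]
  simp only [twist_apply]
  generalize P.F b = x
  induction x with
  | zero => simp
  | add x x' h h' => simp only [mul_add, map_add, h, h', TensorProduct.add_tmul, Finset.sum_add_distrib]
  | tmul b c =>
    simp only [TensorProduct.map_tmul, LinearMap.comp_apply, Q.circ_theta, map_sum, map_smul,
      LinearMap.mulRight_apply, LinearMap.mulLeft_apply, TensorProduct.tmul_sum,
      TensorProduct.tmul_smul, LinearMap.lTensor_tmul, TensorProduct.rid_tmul, mul_smul_comm]
    rfl

lemma lTensor_circ_theta (b : B) (i : Fin d) :
    (Q.circ (Q.theta i)).lTensor B (P.F b) = ∑ j, P.twist Q i j b ⊗ₜ Q.theta j := by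
  have h := P.horMul_theta Q 1 b i 1
  rw [horMul_tmul] at h
  simp only [one_mul, mul_one] at h
  rw [← h]
  congr 1
  rw [LinearMap.lTensor]
  congr 1
  · exact LinearMap.ext fun x => by simp
  · exact LinearMap.ext fun x => by simp

lemma crossStar_one (b : B) : P.crossStar Q.starExt Q.circ (b ⊗ₜ 1) = star b ⊗ₜ 1 := by
  have h1 : Q.starExt 1 = 1 := by
    rw [← map_one Q.proj, Q.starHom_proj, Q.tensStar_one]
  rw [crossStar_tmul, h1]
  have h := P.map_circ_one Q LinearMap.id 1 (star b)
  rw [LinearMap.id_apply] at h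
  rw [← h, LinearMap.lTensor]
  congr 2
  exact LinearMap.ext fun x => by simp

lemma starExt_theta (i : Fin d) : Q.starExt (Q.theta i) = Q.thetaStar i := by
  rw [CoordForms.theta, Q.starHom_proj, Q.tensStar_ι]
  simp [CoordForms.tensStarGen, CoordForms.thetaStar, CoordForms.theta]

lemma crossStar_theta (b : B) (i : Fin d) : P.crossStar Q.starExt Q.circ (b ⊗ₜ Q.theta i) =
    ∑ l, ∑ j, (Q.cHalf⁻¹ l i • P.twist Q l j (star b)) ⊗ₜ Q.theta j := by
  have e : ∀ y, (Q.circ y).lTensor B (P.F (star b)) =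
    (LinearMap.lTensorHom B ∘ₗ Q.circ).flip (P.F (star b)) y := fun _ => rfl
  rw [crossStar_tmul, starExt_theta, CoordForms.thetaStar, e, map_sum]
  refine Finset.sum_congr rfl fun l _ => ?_
  rw [map_smul, ← e, lTensor_circ_theta, Finset.smul_sum]
  simp only [TensorProduct.smul_tmul']

end QPB

/-! ### Coordinate vector fields: Leibniz rule, hermiticity, covariance -/

namespace FrameStructure

variable {P : QPB A B} {Q : CoordForms A d} (N : FrameStructure P Q) {Sg : Type*} [Ring Sg]
  [StarRing Sg] [Algebra ℂ Sg] [StarModule ℂ Sg] (M : BraidedMetric Q Sg)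

lemma mem_horDeg_zero (b : B) : b ⊗ₜ[ℂ] (1 : Q.Ext) ∈ P.horDeg Q 0 :=
  Submodule.subset_span ⟨b, 1, by
    rw [CoordForms.extDeg, pow_zero]; exact Submodule.one_le.1 le_rfl, rfl⟩

/-- `A_σ` is the identity in degree one, so the `θ_i` stay independent in `𝕍^∧` and coefficients of
one-forms can be compared. -/
lemma real_theta (i : Fin d) : M.real (Q.theta i) = FreeAlgebra.ι ℂ i := by
  rw [CoordForms.theta, M.real_proj, antisym_eq_antisymUp M.sigma 0 _ (ι_mem_homTens i)]
  rfl

lemma wordCoeff_ι (i j : Fin d) : wordCoeff [i] (FreeAlgebra.ι ℂ j) = if j = i then (1 : ℂ) else 0 := by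
  have : FreeAlgebra.ι ℂ j = word [j] := by simp [word_cons]
  rw [this, wordCoeff, onWords_word]
  simp

/-- The coefficient of `θ_i` in a horizontal form. -/
def thetaCoeff (i : Fin d) : P.Hor Q →ₗ[ℂ] B :=
  (TensorProduct.rid ℂ B).toLinearMap ∘ₗ (wordCoeff [i] ∘ₗ M.real).lTensor B

lemma thetaCoeff_tmul_theta (i j : Fin d) (b : B) :
    thetaCoeff (P := P) M i (b ⊗ₜ Q.theta j) = if j = i then b else 0 := by
  have e : thetaCoeff (P := P) M i (b ⊗ₜ Q.theta j) = wordCoeff [i] (M.real (Q.theta j)) • b := by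
    simp [thetaCoeff]
  rw [e, real_theta, wordCoeff_ι]
  split_ifs <;> simp

lemma eq_sum_of_mem_horDeg_one {φ : P.Hor Q} (h : φ ∈ P.horDeg Q 1) :
    φ = ∑ i, thetaCoeff (P := P) M i φ ⊗ₜ Q.theta i := by
  have key : P.horDeg Q 1 ≤ LinearMap.eqLocus LinearMap.id
      (∑ i, (TensorProduct.mk ℂ B Q.Ext).flip (Q.theta i) ∘ₗ thetaCoeff (P := P) M i) := by
    refine Submodule.span_le.2 ?_
    rintro _ ⟨b, η, hη, rfl⟩
    rw [CoordForms.extDeg, pow_one] at hη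
    have h2 : Submodule.span ℂ (Set.range Q.theta) ≤
        (LinearMap.eqLocus LinearMap.id (∑ i, (TensorProduct.mk ℂ B Q.Ext).flip (Q.theta i) ∘ₗ
          thetaCoeff (P := P) M i)).comap (TensorProduct.mk ℂ B Q.Ext b) := by
      refine Submodule.span_le.2 ?_
      rintro _ ⟨j, rfl⟩
      change b ⊗ₜ Q.theta j = _
      simp [LinearMap.sum_apply, thetaCoeff_tmul_theta, TensorProduct.ite_tmul]
    exact h2 hη
  have := key h
  simpa [LinearMap.sum_apply] using this

lemma nabla_tmul_one (b : B) :
    N.nabla (b ⊗ₜ 1) = ∑ i, N.partialD M i b ⊗ₜ Q.theta i :=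
  eq_sum_of_mem_horDeg_one M (N.nabla_deg 0 _ (mem_horDeg_zero b))

lemma sum_theta_injective (P : QPB A B) (M : BraidedMetric Q Sg) {f h : Fin d → B}
    (e : ∑ i, f i ⊗ₜ[ℂ] Q.theta i = ∑ i, h i ⊗ₜ[ℂ] Q.theta i) : f = h := by
  ext j
  have := congrArg (thetaCoeff (P := P) M j) e
  simpa [map_sum, thetaCoeff_tmul_theta] using this

lemma partialD_mul (j : Fin d) (b q : B) : N.partialD M j (b * q) =
    b * N.partialD M j q + ∑ i, N.partialD M i b * P.twist Q i j q := by
  have h := N.leibniz 0 _ (mem_horDeg_zero b) (q ⊗ₜ 1)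
  rw [pow_zero, one_smul, P.horMul_one_left, nabla_tmul_one N M, nabla_tmul_one N M,
    nabla_tmul_one N M, map_sum, map_sum, LinearMap.sum_apply] at h
  simp only [P.horMul_theta, P.horMul_one_left, mul_one] at h
  rw [Finset.sum_comm] at h
  simp only [← TensorProduct.sum_tmul] at h
  rw [← Finset.sum_add_distrib] at h
  simp only [← TensorProduct.add_tmul] at h
  rw [congrFun (sum_theta_injective P M h) j, add_comm]

lemma partialD_star (j : Fin d) (b : B) : N.partialD M j (star b) =
    ∑ i, ∑ l, Q.cHalf⁻¹ l i • P.twist Q l j (star (N.partialD M i b)) := by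
  have h := N.hermitian 0 _ (mem_horDeg_zero b)
  -- The signs `(-1)^(n(n-1)/2)` of the graded involution are trivial in degrees `0` and `1`.
  simp only [QPB.horStar, Nat.zero_mul, Nat.zero_div, pow_zero, one_smul, zero_add, Nat.sub_self,
    Nat.mul_zero, P.crossStar_one] at h
  rw [nabla_tmul_one N M, nabla_tmul_one N M, map_sum] at h
  simp only [P.crossStar_theta] at h
  have e : ∀ i, ∑ l, ∑ j, (Q.cHalf⁻¹ l i • P.twist Q l j (star (N.partialD M i b))) ⊗ₜ[ℂ]
      Q.theta j = ∑ j, (∑ l, Q.cHalf⁻¹ l i • P.twist Q l j (star (N.partialD M i b))) ⊗ₜ[ℂ]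
      Q.theta j := fun i => by
    rw [Finset.sum_comm]
    simp only [TensorProduct.sum_tmul]
  simp only [e] at h
  rw [Finset.sum_comm] at h
  simp only [← TensorProduct.sum_tmul] at h
  exact congrFun (sum_theta_injective P M h) j

/-- Covariance of the coordinate vector fields. -/
lemma F_partialD (i : Fin d) (b : B) : ∑ l, P.F (N.partialD M l b) * ((1 : B) ⊗ₜ Q.rep i l) =
    (N.partialD M i).rTensor A (P.F b) := by
  have h := N.covariant (b ⊗ₜ 1)
  have e1 : ∀ x : B ⊗[ℂ] A, N.nabla.rTensor A ((LinearMap.mul' ℂ A).lTensor (P.Hor Q)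
      (TensorProduct.tensorTensorTensorComm ℂ B A Q.Ext A (x ⊗ₜ 1))) =
      ∑ i, ((TensorProduct.mk ℂ B Q.Ext).flip (Q.theta i) ∘ₗ N.partialD M i).rTensor A x := by
    intro x
    induction x with
    | zero => simp
    | add x y hx hy =>
      simp only [TensorProduct.add_tmul, map_add, hx, hy, Finset.sum_add_distrib]
    | tmul b c =>
      rw [Algebra.TensorProduct.one_def, TensorProduct.tensorTensorTensorComm_tmul,
        LinearMap.lTensor_tmul, LinearMap.rTensor_tmul, nabla_tmul_one N M, LinearMap.mul'_apply,
        mul_one, TensorProduct.sum_tmul]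
      rfl
  have e2 : ∀ (x : B ⊗[ℂ] A) (l : Fin d), (LinearMap.mul' ℂ A).lTensor (P.Hor Q)
      (TensorProduct.tensorTensorTensorComm ℂ B A Q.Ext A (x ⊗ₜ Q.kap (Q.theta l))) =
      ∑ i, ((TensorProduct.mk ℂ B Q.Ext).flip (Q.theta i)).rTensor A
        (x * ((1 : B) ⊗ₜ Q.rep i l)) := by
    intro x l
    rw [CoordForms.kap, CoordForms.extLift_theta, TensorProduct.tmul_sum, map_sum, map_sum]
    refine Finset.sum_congr rfl fun i _ => ?_
    induction x with
    | zero => simp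
    | add x y hx hy => simp only [TensorProduct.add_tmul, map_add, add_mul, hx, hy]
    | tmul b c => simp
  have h1 : P.horF Q (b ⊗ₜ 1) = (LinearMap.mul' ℂ A).lTensor (P.Hor Q)
      (TensorProduct.tensorTensorTensorComm ℂ B A Q.Ext A (P.F b ⊗ₜ 1)) := by
    rw [← map_one Q.kap]
    rfl
  have h2 : ∀ (b : B) (l : Fin d), P.horF Q (b ⊗ₜ Q.theta l) =
      (LinearMap.mul' ℂ A).lTensor (P.Hor Q)
      (TensorProduct.tensorTensorTensorComm ℂ B A Q.Ext A (P.F b ⊗ₜ Q.kap (Q.theta l))) :=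
    fun b l => rfl
  rw [h1, e1, nabla_tmul_one N M, map_sum] at h
  simp only [h2, e2] at h
  have h3 := congrArg ((thetaCoeff (P := P) M i).rTensor A) h
  have e3 : ∀ (j : Fin d) (x : B ⊗[ℂ] A), (thetaCoeff (P := P) M i).rTensor A
      (((TensorProduct.mk ℂ B Q.Ext).flip (Q.theta j)).rTensor A x) = if j = i then x else 0 := by
    intro j x
    rw [← LinearMap.comp_apply, ← LinearMap.rTensor_comp]
    have : thetaCoeff (P := P) M i ∘ₗ (TensorProduct.mk ℂ B Q.Ext).flip (Q.theta j) =
        if j = i then LinearMap.id else 0 := by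
      ext b
      simp only [LinearMap.comp_apply, LinearMap.flip_apply, TensorProduct.mk_apply,
        thetaCoeff_tmul_theta]
      split_ifs <;> rfl
    rw [this]
    split_ifs
    · simp
    · simp
  simp only [map_sum, LinearMap.rTensor_comp, LinearMap.comp_apply, e3, Finset.sum_ite_eq',
    Finset.mem_univ, if_true] at h3
  exact h3

lemma sum_bCoef_partialD (i j : Fin d) :
    ∑ α, N.bCoef α i * N.partialD M j (N.fCoef α : B) = if i = j then 1 else 0 := by
  have h := congrArg (thetaCoeff (P := P) M j) (N.complete i)
  rw [thetaCoeff_tmul_theta, map_sum] at h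
  rw [h]
  refine Finset.sum_congr rfl fun α _ => ?_
  rw [nabla_tmul_one N M, map_sum, map_sum]
  simp [P.horMul_one_left, thetaCoeff_tmul_theta]

end FrameStructure

end BundleForms

end QRiem

namespace QRiem

/-! ### Vertical integration and Haar averages -/

section Integration

variable {A : Type*} [Ring A] [StarRing A] [HopfAlgebra ℂ A] [StarModule ℂ A] {d : ℕ}
  {B : Type*} [Ring B] [StarRing B] [Algebra ℂ B] [StarModule ℂ B]

namespace QPB

variable (P : QPB A B)

/-- `(id ⊗ f) F`. -/
def slice (f : A →ₗ[ℂ] ℂ) : B →ₗ[ℂ] B :=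
  (TensorProduct.rid ℂ B).toLinearMap ∘ₗ f.lTensor B ∘ₗ P.Flin

lemma slice_apply (f : A →ₗ[ℂ] ℂ) (b : B) :
    P.slice f b = TensorProduct.rid ℂ B (f.lTensor B (P.F b)) := rfl

lemma F_slice (f : A →ₗ[ℂ] ℂ) (b : B) : P.F (P.slice f b) =
    ((TensorProduct.rid ℂ A).toLinearMap ∘ₗ f.lTensor A ∘ₗ Coalgebra.comul).lTensor B (P.F b) := by
  have h1 : ∀ x : B ⊗[ℂ] A, P.F (TensorProduct.rid ℂ B (f.lTensor B x)) =
      TensorProduct.rid ℂ (B ⊗[ℂ] A) (f.lTensor (B ⊗[ℂ] A) (P.Flin.rTensor A x)) := by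
    intro x
    induction x with
    | zero => simp
    | add x y hx hy => simp only [map_add, hx, hy]
    | tmul x y => simp
  have h2 : ∀ (x : B) (y : A ⊗[ℂ] A), TensorProduct.rid ℂ (B ⊗[ℂ] A) (f.lTensor (B ⊗[ℂ] A)
      ((TensorProduct.assoc ℂ B A A).symm (x ⊗ₜ[ℂ] y))) =
      x ⊗ₜ[ℂ] TensorProduct.rid ℂ A (f.lTensor A y) := by
    intro x y
    induction y with
    | zero => simp
    | add y z hy hz => simp only [map_add, TensorProduct.tmul_add, hy, hz]
    | tmul y z => simp
  have h3 : ∀ x : B ⊗[ℂ] A, TensorProduct.rid ℂ (B ⊗[ℂ] A) (f.lTensor (B ⊗[ℂ] A)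
      ((TensorProduct.assoc ℂ B A A).symm
        ((Coalgebra.comul (R := ℂ) (A := A)).lTensor B x))) =
      ((TensorProduct.rid ℂ A).toLinearMap ∘ₗ f.lTensor A ∘ₗ Coalgebra.comul).lTensor B x := by
    intro x
    induction x with
    | zero => simp
    | add x y hx hy => simp only [map_add, hx, hy]
    | tmul x y =>
      rw [LinearMap.lTensor_tmul, h2]
      rfl
  have h4 := h3 (P.F b)
  rw [← P.coassoc b, LinearEquiv.symm_apply_apply] at h4
  exact (h1 _).trans h4

lemma vert_eq_slice (H : CompactQG A) : P.vert H = P.slice H.haar := rfl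

lemma vert_base (H : CompactQG A) (v : P.base) : P.vert H (v : B) = v := by
  rw [vert_eq_slice, slice_apply, (P.mem_base v).1 v.2]
  simp [H.haar_one]

/-- Invariance of the integral under the action, the counterpart of `vert_mem`: there Haar
integration acts on the last leg of the coproduct, here on the first. -/
lemma vert_rTensor (H : CompactQG A) (b : B) :
    (P.vert H).rTensor A (P.F b) = P.vert H b ⊗ₜ 1 := by
  have h1 : ∀ x : B ⊗[ℂ] A, (P.vert H).rTensor A x =
      ((TensorProduct.rid ℂ B).toLinearMap ∘ₗ H.haar.lTensor B).rTensor A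
        (P.Flin.rTensor A x) := by
    intro x
    rw [vert, ← LinearMap.comp_assoc, LinearMap.rTensor_comp]
    rfl
  have h2 : ∀ (x : B) (y : A ⊗[ℂ] A),
      ((TensorProduct.rid ℂ B).toLinearMap ∘ₗ H.haar.lTensor B).rTensor A
        ((TensorProduct.assoc ℂ B A A).symm (x ⊗ₜ[ℂ] y)) =
      x ⊗ₜ[ℂ] TensorProduct.lid ℂ A (H.haar.rTensor A y) := by
    intro x y
    induction y with
    | zero => simp
    | add y z hy hz => simp only [map_add, TensorProduct.tmul_add, hy, hz]
    | tmul y z => simp [TensorProduct.smul_tmul]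
  have h3 : ∀ x : B ⊗[ℂ] A, ((TensorProduct.rid ℂ B).toLinearMap ∘ₗ H.haar.lTensor B).rTensor A
      ((TensorProduct.assoc ℂ B A A).symm
        ((Coalgebra.comul (R := ℂ) (A := A)).lTensor B x)) =
      TensorProduct.rid ℂ B (H.haar.lTensor B x) ⊗ₜ[ℂ] 1 := by
    intro x
    induction x with
    | zero => simp
    | add x y hx hy => simp only [map_add, TensorProduct.add_tmul, hx, hy]
    | tmul x y =>
      rw [LinearMap.lTensor_tmul, h2, H.haar_right]
      simp [TensorProduct.smul_tmul']
  rw [h1, ← (TensorProduct.assoc ℂ B A A).symm_apply_apply (P.Flin.rTensor A (P.F b))]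
  exact (congrArg _ (congrArg _ (P.coassoc b))).trans (h3 _)

/-- The family `β` transforms as the basis `θ_1, …, θ_d`. -/
def IsCovariant (Q : CoordForms A d) (β : Fin d → B) : Prop :=
  ∀ j, P.F (β j) = ∑ k, β k ⊗ₜ Q.rep k j

/-- The averages of `b` against the matrix elements of the conjugate of `ϰ`. -/
def average (H : CompactQG A) (b : B) : A →ₗ[ℂ] B :=
  (TensorProduct.rid ℂ B).toLinearMap ∘ₗ H.haar.lTensor B ∘ₗ LinearMap.mulLeft ℂ (P.F b) ∘ₗ
    TensorProduct.mk ℂ B A 1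

lemma average_apply (H : CompactQG A) (b : B) (y : A) :
    P.average H b y = TensorProduct.rid ℂ B (H.haar.lTensor B (P.F b * ((1 : B) ⊗ₜ y))) := rfl

lemma average_eq_slice (H : CompactQG A) (b : B) (y : A) :
    P.average H b y = P.slice (H.haar ∘ₗ LinearMap.mulRight ℂ y) b := by
  rw [average_apply, slice_apply]
  generalize P.F b = x
  induction x with
  | zero => simp
  | add x y hx hy => simp only [map_add, add_mul, hx, hy]
  | tmul b c => simp

variable (Q : CoordForms A d)

/-- Haar invariance, applied to the product with a matrix element of the conjugate of `ϰ`, expresses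
the averages through their images under `F`. Unitarity of `ϰ` solves this relation for `F`. -/
lemma isCovariant_average (H : CompactQG A) (b : B) (a : Fin d) :
    P.IsCovariant Q fun j => P.average H b (star (Q.rep j a)) := by
  have hcomul : ∀ j, Coalgebra.comul (R := ℂ) (star (Q.rep j a)) =
      ∑ s, star (Q.rep j s) ⊗ₜ[ℂ] star (Q.rep s a) := fun j => by
    rw [H.comul_star, Q.comul_rep, star_sum]
    simp only [TensorProduct.star_tmul]
  have h1 : ∀ j, ∑ s, P.F (P.average H b (star (Q.rep s a))) * ((1 : B) ⊗ₜ star (Q.rep j s)) =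
      P.average H b (star (Q.rep j a)) ⊗ₜ 1 := by
    intro j
    simp only [average_eq_slice, F_slice]
    simp only [slice_apply]
    generalize P.F b = x
    induction x with
    | zero => simp
    | add x y hx hy =>
      simp only [map_add, add_mul, Finset.sum_add_distrib, hx, hy, TensorProduct.add_tmul]
    | tmul b c =>
      have h := H.haar_left (c * star (Q.rep j a))
      rw [Bialgebra.comul_mul, hcomul, Finset.mul_sum, map_sum, map_sum] at h
      simp only [LinearMap.lTensor_tmul, Algebra.TensorProduct.tmul_mul_tmul, mul_one,
        LinearMap.comp_apply, LinearMap.mulRight_apply, TensorProduct.rid_tmul,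
        LinearEquiv.coe_coe, ← TensorProduct.tmul_sum]
      rw [← TensorProduct.smul_tmul', ← TensorProduct.tmul_smul, ← h]
      congr 1
      refine Finset.sum_congr rfl fun s _ => ?_
      generalize Coalgebra.comul (R := ℂ) c = t
      induction t with
      | zero => simp
      | add x y hx hy => simp only [map_add, add_mul, hx, hy]
      | tmul u v => simp
  intro t
  have h2 : ∀ s, ∑ j, star (Q.rep j s) * Q.rep j t = if s = t then 1 else 0 := fun s => by
    have h := congrFun (congrFun Q.rep_map_star_transpose_mul s) t
    rw [Matrix.mul_apply, Matrix.one_apply] at h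
    exact h
  have h3 : ∀ j, P.average H b (star (Q.rep j a)) ⊗ₜ[ℂ] Q.rep j t =
      ∑ s, P.F (P.average H b (star (Q.rep s a))) *
        ((1 : B) ⊗ₜ (star (Q.rep j s) * Q.rep j t)) := fun j => by
    have e : P.average H b (star (Q.rep j a)) ⊗ₜ[ℂ] Q.rep j t =
      (P.average H b (star (Q.rep j a)) ⊗ₜ[ℂ] (1 : A)) * ((1 : B) ⊗ₜ Q.rep j t) := by simp
    rw [e, ← h1, Finset.sum_mul]
    refine Finset.sum_congr rfl fun s _ => ?_
    rw [mul_assoc, Algebra.TensorProduct.tmul_mul_tmul, one_mul]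
  simp only [h3]
  rw [Finset.sum_comm]
  simp only [← Finset.mul_sum, ← TensorProduct.tmul_sum, h2]
  rw [Finset.sum_eq_single t]
  · rw [if_pos rfl, ← Algebra.TensorProduct.one_def, mul_one]
  · intro s _ hs
    rw [if_neg hs, TensorProduct.tmul_zero, mul_zero]
  · simp

end QPB

/-! ### Divergences of covariant families -/

namespace FrameStructure

variable {P : QPB A B} {Q : CoordForms A d} (N : FrameStructure P Q) {Sg : Type*} [Ring Sg]
  [StarRing Sg] [Algebra ℂ Sg] [StarModule ℂ Sg] (M : BraidedMetric Q Sg)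

lemma F_partialD_eq (p : Fin d) (b : B) : P.F (N.partialD M p b) =
    ∑ i, (N.partialD M i).rTensor A (P.F b) * ((1 : B) ⊗ₜ Q.repDual i p) := by
  have h2 : ∀ l, ∑ i, Q.rep i l * Q.repDual i p = if l = p then 1 else 0 := fun l => by
    have h := congrFun (congrFun Q.rep_transpose_mul_repDual l) p
    rw [Matrix.mul_apply, Matrix.one_apply] at h
    exact h
  simp only [← F_partialD N M, Finset.sum_mul, mul_assoc, Algebra.TensorProduct.tmul_mul_tmul,
    one_mul]
  rw [Finset.sum_comm]
  simp only [← Finset.mul_sum, ← TensorProduct.tmul_sum, h2]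
  rw [Finset.sum_eq_single p]
  · rw [if_pos rfl, ← Algebra.TensorProduct.one_def, mul_one]
  · intro s _ hs
    rw [if_neg hs, TensorProduct.tmul_zero, mul_zero]
  · simp

/-- The divergence `∑ C_{ji} ∂_i(β_j)`. -/
def divergence (β : Fin d → B) : B := ∑ i, ∑ j, (Q.cHalf * Q.cHalf) j i • N.partialD M i (β j)

lemma divergence_mem_base {β : Fin d → B} (hβ : P.IsCovariant Q β) :
    N.divergence M β ∈ P.base := by
  have h3 : ∀ k i, ∑ p, ∑ j, (Q.cHalf * Q.cHalf) j p • (Q.rep k j * Q.repDual i p) =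
      (Q.cHalf * Q.cHalf) k i • (1 : A) := fun k i => by
    have h := congrFun (congrFun Q.rep_mul_repDual_transpose k) i
    rw [CoordForms.matE, ← Matrix.map_mul, Matrix.mul_apply, Matrix.map_apply,
      Algebra.algebraMap_eq_smul_one] at h
    rw [← h]
    refine Finset.sum_congr rfl fun p _ => ?_
    rw [Matrix.mul_apply, Finset.sum_mul]
    refine Finset.sum_congr rfl fun j _ => ?_
    rw [Matrix.map_apply, Matrix.transpose_apply, ← Algebra.commutes, ← Algebra.smul_def,
      smul_mul_assoc]
  rw [QPB.mem_base, divergence, map_sum]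
  have e : ∀ p, P.F (∑ j, (Q.cHalf * Q.cHalf) j p • N.partialD M p (β j)) =
      ∑ i, ∑ k, N.partialD M i (β k) ⊗ₜ[ℂ]
        ∑ j, (Q.cHalf * Q.cHalf) j p • (Q.rep k j * Q.repDual i p) := fun p => by
    simp only [map_sum, map_smul, N.F_partialD_eq M p, hβ _, LinearMap.rTensor_tmul,
      Finset.sum_mul, Algebra.TensorProduct.tmul_mul_tmul, mul_one, TensorProduct.tmul_sum,
      TensorProduct.tmul_smul, Finset.smul_sum]
    rw [Finset.sum_comm]
    exact Finset.sum_congr rfl fun i _ => Finset.sum_comm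
  simp only [e]
  rw [Finset.sum_comm, TensorProduct.sum_tmul]
  refine Finset.sum_congr rfl fun i _ => ?_
  rw [Finset.sum_comm, TensorProduct.sum_tmul]
  refine Finset.sum_congr rfl fun k _ => ?_
  rw [← TensorProduct.tmul_sum, h3, TensorProduct.tmul_smul, TensorProduct.smul_tmul']

lemma sum_partialD_mem_base {β : Fin d → B} (hβ : P.IsCovariant Q β) (f : P.base) :
    ∑ i, N.partialD M i (f : B) * β i ∈ P.base := by
  have h2 : ∀ k l, ∑ i, Q.repDual k i * Q.rep l i = if k = l then 1 else 0 := fun k l => by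
    have h := congrFun (congrFun Q.repDual_mul_rep_transpose k) l
    rw [Matrix.mul_apply, Matrix.one_apply] at h
    exact h
  rw [QPB.mem_base, map_sum]
  have e : ∀ i, P.F (N.partialD M i (f : B) * β i) = ∑ k, ∑ l,
      (N.partialD M k (f : B) * β l) ⊗ₜ[ℂ] (Q.repDual k i * Q.rep l i) := fun i => by
    rw [map_mul, F_partialD_eq, hβ, (P.mem_base f).1 f.2, Finset.sum_mul_sum]
    simp
  simp only [e]
  rw [Finset.sum_comm, TensorProduct.sum_tmul]
  refine Finset.sum_congr rfl fun k _ => ?_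
  rw [Finset.sum_comm]
  simp only [← TensorProduct.tmul_sum, h2]
  rw [Finset.sum_eq_single k]
  · rw [if_pos rfl]
  · intro l _ hl
    rw [if_neg (Ne.symm hl), TensorProduct.tmul_zero]
  · simp

/-- Completeness of the frame expands any family over the `b_{αj}`. For covariant `β` the
coefficients lie in the base, by `sum_partialD_mem_base`: there `∂_i` transforms by the dual of `ϰ`
and `β` by `ϰ`. -/
lemma eq_sum_bCoef_mul (β : Fin d → B) (j : Fin d) :
    β j = ∑ α, N.bCoef α j * ∑ i, N.partialD M i (N.fCoef α : B) * β i := by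
  simp only [Finset.mul_sum, ← mul_assoc]
  rw [Finset.sum_comm]
  simp only [← Finset.sum_mul, N.sum_bCoef_partialD M]
  simp

lemma isCovariant_bCoef_mul (α : Fin N.r) (w : P.base) :
    P.IsCovariant Q fun j => N.bCoef α j * w := by
  intro j
  rw [map_mul, N.bCoef_cov, (P.mem_base w).1 w.2, Finset.sum_mul]
  simp

end FrameStructure

/-! ### Invariance of `ω_P` and integration by parts -/

namespace FrameMeasure

variable {H : CompactQG A} {P : QPB A B} {Q : CoordForms A d} {N : FrameStructure P Q}
  {Sg : Type*} [Ring Sg] [StarRing Sg] [Algebra ℂ Sg] [StarModule ℂ Sg] {M : BraidedMetric Q Sg}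
  {VC : Type*} [CStarAlgebra VC] [PartialOrder VC] [StarOrderedRing VC]
  (μ : FrameMeasure H N M VC)

lemma omegaP_base (v : P.base) : μ.omegaP (v : B) = μ.state (μ.emb v) := by
  have h : P.intUp H (v : B) = v := Subtype.ext (P.vert_base H v)
  have e : μ.omegaP (v : B) = μ.state (μ.emb (P.intUp H (v : B))) := rfl
  rw [e, h]

lemma omegaP_vert (b : B) : μ.omegaP (P.vert H b) = μ.omegaP b := μ.omegaP_base (P.intUp H b)

lemma omegaP_faithful (b : B) (h : μ.omegaP (star b * b) = 0) : b = 0 := by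
  refine μ.vert_faithful b (μ.emb_injective ?_)
  rw [map_zero]
  exact μ.state_faithful _ (μ.vert_pos b) h

lemma lid_omegaP_rTensor (b : B) :
    TensorProduct.lid ℂ A (μ.omegaP.rTensor A (P.F b)) = μ.omegaP b • 1 := by
  have h : μ.omegaP ∘ₗ P.vert H = μ.omegaP := LinearMap.ext μ.omegaP_vert
  rw [← h, LinearMap.rTensor_comp, LinearMap.comp_apply, P.vert_rTensor, LinearMap.rTensor_tmul,
    TensorProduct.lid_tmul]
  rfl

lemma omegaP_slice (f : A →ₗ[ℂ] ℂ) (b : B) : μ.omegaP (P.slice f b) = μ.omegaP b * f 1 := by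
  have h : ∀ x : B ⊗[ℂ] A, μ.omegaP (TensorProduct.rid ℂ B (f.lTensor B x)) =
      f (TensorProduct.lid ℂ A (μ.omegaP.rTensor A x)) := by
    intro x
    induction x with
    | zero => simp
    | add x y hx hy => simp only [map_add, hx, hy]
    | tmul b c => simp [mul_comm]
  rw [P.slice_apply, h, lid_omegaP_rTensor, map_smul, smul_eq_mul]

/-- The frame expansion of `β` has base-valued coefficients on the right of the `b_{αj}`, which is
exactly the form of the homogeneity hypothesis. -/
lemma omegaP_divergence {β : Fin d → B} (hβ : P.IsCovariant Q β) :
    μ.omegaP (N.divergence M β) = 0 := by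
  have e : N.divergence M β = ∑ α, N.divergence M fun j => N.bCoef α j *
      (⟨_, N.sum_partialD_mem_base M hβ (N.fCoef α)⟩ : P.base) := by
    simp only [FrameStructure.divergence]
    conv_rhs => rw [Finset.sum_comm]
    refine Finset.sum_congr rfl fun i _ => ?_
    conv_rhs => rw [Finset.sum_comm]
    refine Finset.sum_congr rfl fun j _ => ?_
    rw [← Finset.smul_sum, ← map_sum, ← N.eq_sum_bCoef_mul M β j]
  rw [e, map_sum]
  refine Finset.sum_eq_zero fun α _ => ?_
  have h := N.divergence_mem_base M (N.isCovariant_bCoef_mul α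
    ⟨_, N.sum_partialD_mem_base M hβ (N.fCoef α)⟩)
  exact (μ.omegaP_base ⟨_, h⟩).trans (μ.homogeneous α _ ⟨_, h⟩ rfl)

lemma divergence_average (b : B) (a : Fin d) :
    N.divergence M (fun j => P.average H b (star (Q.rep j a))) =
      ∑ p, (Q.cHalf * Q.cHalf) a p • P.vert H (N.partialD M p b) := by
  have h1 : ∀ p, P.vert H (N.partialD M p b) =
      ∑ i, N.partialD M i (P.average H b (Q.repDual i p)) := fun p => by
    rw [P.vert_eq_slice, P.slice_apply, N.F_partialD_eq M, map_sum, map_sum]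
    refine Finset.sum_congr rfl fun i _ => ?_
    rw [P.average_apply]
    generalize P.F b = x
    induction x with
    | zero => simp
    | add x y hx hy => simp only [map_add, add_mul, hx, hy]
    | tmul b c => simp
  have h2 : ∀ i, ∑ j, (Q.cHalf * Q.cHalf) j i • star (Q.rep j a) =
      ∑ p, (Q.cHalf * Q.cHalf) a p • Q.repDual i p := fun i => by
    have h := congrFun (congrFun Q.matEt_mul_map_star i) a
    rw [CoordForms.matEt, ← Matrix.map_mul, ← Matrix.transpose_mul, Matrix.mul_apply,
      Matrix.mul_apply] at h
    simp only [Matrix.map_apply, Matrix.transpose_apply] at h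
    simp only [← Algebra.commutes _ (Q.repDual _ _), ← Algebra.smul_def] at h
    exact h
  simp only [h1, FrameStructure.divergence, Finset.smul_sum, ← map_smul, ← map_sum]
  rw [Finset.sum_comm]
  refine Finset.sum_congr rfl fun i _ => ?_
  rw [h2, map_sum, map_sum]

/-- The averages of `b` have divergences `∑ C_{ap} ∫_↑ ∂_p b`, whose integrals vanish for every `a`.
Invertibility of `C` isolates each `p`. -/
lemma omegaP_partialD (p : Fin d) (b : B) : μ.omegaP (N.partialD M p b) = 0 := by
  have h : ∀ a, ∑ p, (Q.cHalf * Q.cHalf) a p * μ.omegaP (N.partialD M p b) = 0 := fun a => by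
    have h := μ.omegaP_divergence (P.isCovariant_average Q H b a)
    rw [divergence_average] at h
    simpa only [map_sum, map_smul, omegaP_vert, smul_eq_mul] using h
  have h2 : (Q.cHalf * Q.cHalf) *ᵥ (fun p => μ.omegaP (N.partialD M p b)) = 0 := funext h
  have h3 : (Q.cHalfᵀ * Q.cHalfᵀ) * (Q.cHalf * Q.cHalf) = 1 := by
    rw [mul_assoc, ← mul_assoc Q.cHalfᵀ Q.cHalf, Q.cHalf_transpose_mul, one_mul,
      Q.cHalf_transpose_mul]
  have h4 := congrArg (fun v => (Q.cHalfᵀ * Q.cHalfᵀ) *ᵥ v) h2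
  simp only [Matrix.mulVec_mulVec, h3, Matrix.one_mulVec, Matrix.mulVec_zero] at h4
  exact congrFun h4 p

/-- Integration by parts. -/
lemma omegaP_star_mul_partialD (j : Fin d) (b q : B) : μ.omegaP (star b * N.partialD M j q) =
    -∑ n, Q.cHalf⁻¹ j n * μ.omegaP (star (N.partialD M n b) * q) := by
  have h := μ.omegaP_partialD j (star b * q)
  -- Invariance of `ω_P` replaces the twist by `ν_{lj}(1)`, so the twists in the Leibniz and star
  -- rules disappear under the integral.
  have htw : ∀ l x, μ.omegaP (P.twist Q l j x) = if l = j then μ.omegaP x else 0 := fun l x => by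
    have := μ.omegaP_slice (Q.nu l j) x
    rw [Q.nu_one] at this
    rw [show P.twist Q l j x = P.slice (Q.nu l j) x from rfl, this]
    split_ifs <;> simp
  have e : ∑ m, N.partialD M m (star b) * P.twist Q m j q =
      ∑ n, ∑ l, Q.cHalf⁻¹ l n • P.twist Q l j (star (N.partialD M n b) * q) := by
    simp only [N.partialD_star M, Finset.sum_mul, P.twist_mul, Finset.smul_sum, smul_mul_assoc]
    rw [Finset.sum_comm]
    exact Finset.sum_congr rfl fun i _ => Finset.sum_comm
  rw [N.partialD_mul M, e, map_add, map_sum] at h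
  simp only [map_sum, map_smul, htw, smul_eq_mul, mul_ite, mul_zero, Finset.sum_ite_eq',
    Finset.mem_univ, if_true] at h
  exact eq_neg_of_add_eq_zero_left h

end FrameMeasure

end Integration

end QRiem

namespace QRiem

/-! ### The curvature and the quantum Laplacian -/

section Laplacian

variable {A : Type*} [Ring A] [StarRing A] [HopfAlgebra ℂ A] [StarModule ℂ A] {d : ℕ}
  {B : Type*} [Ring B] [StarRing B] [Algebra ℂ B] [StarModule ℂ B]

namespace FrameStructure

variable {P : QPB A B} {Q : CoordForms A d} (N : FrameStructure P Q) {Sg : Type*} [Ring Sg]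
  [StarRing Sg] [Algebra ℂ Sg] [StarModule ℂ Sg] (M : BraidedMetric Q Sg)

lemma nablaS_tmul (b : B) (ϑ : M.VS) :
    N.nablaS M (b ⊗ₜ ϑ) = ∑ i, N.partialD M i b ⊗ₜ M.lmulE (Q.theta i) ϑ := by
  have e : N.nablaS M (b ⊗ₜ ϑ) =
    (M.lmulE.toLinearMap.flip ϑ).lTensor B (N.nabla (b ⊗ₜ 1)) := rfl
  rw [e, N.nabla_tmul_one M, map_sum]
  rfl

/-- The adjoint `-∑_i ∂_i ⊗ ι[θ_i]` of `∇`. -/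
def nablaAdj : Module.End ℂ (N.HorS M) :=
  -∑ i, TensorProduct.map (N.partialD M i) (M.iota i)

lemma nablaAdj_tmul (b : B) (ϑ : M.VS) :
    N.nablaAdj M (b ⊗ₜ ϑ) = -∑ i, N.partialD M i b ⊗ₜ M.iota i ϑ := by
  rw [nablaAdj, LinearMap.neg_apply, LinearMap.sum_apply]
  rfl

lemma nabla_nabla_tmul_one (b : B) : N.nabla (N.nabla (b ⊗ₜ 1)) =
    ∑ k, ∑ l, N.partialD M k (N.partialD M l b) ⊗ₜ (Q.theta k * Q.theta l) := by
  rw [N.nabla_tmul_one M, map_sum, Finset.sum_comm]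
  refine Finset.sum_congr rfl fun l _ => ?_
  have h := N.leibniz 0 _ (mem_horDeg_zero (N.partialD M l b)) (1 ⊗ₜ Q.theta l)
  rw [P.horMul_one_right, one_mul, N.nabla_theta, map_zero, smul_zero, add_zero,
    N.nabla_tmul_one M, map_sum, LinearMap.sum_apply] at h
  rw [h]
  exact Finset.sum_congr rfl fun k _ => P.horMul_one_right Q _ _ _

/-- In degree two `A_σ` is `1 - σ`; the factor `2` comes from the normalization of the components.
-/
lemma comp2_tmul_theta_mul (i j k l : Fin d) (b : B) :
    comp2 (P := P) M i j (b ⊗ₜ (Q.theta k * Q.theta l)) =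
      (2 : ℂ) • ((if (k, l) = (i, j) then b else 0) - M.sigma (i, j) (k, l) • b) := by
  have e : comp2 (P := P) M i j (b ⊗ₜ (Q.theta k * Q.theta l)) =
      (2 : ℂ) • (wordCoeff [i, j] (M.real (Q.theta k * Q.theta l)) • b) := by
    simp [comp2]
  have hmem : FreeAlgebra.ι ℂ k * FreeAlgebra.ι ℂ l ∈ homTens d (1 + 1) :=
    mul_mem_homTens (ι_mem_homTens k) (ι_mem_homTens l)
  have hA : antisymUp (legOp M.sigma) 0 1 = 1 - legOp M.sigma 0 := by
    simp [antisymUp, cosetUp]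
  have hw : ∀ p : Fin d × Fin d, wordCoeff [i, j] (FreeAlgebra.ι ℂ p.1 * FreeAlgebra.ι ℂ p.2) =
      if p = (i, j) then (1 : ℂ) else 0 := fun p => by
    have : FreeAlgebra.ι ℂ p.1 * FreeAlgebra.ι ℂ p.2 = word [p.1, p.2] := by simp [word_cons]
    rw [this, wordCoeff, onWords_word]
    simp [Prod.ext_iff]
  have hs := M.sg_zero_cons k l 1
  simp only [mul_one] at hs
  rw [e, CoordForms.theta, CoordForms.theta, ← map_mul, M.real_proj,
    antisym_eq_antisymUp _ 1 _ hmem, hA, LinearMap.sub_apply, Module.End.one_apply, map_sub,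
    hw (k, l)]
  change (2 : ℂ) • (((if (k, l) = (i, j) then (1 : ℂ) else 0) - wordCoeff [i, j] (M.sg 0 _)) • b) = _
  rw [hs, map_sum]
  simp only [map_smul, hw, smul_eq_mul, mul_ite, mul_one, mul_zero, Finset.sum_ite_eq',
    Finset.mem_univ, if_true, sub_smul, ite_smul, one_smul, zero_smul]

lemma comp2_mul_left (i j : Fin d) (b : B) (ψ : P.Hor Q) :
    comp2 M i j (P.horMul Q (b ⊗ₜ 1) ψ) = b * comp2 M i j ψ := by
  induction ψ using TensorProduct.induction_on with
  | zero => simp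
  | add x y hx hy => simp only [map_add, hx, hy, mul_add]
  | tmul q η =>
    rw [P.horMul_one_left]
    simp [comp2]

lemma curvTerm_eq {ϱ : A →ₗ[ℂ] P.Hor Q} (hϱ : N.IsCurvature ϱ) (i j : Fin d) (b : B) :
    curvTerm M ϱ i j b = -comp2 M i j (N.nabla (N.nabla (b ⊗ₜ 1))) := by
  rw [hϱ.2 b, map_neg, neg_neg, curvTerm]
  generalize P.F b = x
  induction x with
  | zero => simp
  | add x y hx hy => simp only [map_add, hx, hy]
  | tmul b c =>
    rw [LinearMap.lTensor_tmul, LinearMap.mul'_apply, LinearMap.comp_apply, ← comp2_mul_left]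
    rfl

/-- Up to sign, the curvature term is the component of `∇² b = ∑ ∂_k ∂_l(b) ⊗ θ_k θ_l` under `1 -
σ`: a braided commutator of the vector fields. -/
lemma half_smul_curvTerm {ϱ : A →ₗ[ℂ] P.Hor Q} (hϱ : N.IsCurvature ϱ) (i j : Fin d) (b : B) :
    (1 / 2 : ℂ) • curvTerm M ϱ i j b = (∑ k, ∑ l, M.sigma (i, j) (k, l) •
      N.partialD M k (N.partialD M l b)) - N.partialD M i (N.partialD M j b) := by
  rw [N.curvTerm_eq M hϱ, N.nabla_nabla_tmul_one M]
  simp only [map_sum, comp2_tmul_theta_mul, ← Finset.smul_sum, Finset.sum_sub_distrib]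
  rw [← smul_neg, smul_smul, show (1 / 2 : ℂ) * 2 = 1 by norm_num, one_smul, neg_sub]
  congr 1
  simp only [Prod.mk.injEq]
  rw [Finset.sum_eq_single i, Finset.sum_eq_single j]
  · simp
  · intro l _ hl; simp [hl]
  · simp
  · intro k _ hk; simp [hk]
  · simp

lemma laplacian_tmul {ϱ : A →ₗ[ℂ] P.Hor Q} (hϱ : N.IsCurvature ϱ) (b : B) (ϑ : M.VS) :
    (N.nablaS M * N.nablaAdj M + N.nablaAdj M * N.nablaS M) (b ⊗ₜ ϑ) =
      -(∑ i, ∑ j, N.partialD M i (N.partialD M j b) ⊗ₜ[ℂ] M.lmulS (M.g i j) ϑ) +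
        (1 / 2 : ℂ) • ∑ i, ∑ j, curvTerm M ϱ i j b ⊗ₜ[ℂ] M.lmulE (Q.theta i) (M.iota j ϑ) := by
  have h1 : (N.nablaS M * N.nablaAdj M) (b ⊗ₜ ϑ) = -∑ i, ∑ j,
      N.partialD M i (N.partialD M j b) ⊗ₜ M.lmulE (Q.theta i) (M.iota j ϑ) := by
    rw [Module.End.mul_apply, nablaAdj_tmul, map_neg, map_sum, Finset.sum_comm]
    simp only [nablaS_tmul]
  have h2 : (N.nablaAdj M * N.nablaS M) (b ⊗ₜ ϑ) = -∑ i, ∑ j,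
      N.partialD M i (N.partialD M j b) ⊗ₜ M.iota i (M.lmulE (Q.theta j) ϑ) := by
    rw [Module.End.mul_apply, nablaS_tmul, map_sum, Finset.sum_comm]
    simp only [nablaAdj_tmul, Finset.sum_neg_distrib]
  -- The Clifford relation separates the metric term; its braided remainder combines with the terms
  -- of `h1` into the curvature in `h5`.
  have h3 : ∀ i j, M.iota i (M.lmulE (Q.theta j) ϑ) = M.lmulS (M.g i j) ϑ -
      ∑ k, ∑ l, M.sigma (k, l) (i, j) • M.lmulE (Q.theta k) (M.iota l ϑ) := fun i j => by
    rw [← M.iota_lmulE i j ϑ, Fintype.sum_prod_type, add_sub_cancel_right]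
  have h4 : ∑ i, ∑ j, N.partialD M i (N.partialD M j b) ⊗ₜ[ℂ]
      ∑ k, ∑ l, M.sigma (k, l) (i, j) • M.lmulE (Q.theta k) (M.iota l ϑ) =
      ∑ k, ∑ l, (∑ i, ∑ j, M.sigma (k, l) (i, j) • N.partialD M i (N.partialD M j b)) ⊗ₜ[ℂ]
        M.lmulE (Q.theta k) (M.iota l ϑ) := by
    simp only [TensorProduct.tmul_sum, TensorProduct.sum_tmul, TensorProduct.tmul_smul,
      TensorProduct.smul_tmul']
    exact CoordForms.sum4_comm _
  have h5 : (1 / 2 : ℂ) • ∑ i, ∑ j, curvTerm M ϱ i j b ⊗ₜ[ℂ]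
      M.lmulE (Q.theta i) (M.iota j ϑ) = ∑ k, ∑ l, (∑ i, ∑ j, M.sigma (k, l) (i, j) •
        N.partialD M i (N.partialD M j b)) ⊗ₜ[ℂ] M.lmulE (Q.theta k) (M.iota l ϑ) -
      ∑ i, ∑ j, N.partialD M i (N.partialD M j b) ⊗ₜ[ℂ] M.lmulE (Q.theta i) (M.iota j ϑ) := by
    simp only [Finset.smul_sum, TensorProduct.smul_tmul', N.half_smul_curvTerm M hϱ,
      TensorProduct.sub_tmul, Finset.sum_sub_distrib]
  rw [LinearMap.add_apply, h1, h2, h5, ← h4]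
  simp only [h3, TensorProduct.tmul_sub, Finset.sum_sub_distrib]
  abel

end FrameStructure

/-! ### The scalar product: adjoint of `∇` and the Hodge formula -/

namespace FrameMeasure

variable {H : CompactQG A} {P : QPB A B} {Q : CoordForms A d} {N : FrameStructure P Q}
  {Sg : Type*} [Ring Sg] [StarRing Sg] [Algebra ℂ Sg] [StarModule ℂ Sg] {M : BraidedMetric Q Sg}
  {VC : Type*} [CStarAlgebra VC] [PartialOrder VC] [StarOrderedRing VC]
  (μ : FrameMeasure H N M VC)

lemma sp_tmul (b q : B) (ϑ η : M.VS) : μ.sp (b ⊗ₜ ϑ) (q ⊗ₜ η) =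
    μ.omegaP (star b * q) • M.gWedge (M.starV ϑ) η := rfl

lemma sp_add_left (φ φ' ψ : N.HorS M) : μ.sp (φ + φ') ψ = μ.sp φ ψ + μ.sp φ' ψ := by
  simp [sp]

lemma sp_add_right (φ ψ ψ' : N.HorS M) : μ.sp φ (ψ + ψ') = μ.sp φ ψ + μ.sp φ ψ' := by
  simp [sp]

lemma sp_zero_left (ψ : N.HorS M) : μ.sp 0 ψ = 0 := by simp [sp]

lemma sp_zero_right (φ : N.HorS M) : μ.sp φ 0 = 0 := by simp [sp]

/-- Integration by parts contributes `C^{-1/2}_{jn}`, which sums the `θ_j` to `θ_n^*`;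
multiplication by `θ_n^*` is then transposed to `ι[θ_n]`. -/
lemma nablaAdj_isFormalAdjoint : μ.IsFormalAdjoint (N.nablaS M) (N.nablaAdj M) := by
  intro φ ψ
  induction φ using TensorProduct.induction_on with
  | zero => simp [sp_zero_left]
  | add x y hx hy => simp only [map_add, sp_add_left, hx, hy]
  | tmul b ϑ =>
    induction ψ using TensorProduct.induction_on with
    | zero => simp [sp_zero_right]
    | add x y hx hy => simp only [map_add, sp_add_right, hx, hy]
    | tmul q η =>
      have hl : ∀ (f : Fin d → N.HorS M) (φ : N.HorS M), μ.sp φ (∑ i, f i) = ∑ i, μ.sp φ (f i) :=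
        fun f φ => by simp [sp]
      have hr : ∀ (f : Fin d → N.HorS M) (ψ : N.HorS M),
          μ.sp (-∑ i, f i) ψ = -∑ i, μ.sp (f i) ψ :=
        fun f ψ => by simp [sp, LinearMap.sum_apply]
      rw [N.nablaS_tmul M, N.nablaAdj_tmul M, hl, hr]
      simp only [sp_tmul, omegaP_star_mul_partialD, ← M.gWedge_starV_iota, neg_smul,
        Finset.sum_neg_distrib, Finset.sum_smul]
      congr 1
      rw [Finset.sum_comm]
      refine Finset.sum_congr rfl fun n _ => ?_
      have e : M.lmulE (Q.thetaStar n) η = ∑ j, Q.cHalf⁻¹ j n • M.lmulE (Q.theta j) η := by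
        simp only [CoordForms.thetaStar, map_sum, map_smul, LinearMap.sum_apply,
          LinearMap.smul_apply]
      rw [e, map_sum, Finset.smul_sum]
      refine Finset.sum_congr rfl fun j _ => ?_
      rw [map_smul, smul_smul, mul_comm]

lemma starFactor_starFactor (φ : N.HorS M) : μ.starFactor (μ.starFactor φ) = φ := by
  have e : ∀ (b : B) (ϑ : M.VS), μ.starFactor (b ⊗ₜ ϑ) = star b ⊗ₜ M.starV ϑ := fun _ _ => rfl
  induction φ using TensorProduct.induction_on with
  | zero => simp
  | add x y hx hy => simp only [map_add, hx, hy]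
  | tmul b ϑ => rw [e, e, star_star, M.starV_starV]

lemma eq_zero_of_sp (φ : N.HorS M) (h : ∀ ψ, μ.sp φ ψ = 0) : φ = 0 := by
  classical
  -- Integrating the factor in `ℬ` against a fixed `q` leaves an element of `𝕍_Σ^∧` orthogonal to
  -- everything, so the two factors can be treated one after the other.
  have h1 : ∀ q : B, TensorProduct.lid ℂ M.VS
      ((μ.omegaP ∘ₗ LinearMap.mulRight ℂ q).rTensor M.VS (μ.starFactor φ)) = 0 := by
    intro q
    refine M.eq_zero_of_gWedge _ fun η => ?_
    rw [← h (q ⊗ₜ η), sp]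
    generalize μ.starFactor φ = χ
    induction χ using TensorProduct.induction_on with
    | zero => simp
    | add x y hx hy => simp only [map_add, LinearMap.add_apply, hx, hy]
    | tmul b ϑ => simp
  let bas := Module.Basis.ofVectorSpace ℂ M.VS
  have h2 : μ.starFactor φ = 0 := by
    refine (TensorProduct.equivFinsuppOfBasisRight bas).injective ?_
    rw [map_zero]
    ext k
    rw [TensorProduct.equivFinsuppOfBasisRight_apply, Finsupp.zero_apply]
    set c := TensorProduct.rid ℂ B ((bas.coord k).lTensor B (μ.starFactor φ)) with hc
    have h3 : ∀ (q : B) (χ : N.HorS M), bas.coord k (TensorProduct.lid ℂ M.VS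
        ((μ.omegaP ∘ₗ LinearMap.mulRight ℂ q).rTensor M.VS χ)) =
        μ.omegaP (TensorProduct.rid ℂ B ((bas.coord k).lTensor B χ) * q) := by
      intro q χ
      induction χ using TensorProduct.induction_on with
      | zero => simp
      | add x y hx hy => simp only [map_add, add_mul, hx, hy]
      | tmul b ϑ => simp [mul_comm]
    -- The coordinate `c` in `ℬ` satisfies `ω_P(c q) = 0` for all `q`. The choice `q = c^*` brings
    -- in faithfulness, applied to `c^*`.
    have h4 := h3 (star c) (μ.starFactor φ)
    rw [h1, map_zero, ← hc] at h4
    have h5 := μ.omegaP_faithful (star c) (by rw [star_star]; exact h4.symm)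
    rw [← star_star c, h5, star_zero]
  rw [← μ.starFactor_starFactor φ, h2, map_zero]

lemma isFormalAdjoint_iff (D : Module.End ℂ (N.HorS M)) :
    μ.IsFormalAdjoint (N.nablaS M) D ↔ D = N.nablaAdj M := by
  refine ⟨fun hD => LinearMap.ext fun φ => ?_, fun h => h ▸ μ.nablaAdj_isFormalAdjoint⟩
  rw [← sub_eq_zero]
  refine μ.eq_zero_of_sp _ fun ψ => ?_
  have h : D φ = D φ - N.nablaAdj M φ + N.nablaAdj M φ := (sub_add_cancel _ _).symm
  have h2 := hD φ ψ
  rw [h, sp_add_left, ← μ.nablaAdj_isFormalAdjoint φ ψ] at h2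
  exact right_eq_add.1 h2

lemma sp_eq_intP (vol : Q.Ext →ₗ[ℂ] ℂ) (hodge : M.VS →ₗ[ℂ] M.VS) (hh : IsHodge M vol hodge)
    (φ ψ : N.HorS M) : μ.sp φ ψ = μ.intP vol (P.crossMul M.mulV M.circV
      (P.crossStar M.starV M.circV φ) (hodge.lTensor B ψ)) := by
  induction φ using TensorProduct.induction_on with
  | zero => simp [sp_zero_left]
  | add x y hx hy => simp only [map_add, LinearMap.add_apply, sp_add_left, hx, hy]
  | tmul b ϑ =>
    induction ψ using TensorProduct.induction_on with
    | zero => simp [sp_zero_right]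
    | add x y hx hy => simp only [map_add, sp_add_right, hx, hy]
    | tmul q η =>
      -- The factor in `𝒜` acts only on `ϑ^*`, so the integral of the product sees `x = F(b^* q)`
      -- only through `ω_P ⊗ id`. By invariance this is a multiple of `1`, which acts trivially.
      have e : ∀ x : B ⊗[ℂ] A, μ.intP vol ((M.mulV.flip (hodge η) ∘ₗ
          M.circV (M.starV ϑ)).lTensor B x) = TensorProduct.rid ℂ Sg (vol.lTensor Sg
          (M.mulV (M.circV (M.starV ϑ) (TensorProduct.lid ℂ A (μ.omegaP.rTensor A x)))
            (hodge η))) := by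
        intro x
        induction x with
        | zero => simp
        | add x y hx hy => simp only [map_add, LinearMap.add_apply, hx, hy]
        | tmul b c =>
          simp only [intP, LinearMap.lTensor_tmul, LinearMap.rTensor_tmul, LinearMap.comp_apply,
            TensorProduct.map_tmul, LinearEquiv.coe_coe, TensorProduct.lid_tmul, map_smul,
            LinearMap.smul_apply, LinearMap.flip_apply]
      rw [LinearMap.lTensor_tmul, P.crossMul_crossStar M.starV M.circV M.circV_mul, e,
        lid_omegaP_rTensor, map_smul, M.circV_one, map_smul, LinearMap.smul_apply, map_smul,
        map_smul, ← hh, sp_tmul]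

end FrameMeasure

end Laplacian

end QRiem

end

theorem mainTheorem4 {A : Type*} [Ring A] [StarRing A] [HopfAlgebra ℂ A] [StarModule ℂ A]
    (H : QRiem.CompactQG A) {d : ℕ} (Q : QRiem.CoordForms A d)
    {B : Type*} [Ring B] [StarRing B] [Algebra ℂ B] [StarModule ℂ B]
    {P : QRiem.QPB A B} (N : QRiem.FrameStructure P Q)
    {Sg : Type*} [Ring Sg] [StarRing Sg] [Algebra ℂ Sg] [StarModule ℂ Sg]
    (M : QRiem.BraidedMetric Q Sg)
    {VC : Type*} [CStarAlgebra VC] [PartialOrder VC] [StarOrderedRing VC]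
    (μ : QRiem.FrameMeasure H N M VC)
    (ϱ : A →ₗ[ℂ] P.Hor Q) (hϱ : N.IsCurvature ϱ) :
    (∀ (vol : Q.Ext →ₗ[ℂ] ℂ) (hodge : M.VS →ₗ[ℂ] M.VS), QRiem.IsVolume Q vol →
      QRiem.IsHodge M vol hodge → ∀ φ ψ : N.HorS M,
        μ.sp φ ψ = μ.intP vol (P.crossMul M.mulV M.circV (P.crossStar M.starV M.circV φ)
          (hodge.lTensor B ψ))) ∧
    ∃ D : Module.End ℂ (N.HorS M),
      (∀ D', μ.IsFormalAdjoint (N.nablaS M) D' ↔ D' = D) ∧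
      ∀ (b : B) (ϑ : M.VS),
        (N.nablaS M * D + D * N.nablaS M) (b ⊗ₜ[ℂ] ϑ) =
          -(∑ i, ∑ j, N.partialD M i (N.partialD M j b) ⊗ₜ[ℂ] M.lmulS (M.g i j) ϑ) +
            (1 / 2 : ℂ) • ∑ i, ∑ j, QRiem.FrameStructure.curvTerm M ϱ i j b ⊗ₜ[ℂ]
              M.lmulE (Q.theta i) (M.iota j ϑ) := by
  refine ⟨fun vol hodge _ hh φ ψ => μ.sp_eq_intP vol hodge hh φ ψ, N.nablaAdj M,
    μ.isFormalAdjoint_iff, fun b ϑ => N.laplacian_tmul M hϱ b ϑ⟩
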